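/- **Model.** A network is a finite simple graph $G=(V,E)$ whose nodes number their incident edges (ports) arbitrarily. In a deterministic CONGEST algorithm with $B$-bit messages all nodes run the same deterministic program; in every synchronous round each node sends one $B$-bit message through each port, receives one through each port, and performs arbitrary local computation. $G^k$ is the graph on $V$ in which distinct $u,v$ are adjacent iff $d_G(u,v)\le k$. A $(c,d)$ network decomposition of a graph $H$ is a partition of its vertices into blocks (colors) $V_1,\dots,V_c$ such that every connected component (cluster) of every $H[V_i]$ has diameter at most $d$ in $H[V_i]$. (For $H=G^k$ the clusters need not be connected in $G$.) Computing it means that every node outputs its color and a cluster identifier that is the given identifier of some node of the cluster and differs between different clusters. $\log^* S$ is the number of times $\log_2$ has to be applied to $S$ until the value is at most $1$. **Theorem.** There are a function $g:\mathbb N\to\mathbb N$ with $g(N)=2^{O(\sqrt{\log N})}$ and a deterministic CONGEST algorithm with $O(S)$-bit messages ($N$, $S$, $k$ and, in (3), $r$ are known to all nodes) such that for all $N,S$ and all $k\ge 1$: 1. In every $N$-node network $G$ with distinct $S$-bit identifiers, where each node initially knows only its own identifier and its degree, the algorithm computes a $(g(N),g(N))$ network decomposition of $G^k$ in $k\,g(N)\log^*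 S$ rounds. 2. Afterwards, one round of communication within the clusters of $G^k$, that is, a convergecast and a broadcast in all clusters simultaneously, can be simulated in $k\cdot 2^{O(\sqrt{\log N})}$ rounds on $G$ with $O(S)$-bit messages: for every $a$ and every commutative monoid $M$ with $|M|\le 2^{aS}$, if every node $v$ holds a value $x_v\in M$, then after $a\,k\,g(N)$ rounds every node $v$ knows $\prod_{u\in C} x_u$, where $C$ is the cluster of $v$. 3. Suppose that, instead, the nodes of a network $G$ with any number of nodes are initially partitioned into $N$ clusters, each with a center such that every node of the cluster is joined to the center by a path of length at most $r$ inside the cluster ($r\ge 1$), that the centers have distinct $S$-bit identifiers, and that each node initially knows only the identifier of the center of its cluster, whether it is this center, and its degree. Then the algorithm computes a $(g(N), r\,g(N))$ network decomposition of $G^k$ in $k\,r\,g(N)\log^* S$ rounds, each of whose clusters is a union of initial clusters and is identified by the center identifier of one of them. -/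

import Mathlib

/-- The iterated binary logarithm: how often `log₂` has to be applied to `n` until the value is at
most `1`. (Rounding up after each application does not change the count, since the thresholds
`1, 2, 4, 16, …` are integers.) -/
def logStar (n : ℕ) : ℕ :=
  if n ≤ 1 then 0 else logStar (Nat.clog 2 n) + 1
termination_by n
decreasing_by
  have h : Nat.clog 2 n ≤ n - 1 :=
    Nat.clog_le_of_le_pow (by have := @Nat.lt_two_pow_self (n - 1); omega)
  omega

/-- `g(N) = 2^{O(√log N)}`. -/
def IsTwoPowBigOSqrtLog (g : ℕ → ℕ) : Prop :=
  ∃ C : ℝ, ∀ᶠ N : ℕ in Filter.atTop, (g N : ℝ) ≤ 2 ^ (C * √(Real.logb 2 N))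

/-! ### The synchronous message passing model with `B`-bit messages -/

/-- The neighbours of every node `v` are numbered `0, …, deg v - 1` in an arbitrary way. -/
structure PortNumbering {V : Type} (G : SimpleGraph V) where
  deg : V → ℕ
  nbr : ∀ v, Fin (deg v) ≃ G.neighborSet v

/-- A deterministic CONGEST algorithm with `B`-bit messages. All nodes run the same program. A node
starts with a local input and the number of its ports. In each round it sends one `B`-bit message
through each port, receives one through each port, and updates its state; local computation is not
restricted. -/
structure CongestAlgorithm (Input Output : Type) (B : ℕ) where
  State : Type
  init : Input → (deg : ℕ) → State
  send : State → (port : ℕ) → BitVec B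
  receive : State → (deg : ℕ) → (Fin deg → BitVec B) → State
  output : State → Output

namespace CongestAlgorithm

variable {Input Output : Type} {B : ℕ} {V : Type} {G : SimpleGraph V}

/-- The states of all nodes after `t` rounds. What `v` receives through port `i` is what its `i`-th
neighbour `u` sends through the port of `u` that leads to `v`. -/
def run (A : CongestAlgorithm Input Output B) (P : PortNumbering G) (x : V → Input) :
    ℕ → V → A.State
  | 0, v => A.init (x v) (P.deg v)
  | t + 1, v => A.receive (run A P x t v) (P.deg v) fun i =>
      A.send (run A P x t (P.nbr v i))
        ((P.nbr (P.nbr v i)).symm ⟨v, (P.nbr v i).2.symm⟩)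

/-- The outputs of all nodes after `t` rounds. -/
def result (A : CongestAlgorithm Input Output B) (P : PortNumbering G) (x : V → Input)
    (t : ℕ) (v : V) : Output :=
  A.output (A.run P x t v)

end CongestAlgorithm

/-! ### Network decompositions -/

/-- The `k`-th power of `G`: two distinct nodes are adjacent if their distance in `G` is at
most `k`. -/
def powerGraph {V : Type} (G : SimpleGraph V) (k : ℕ) : SimpleGraph V where
  Adj u v := u ≠ v ∧ G.edist u v ≤ k
  symm := ⟨fun u v h => ⟨h.1.symm, by rw [SimpleGraph.edist_comm]; exact h.2⟩⟩
  loopless := ⟨fun _ h => h.1 rfl⟩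

/-- The disjoint union of the induced subgraphs `H[V_i]`, where the block `V_i` consists of the
nodes of color `i`. -/
def blockGraph {V : Type} (H : SimpleGraph V) (color : V → ℕ) : SimpleGraph V where
  Adj u v := H.Adj u v ∧ color u = color v
  symm := ⟨fun _ _ h => ⟨h.1.symm, h.2.symm⟩⟩
  loopless := ⟨fun _ h => h.1.ne rfl⟩

/-- The clusters are the connected components of the graphs `H[V_i]`. -/
def SameCluster {V : Type} (H : SimpleGraph V) (color : V → ℕ) (u v : V) : Prop :=
  (blockGraph H color).Reachable u v

open Classical in
/-- The cluster of the node `v`. -/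
noncomputable def clusterOf {V : Type} [Fintype V] (H : SimpleGraph V) (color : V → ℕ) (v : V) :
    Finset V :=
  Finset.univ.filter (SameCluster H color v)

/-- `color` is a `(c, d)` network decomposition of `H`: the nodes are partitioned into `c` blocks
`V_i`, and each connected component of each `H[V_i]` has diameter at most `d`. -/
structure IsNetworkDecomposition {V : Type} (H : SimpleGraph V) (c d : ℕ) (color : V → ℕ) :
    Prop where
  color_lt : ∀ v, color v < c
  diam_le : ∀ u v, SameCluster H color u v → (blockGraph H color).dist u v ≤ d

/-- The nodes hold a `(c, d)` network decomposition of `H`: each node outputs its color and an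
identifier of its cluster. Different clusters have different identifiers, and the identifier of a
cluster is one of the identifiers `ident w` that its nodes `w` were given. -/
structure OutputsDecomposition {V : Type} {S : ℕ} (H : SimpleGraph V) (c d : ℕ)
    (ident : V → BitVec S) (out : V → ℕ × BitVec S) : Prop where
  decomposition : IsNetworkDecomposition H c d fun v => (out v).1
  label_eq_iff : ∀ u v, (out u).2 = (out v).2 ↔ SameCluster H (fun w => (out w).1) u v
  label_mem : ∀ v, ∃ w, SameCluster H (fun w => (out w).1) v w ∧ (out v).2 = ident w

/-- A partition of the nodes of `G` into clusters with centers, where `center v` is the center of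
the cluster of `v`; every node is reached from the center of its cluster by a path of length at
most `r` inside the cluster. -/
structure IsClustering {V : Type} (G : SimpleGraph V) (r : ℕ) (center : V → V) : Prop where
  center_center : ∀ v, center (center v) = center v
  radius_le : ∀ v, ∃ p : G.Walk (center v) v, p.length ≤ r ∧ ∀ w ∈ p.support, center w = center v

open Classical in
/-- The initial knowledge of a node, given a clustering: the identifier of the center of its
cluster, and whether it is this center itself. -/
noncomputable def clusterInput {V : Type} {S : ℕ} (ident : V → BitVec S) (center : V → V) (v : V) :
    BitVec S × Bool :=
  (ident (center v), decide (center v = v))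

/-!
Write `s` for roughly `√(log₂ N)` and `d = 2 ^ (s + 1)`. All nodes start in active clusters, and
each of `s` levels divides the number of active clusters by `2 ^ s`, so that no active cluster is
left at the end.

In a level, every active cluster has out-edges to the active clusters near to it, but only to the
`d` of them with the smallest labels. A cluster is heavy if it has at least `d ^ 2` in-neighbors;
double counting shows that at most a fraction `1 / d` of the active clusters is heavy. Among those
without a heavy cluster near to them, sharing an out-neighbor is a relation of degree at most
`d ^ 3`. Color reduction by polynomials over a finite field finds, in `O(log* S)` steps, a proper
coloring of it with `2 ^ O(s)` colors, and hence a maximal independent set of the clusters of high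
out-degree. The members of that set have `d` out-neighbors each, without overlap, so they too are at
most a fraction `1 / d` of the active clusters. The heavy clusters and the independent set become
the centers, and two rounds of absorption merge the clusters around them into theirs. A cluster that
is not absorbed has low degree and no heavy cluster near to it. If two such clusters are near to
each other, they share an out-neighbor, as a cluster of low degree has out-edges to all active
clusters near to it, itself included. Hence the coloring separates them.

The radius of the clusters in `G ^ k` grows by a constant factor in each level. Clusters communicate
through nodes that relay their labels. Each absorption adds at most one label to every node, as it
follows a Voronoi partition around the centers, so that no node ever relays more than `1 + 2 * s`
labels, and congestion costs only a small factor. Since the relays of a label are connected in `G`,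
they contain a breadth first search tree, along which values are aggregated.
-/

namespace CongestAlgorithm

variable {α β γ E : Type} {B : ℕ} {V : Type} {G : SimpleGraph V}

/-- The algorithm `A` with its input and its output changed by local functions. -/
def dimap {α' β' : Type} (A : CongestAlgorithm α β B) (f : α' → α) (h : β → β') :
    CongestAlgorithm α' β' B where
  State := A.State
  init x deg := A.init (f x) deg
  send := A.send
  receive := A.receive
  output s := h (A.output s)

theorem run_dimap {α' β' : Type} (A : CongestAlgorithm α β B) (f : α' → α) (h : β → β')
    (P : PortNumbering G) (x : V → α') (t : ℕ) :
    (A.dimap f h).run P x t = A.run P (f ∘ x) t := by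
  induction t with
  | zero => rfl
  | succ t ih => funext v; simp only [run, ih]; rfl

theorem result_dimap {α' β' : Type} (A : CongestAlgorithm α β B) (f : α' → α) (h : β → β')
    (P : PortNumbering G) (x : V → α') (t : ℕ) :
    (A.dimap f h).result P x t = h ∘ A.result P (f ∘ x) t := by
  funext v
  rw [result, run_dimap]
  rfl

/-- The algorithm that applies `f` at every node, without communication. -/
def idle (f : α → β) : CongestAlgorithm α β B where
  State := α
  init x _ := x
  send _ _ := 0
  receive s _ _ := s
  output := f

theorem run_idle (f : α → β) (P : PortNumbering G) (x : V → α) (t : ℕ) :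
    (idle f : CongestAlgorithm α β B).run P x t = x := by
  induction t with
  | zero => rfl
  | succ t ih => funext v; simp only [run, ih]; rfl

theorem result_idle (f : α → β) (P : PortNumbering G) (x : V → α) (t : ℕ) :
    (idle f : CongestAlgorithm α β B).result P x t = f ∘ x := by
  funext v
  rw [result, run_idle]
  rfl

/-- The state of `seq` when `n` rounds of the first algorithm are still to be run. -/
def seqState (A : CongestAlgorithm α β B) (A' : CongestAlgorithm β γ B) (deg : ℕ) :
    ℕ → A.State → (ℕ × A.State) ⊕ A'.State
  | 0, s => .inr (A'.init (A.output s) deg)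
  | n + 1, s => .inl (n, s)

/-- The algorithm that runs `A` for `T` rounds, and then `A'` on the outputs of `A`. -/
def seq (A : CongestAlgorithm α β B) (A' : CongestAlgorithm β γ B) (T : ℕ) :
    CongestAlgorithm α γ B where
  State := (ℕ × A.State) ⊕ A'.State
  init x deg := seqState A A' deg T (A.init x deg)
  send s port := match s with
    | .inl (_, s) => A.send s port
    | .inr s => A'.send s port
  receive s deg m := match s with
    | .inl (n, s) => seqState A A' deg n (A.receive s deg m)
    | .inr s => .inr (A'.receive s deg m)
  output s := match s with
    | .inl (_, s) => A'.output (A'.init (A.output s) 0)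
    | .inr s => A'.output s

theorem run_seq_of_add_eq (A : CongestAlgorithm α β B) (A' : CongestAlgorithm β γ B)
    (P : PortNumbering G) (x : V → α) {T t n : ℕ} (h : t + n = T) (v : V) :
    (A.seq A' T).run P x t v = seqState A A' (P.deg v) n (A.run P x t v) := by
  induction t generalizing n v with
  | zero => rw [Nat.zero_add] at h; subst h; rfl
  | succ t ih =>
    have ih' := fun v => ih (n := n + 1) (by omega) v
    simp only [run, ih']
    rfl

theorem run_seq_add (A : CongestAlgorithm α β B) (A' : CongestAlgorithm β γ B)
    (P : PortNumbering G) (x : V → α) (T t : ℕ) (v : V) :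
    (A.seq A' T).run P x (T + t) v = .inr (A'.run P (A.result P x T) t v) := by
  induction t generalizing v with
  | zero => exact run_seq_of_add_eq A A' P x (add_zero T) v
  | succ t ih =>
    rw [← Nat.add_assoc]
    simp only [run, ih]
    rfl

theorem result_seq (A : CongestAlgorithm α β B) (A' : CongestAlgorithm β γ B)
    (P : PortNumbering G) (x : V → α) (T t : ℕ) :
    (A.seq A' T).result P x (T + t) = A'.result P (A.result P x T) t := by
  funext v
  rw [result, run_seq_add]
  rfl

/-- The algorithm in which every node spells out the code `enc (s x)` of a set, one message per
round and the same message through all ports, and learns the union of the sets that it decodes from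
its ports. A state consists of the input, the degree, the number of the round, and the messages
received so far, by port and round. -/
noncomputable def gather (enc : Set E → ℕ → BitVec B) (dec : (ℕ → BitVec B) → Set E)
    (s : α → Set E) (upd : α → Set E → β) : CongestAlgorithm α β B where
  State := α × ℕ × ℕ × (ℕ → ℕ → BitVec B)
  init x deg := (x, deg, 0, fun _ _ => 0)
  send σ _ := enc (s σ.1) σ.2.2.1
  receive σ deg m := (σ.1, deg, σ.2.2.1 + 1, fun p j =>
    if j = σ.2.2.1 then (if h : p < deg then m ⟨p, h⟩ else 0) else σ.2.2.2 p j)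
  output σ := upd σ.1 {e | ∃ p < σ.2.1, e ∈ dec (σ.2.2.2 p)}

theorem exists_run_gather_eq (enc : Set E → ℕ → BitVec B) (dec : (ℕ → BitVec B) → Set E)
    (s : α → Set E) (upd : α → Set E → β) (P : PortNumbering G) (x : V → α) (t : ℕ) (v : V) :
    ∃ buf : ℕ → ℕ → BitVec B, (gather enc dec s upd).run P x t v = (x v, P.deg v, t, buf) ∧
      ∀ i : Fin (P.deg v), ∀ j < t, buf i j = enc (s (x (P.nbr v i))) j := by
  induction t generalizing v with
  | zero => exact ⟨_, rfl, fun _ _ h => absurd h (Nat.not_lt_zero _)⟩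
  | succ t ih =>
    choose buf hrun hbuf using ih
    simp only [run, hrun]
    refine ⟨_, rfl, fun i j hj => ?_⟩
    by_cases h : j = t
    · simp [gather, h]
    · simpa only [h, if_false] using hbuf v i j (by omega)

theorem result_gather {enc : Set E → ℕ → BitVec B} {dec : (ℕ → BitVec B) → Set E}
    {s : α → Set E} {T : ℕ}
    (hdec : ∀ a (f : ℕ → BitVec B), (∀ j < T, f j = enc (s a) j) → dec f = s a)
    (upd : α → Set E → β) (P : PortNumbering G) (x : V → α) :
    (gather enc dec s upd).result P x T =
      fun v => upd (x v) {e | ∃ u, G.Adj v u ∧ e ∈ s (x u)} := by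
  funext v
  obtain ⟨buf, hrun, hbuf⟩ := exists_run_gather_eq enc dec s upd P x T v
  have hport : ∀ i : Fin (P.deg v), dec (buf i) = s (x (P.nbr v i)) := fun i =>
    hdec _ _ (hbuf i)
  have hunion : {e | ∃ p < P.deg v, e ∈ dec (buf p)} = {e | ∃ u, G.Adj v u ∧ e ∈ s (x u)} := by
    ext e
    constructor
    · rintro ⟨p, hp, he⟩
      exact ⟨_, (P.nbr v ⟨p, hp⟩).2, hport ⟨p, hp⟩ ▸ he⟩
    · rintro ⟨u, hu, he⟩
      refine ⟨(P.nbr v).symm ⟨u, hu⟩, Fin.is_lt _, ?_⟩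
      rw [hport]
      simpa using he
  rw [result, hrun]
  simp only [gather, hunion]

end CongestAlgorithm

namespace NetworkDecomposition

/-- A transformation of the local data of the nodes of a network, defined on all networks at once:
what an algorithm computes, regardless of messages and port numbers. -/
abbrev NetMap (α β : Type) := ∀ V : Type, SimpleGraph V → (V → α) → V → β

/-- `F` is computed in `T` rounds by an algorithm with `B`-bit messages. -/
def Realizable (B T : ℕ) {α β : Type} (F : NetMap α β) : Prop :=
  ∃ A : CongestAlgorithm α β B, ∀ (V : Type) (G : SimpleGraph V) (P : PortNumbering G)
    (x : V → α), A.result P x T = F V G x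

namespace NetMap

variable {α β γ E : Type}

/-- Every node applies `f` to its own data. -/
def ofLocal (f : α → β) : NetMap α β := fun _ _ x v => f (x v)

/-- Sequential composition, first `F` and then `F'`. -/
def andThen (F : NetMap α β) (F' : NetMap β γ) : NetMap α γ :=
  fun V G x => F' V G (F V G x)

/-- The sequential composition of `F 0, …, F (n - 1)`. -/
def chain (F : ℕ → NetMap α α) : ℕ → NetMap α α
  | 0 => fun _ _ x => x
  | n + 1 => (chain F n).andThen (F n)

/-- What a node sends if at most `K` elements can be sent: the set `s` if it fits, and nothing
otherwise. -/
noncomputable def cap (K : ℕ) (s : Set E) : Set E :=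
  open Classical in if s.ncard ≤ K then s else ∅

theorem cap_of_le {K : ℕ} {s : Set E} (h : s.ncard ≤ K) : cap K s = s :=
  if_pos h

theorem ncard_cap_le (K : ℕ) (s : Set E) : (cap K s).ncard ≤ K := by
  unfold cap
  split_ifs with h
  · exact h
  · simp only [Set.ncard_empty, Nat.zero_le]

/-- Every node sends a set of at most `K` elements to its neighbors, and updates its data with the
union of the sets that it receives. -/
noncomputable def gather (K : ℕ) (s : α → Set E) (upd : α → Set E → β) : NetMap α β :=
  fun _ G x v => upd (x v) {e | ∃ u, G.Adj v u ∧ e ∈ cap K (s (x u))}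

end NetMap

theorem exists_fin_enumeration_of_ncard_le {E : Type*} {K : ℕ} {s : Set E} (hs : s.Finite)
    (hK : s.ncard ≤ K) : ∃ g : Fin K → Option E, {e | ∃ i, g i = some e} = s := by
  refine ⟨fun i => hs.toFinset.toList[(i : ℕ)]?, Set.ext fun e => ?_⟩
  have hmem : e ∈ s ↔ e ∈ hs.toFinset.toList := by simp
  rw [hmem, List.mem_iff_getElem?]
  refine ⟨fun ⟨i, hi⟩ => ⟨i, hi⟩, fun ⟨i, hi⟩ => ⟨⟨i, ?_⟩, hi⟩⟩
  have hi' := (List.getElem?_eq_some_iff.1 hi).1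
  rw [Finset.length_toList, ← Set.ncard_eq_toFinset_card s hs] at hi'
  omega

theorem card_fin_option_le {E : Type*} [Finite E] {B b : ℕ} (hB : 1 ≤ B)
    (hE : Nat.card E ≤ 2 ^ (b * B)) (K : ℕ) :
    Nat.card (Fin K → Option E) ≤ Nat.card (Fin (K * (b + 1)) → BitVec B) := by
  have hoption : Nat.card (Option E) ≤ 2 ^ (b * B + B) := by
    have hmul : 2 ^ (b * B) * 2 ^ 1 ≤ 2 ^ (b * B) * 2 ^ B := by gcongr; norm_num
    have hpos : 1 ≤ 2 ^ (b * B) := Nat.one_le_two_pow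
    rw [Finite.card_option, pow_add]
    omega
  calc Nat.card (Fin K → Option E) = Nat.card (Option E) ^ K := by simp [Nat.card_fun]
    _ ≤ (2 ^ (b * B + B)) ^ K := Nat.pow_le_pow_left hoption K
    _ = (2 ^ B) ^ (K * (b + 1)) := by rw [← pow_mul, ← pow_mul]; congr 1; ring
    _ = Nat.card (Fin (K * (b + 1)) → BitVec B) := by
      rw [Nat.card_fun, Nat.card_congr (BitVec.equivFin (m := B)).toEquiv, Nat.card_fin,
        Nat.card_fin]

theorem exists_encoding_of_sets {E : Type*} [Finite E] {B b K : ℕ} (hB : 1 ≤ B)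
    (hE : Nat.card E ≤ 2 ^ (b * B)) :
    ∃ (enc : Set E → ℕ → BitVec B) (dec : (ℕ → BitVec B) → Set E),
      ∀ s : Set E, s.ncard ≤ K → ∀ f : ℕ → BitVec B,
        (∀ j < K * (b + 1), f j = enc s j) → dec f = s := by
  have : Finite (BitVec B) := .of_equiv _ (BitVec.equivFin (m := B)).toEquiv.symm
  have := Fintype.ofFinite (Fin K → Option E)
  have := Fintype.ofFinite (Fin (K * (b + 1)) → BitVec B)
  obtain ⟨φ⟩ : Nonempty ((Fin K → Option E) ↪ (Fin (K * (b + 1)) → BitVec B)) := by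
    apply Function.Embedding.nonempty_of_card_le
    simpa only [Nat.card_eq_fintype_card] using card_fin_option_le hB hE K
  choose! g hg using fun (s : Set E) (hs : s.ncard ≤ K) =>
    exists_fin_enumeration_of_ncard_le s.toFinite hs
  refine ⟨fun s j => if h : j < K * (b + 1) then φ (g s) ⟨j, h⟩ else 0,
    fun f => {e | ∃ i, Function.invFun φ (fun j => f j) i = some e},
    fun s hs f hf => ?_⟩
  have hcode : (fun j : Fin (K * (b + 1)) => f j) = φ (g s) := by
    funext j
    simp [hf j j.2]
  simp only [hcode]
  rw [Function.leftInverse_invFun φ.injective (g s), hg s hs]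

namespace Realizable

variable {α β γ : Type} {B T T' : ℕ}

theorem ofLocal (f : α → β) (T : ℕ) : Realizable B T (NetMap.ofLocal f) :=
  ⟨.idle f, fun _ _ P x => CongestAlgorithm.result_idle f P x T⟩

theorem andThen {F : NetMap α β} {F' : NetMap β γ} (h : Realizable B T F)
    (h' : Realizable B T' F') : Realizable B (T + T') (F.andThen F') := by
  obtain ⟨A, hA⟩ := h
  obtain ⟨A', hA'⟩ := h'
  refine ⟨A.seq A' T, fun V G P x => ?_⟩
  rw [CongestAlgorithm.result_seq, hA, hA', NetMap.andThen]

theorem mono {F : NetMap α β} (h : Realizable B T F) (hT : T ≤ T') : Realizable B T' F := by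
  have := h.andThen (ofLocal (B := B) (id : β → β) (T' - T))
  rwa [Nat.add_sub_cancel' hT] at this

theorem chain {F : ℕ → NetMap α α} (h : ∀ i, Realizable B T (F i)) (n : ℕ) :
    Realizable B (n * T) (NetMap.chain F n) := by
  induction n with
  | zero => exact (ofLocal (B := B) (id : α → α) 0).mono (Nat.zero_le _)
  | succ n ih => rw [Nat.succ_mul]; exact ih.andThen (h n)

theorem gather {E : Type} [Finite E] {b K : ℕ} (hB : 1 ≤ B)
    (hE : Nat.card E ≤ 2 ^ (b * B)) (s : α → Set E) (upd : α → Set E → β) :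
    Realizable B (K * (b + 1)) (NetMap.gather K s upd) := by
  obtain ⟨enc, dec, hdec⟩ := exists_encoding_of_sets (K := K) hB hE
  exact ⟨.gather enc dec (fun a => NetMap.cap K (s a)) upd, fun V G P x =>
    CongestAlgorithm.result_gather (fun a => hdec _ (NetMap.ncard_cap_le K (s a))) upd P x⟩

end Realizable

/-! ### The smallest elements of a set -/

section ncard

variable {W X : Type*} [Finite X] {n : ℕ} {Λ : Set W} {F : W → Set X}

theorem ncard_fibered_eq_sum (Λ : Set W) [Fintype Λ] (F : W → Set X) :
    {p : W × X | p.1 ∈ Λ ∧ p.2 ∈ F p.1}.ncard = ∑ l : Λ, (F l).ncard := by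
  let φ : {p : W × X | p.1 ∈ Λ ∧ p.2 ∈ F p.1} ≃ Σ l : Λ, F l :=
    { toFun p := ⟨⟨p.1.1, p.2.1⟩, p.1.2, p.2.2⟩
      invFun q := ⟨(q.1, q.2), q.1.2, q.2.2⟩ }
  simp only [← Nat.card_coe_set_eq]
  rw [Nat.card_congr φ, Nat.card_sigma]

variable [Finite W]

theorem ncard_fibered_le (hF : ∀ l ∈ Λ, (F l).ncard ≤ n) :
    {p : W × X | p.1 ∈ Λ ∧ p.2 ∈ F p.1}.ncard ≤ Λ.ncard * n := by
  have := Fintype.ofFinite Λ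
  rw [ncard_fibered_eq_sum, ← Nat.card_coe_set_eq, Nat.card_eq_fintype_card]
  exact Finset.sum_le_card_nsmul _ _ _ fun l _ => hF l l.2

theorem le_ncard_fibered (hF : ∀ l ∈ Λ, n ≤ (F l).ncard) :
    Λ.ncard * n ≤ {p : W × X | p.1 ∈ Λ ∧ p.2 ∈ F p.1}.ncard := by
  have := Fintype.ofFinite Λ
  rw [ncard_fibered_eq_sum, ← Nat.card_coe_set_eq, Nat.card_eq_fintype_card]
  exact Finset.card_nsmul_le_sum _ _ _ fun l _ => hF l l.2

end ncard

/-- The key of `e`, with ties broken by an arbitrary enumeration of the type. -/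
noncomputable def rank {X ω : Type*} [Finite X] (f : X → ω) (e : X) : ω ×ₗ Fin (Nat.card X) :=
  toLex (f e, Finite.equivFin X e)

/-- The elements of `s` that precede `e` when `s` is sorted by the keys `f`. -/
def preceding {X ω : Type*} [Finite X] [LinearOrder ω] (f : X → ω) (s : Set X) (e : X) : Set X :=
  {e' ∈ s | rank f e' < rank f e}

/-- The `D` elements of `s` with the smallest keys. -/
def smallest {X ω : Type*} [Finite X] [LinearOrder ω] (D : ℕ) (f : X → ω) (s : Set X) : Set X :=
  {e ∈ s | (preceding f s e).ncard < D}

section smallest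

variable {X ω : Type*} [Finite X]

theorem rank_injective (f : X → ω) : Function.Injective (rank f) := fun _ _ h =>
  (Finite.equivFin X).injective (congrArg (fun p => (ofLex p).2) h)

variable [LinearOrder ω] {D : ℕ} {f : X → ω} {s t : Set X}

theorem le_of_rank_lt {a b : X} (h : rank f a < rank f b) : f a ≤ f b := by
  rcases Prod.Lex.lt_iff.1 h with h | h
  · exact h.le
  · exact h.1.le

theorem ncard_preceding_le {s' : Set X} {a b : X} (hs : ∀ c ∈ s, rank f c < rank f a → c ∈ s')
    (hab : rank f a ≤ rank f b) : (preceding f s a).ncard ≤ (preceding f s' b).ncard := by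
  refine Set.ncard_le_ncard fun c hc => ?_
  exact ⟨hs c hc.1 hc.2, hc.2.trans_le hab⟩

theorem smallest_subset (D : ℕ) (f : X → ω) (s : Set X) : smallest D f s ⊆ s := fun _ h => h.1

theorem ncard_smallest_le (D : ℕ) (f : X → ω) (s : Set X) : (smallest D f s).ncard ≤ D := by
  rcases (smallest D f s).eq_empty_or_nonempty with hempty | hne
  · simp only [hempty, Set.ncard_empty, Nat.zero_le]
  · obtain ⟨e, he, hmax⟩ := Set.exists_max_image (smallest D f s) (rank f) (Set.toFinite _) hne
    have hsub : smallest D f s ⊆ insert e (preceding f s e) := fun a ha =>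
      or_iff_not_imp_left.2 fun hae =>
        ⟨ha.1, (hmax a ha).lt_of_ne fun h => hae (rank_injective f h)⟩
    have hcard := (Set.ncard_le_ncard hsub).trans (Set.ncard_insert_le e (preceding f s e))
    exact hcard.trans he.2

theorem smallest_eq_self (h : s.ncard ≤ D) : smallest D f s = s := by
  refine (smallest_subset D f s).antisymm fun e he => ⟨he, lt_of_lt_of_le ?_ h⟩
  refine Set.ncard_lt_ncard ⟨fun a ha => ha.1, fun hs => ?_⟩
  exact lt_irrefl _ (hs he).2

theorem mem_smallest_of_rank_lt {a b : X} (ha : a ∈ s) (hb : b ∈ smallest D f s)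
    (h : rank f a < rank f b) : a ∈ smallest D f s :=
  ⟨ha, (ncard_preceding_le (fun _ hc _ => hc) h.le).trans_lt hb.2⟩

theorem le_ncard_smallest (h : D ≤ s.ncard) : D ≤ (smallest D f s).ncard := by
  rcases (s \ smallest D f s).eq_empty_or_nonempty with hempty | hne
  · exact h.trans (Set.ncard_le_ncard (Set.sdiff_eq_empty.1 hempty))
  · obtain ⟨e, he, hmin⟩ := Set.exists_min_image _ (rank f) (Set.toFinite _) hne
    have hD : D ≤ (preceding f s e).ncard := not_lt.1 fun hlt => he.2 ⟨he.1, hlt⟩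
    refine hD.trans (Set.ncard_le_ncard fun a ha => ?_)
    by_contra hn
    exact ha.2.not_ge (hmin a ⟨ha.1, hn⟩)

theorem nonempty_smallest_one : (smallest 1 f s).Nonempty ↔ s.Nonempty :=
  ⟨fun h => h.mono (smallest_subset 1 f s), fun h => (Set.ncard_pos (Set.toFinite _)).1
    (le_ncard_smallest ((Set.ncard_pos (Set.toFinite _)).2 h))⟩

theorem smallest_preceding_subset (D : ℕ) (f : X → ω) (s : Set X) (e : X) :
    smallest D f (preceding f s e) ⊆ smallest D f s ∩ preceding f s e := fun _ ha =>
  ⟨⟨ha.1.1, (ncard_preceding_le (s' := preceding f s e)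
    (fun _ hc hlt => ⟨hc, hlt.trans ha.1.2⟩) le_rfl).trans_lt ha.2⟩, ha.1⟩

theorem ncard_preceding_lt {e : X} (h : (smallest D f s ∩ preceding f s e).ncard < D) :
    (preceding f s e).ncard < D := by
  by_contra hle
  exact ((le_ncard_smallest (not_lt.1 hle)).trans
    (Set.ncard_le_ncard (smallest_preceding_subset D f s e))).not_gt h

theorem mem_smallest_of_ncard_lt {p : X → Prop} (hp : ∀ a b, f a ≤ f b → p b → p a)
    (h : {e ∈ smallest D f s | p e}.ncard < D) {e : X} (he : e ∈ s) (hpe : p e) :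
    e ∈ smallest D f s := by
  refine ⟨he, ncard_preceding_lt (lt_of_le_of_lt (Set.ncard_le_ncard fun a ha => ?_) h)⟩
  exact ⟨ha.1, hp a e (le_of_rank_lt ha.2.2) hpe⟩

theorem mem_smallest_of_ncard_le {p : X → Prop} (hp : ∀ a b, f a ≤ f b → p b → p a)
    (h : {e ∈ s | p e}.ncard ≤ D) {e : X} (he : e ∈ s) (hpe : p e) : e ∈ smallest D f s := by
  refine ⟨he, (Set.ncard_lt_ncard ⟨?_, fun hs => ?_⟩).trans_le h⟩
  · exact fun a ha => ⟨ha.1, hp a e (le_of_rank_lt ha.2) hpe⟩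
  · exact lt_irrefl _ (hs ⟨he, hpe⟩).2

theorem smallest_eq_of_subset (hst : s ⊆ t) (h : smallest D f t ⊆ s) :
    smallest D f s = smallest D f t := by
  refine Set.Subset.antisymm (fun e he => ⟨hst he.1, ncard_preceding_lt ?_⟩) fun e he =>
    ⟨h he, (ncard_preceding_le (fun _ hc _ => hst hc) le_rfl).trans_lt he.2⟩
  refine lt_of_le_of_lt (Set.ncard_le_ncard fun a ha => ?_) he.2
  exact ⟨h ha.1, ha.2.2⟩

theorem smallest_iUnion_smallest {ι : Type*} (p : ι → Prop) (A : ι → Set X) :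
    smallest D f {e | ∃ i, p i ∧ e ∈ smallest D f (A i)} =
      smallest D f {e | ∃ i, p i ∧ e ∈ A i} := by
  refine smallest_eq_of_subset (fun e ⟨i, hi, he⟩ => ⟨i, hi, he.1⟩) ?_
  rintro e ⟨⟨i, hi, he⟩, hlt⟩
  exact ⟨i, hi, he, (ncard_preceding_le (s' := {e | ∃ i, p i ∧ e ∈ A i})
    (fun _ hc _ => ⟨i, hi, hc⟩) le_rfl).trans_lt hlt⟩

end smallest

/-! ### Flooding -/

/-- There is a walk of length at most `T` from `u` to `v` all of whose nodes lie in `U`. -/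
def Within {V : Type*} (G : SimpleGraph V) (U : Set V) (T : ℕ) (u v : V) : Prop :=
  ∃ p : G.Walk u v, p.length ≤ T ∧ ∀ w ∈ p.support, w ∈ U

namespace Within

variable {V : Type*} {G G' : SimpleGraph V} {U U' : Set V} {T T' : ℕ} {u v w : V}

theorem symm (h : Within G U T u v) : Within G U T v u := by
  obtain ⟨p, hlen, hU⟩ := h
  exact ⟨p.reverse, by rwa [p.length_reverse],
    fun w hw => hU w (by rwa [p.support_reverse, List.mem_reverse] at hw)⟩

theorem trans (h : Within G U T u v) (h' : Within G U T' v w) : Within G U (T + T') u w := by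
  obtain ⟨p, hlen, hU⟩ := h
  obtain ⟨p', hlen', hU'⟩ := h'
  refine ⟨p.append p', p.length_append p' ▸ add_le_add hlen hlen', fun a ha => ?_⟩
  exact ((SimpleGraph.Walk.mem_support_append_iff _ _).1 ha).elim (hU a) (hU' a)

theorem mono (h : Within G U T u v) (hU : U ⊆ U') (hT : T ≤ T') : Within G U' T' u v :=
  let ⟨p, hlen, hp⟩ := h
  ⟨p, hlen.trans hT, fun w hw => hU (hp w hw)⟩

theorem left_mem (h : Within G U T u v) : u ∈ U :=
  let ⟨p, _, hU⟩ := h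
  hU u p.start_mem_support

theorem right_mem (h : Within G U T u v) : v ∈ U := h.symm.left_mem

theorem refl (hv : v ∈ U) (T : ℕ) : Within G U T v v :=
  ⟨.nil, T.zero_le, by simpa using hv⟩

theorem cons (h : G.Adj u v) (hu : u ∈ U) (h' : Within G U T v w) : Within G U (T + 1) u w := by
  obtain ⟨p, hlen, hU⟩ := h'
  refine ⟨.cons h p, Nat.succ_le_succ hlen, ?_⟩
  simpa only [SimpleGraph.Walk.support_cons, List.forall_mem_cons] using ⟨hu, hU⟩

theorem zero_iff : Within G U 0 u v ↔ u = v ∧ u ∈ U := by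
  refine ⟨fun h => ⟨?_, h.left_mem⟩, ?_⟩
  · obtain ⟨p, hlen, -⟩ := h
    exact SimpleGraph.Walk.eq_of_length_eq_zero (Nat.le_zero.1 hlen)
  · rintro ⟨rfl, hu⟩
    exact refl hu 0

theorem succ_iff : Within G U (T + 1) u v ↔
    u ∈ U ∧ (Within G U T u v ∨ ∃ w, G.Adj u w ∧ Within G U T w v) := by
  constructor
  · intro h
    refine ⟨h.left_mem, ?_⟩
    obtain ⟨p, hlen, hU⟩ := h
    cases p with
    | nil => exact .inl (refl (hU _ (by simp)) T)
    | cons h p =>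
      rw [SimpleGraph.Walk.support_cons, List.forall_mem_cons] at hU
      exact .inr ⟨_, h, p, Nat.le_of_succ_le_succ hlen, hU.2⟩
  · rintro ⟨hu, h | ⟨w, hw, h⟩⟩
    · exact h.mono subset_rfl T.le_succ
    · exact cons hw hu h

theorem mono_graph (h : Within G U T u v)
    (hG : ∀ a b, a ∈ U → b ∈ U → G.Adj a b → G'.Adj a b) : Within G' U T u v := by
  induction T generalizing u with
  | zero => exact zero_iff.2 (zero_iff.1 h)
  | succ T ih =>
    rw [succ_iff] at h ⊢
    refine ⟨h.1, h.2.imp ih ?_⟩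
    rintro ⟨w, hw, hwv⟩
    exact ⟨w, hG _ _ h.1 hwv.left_mem hw, ih hwv⟩

theorem univ_iff_edist_le : Within G Set.univ T u v ↔ G.edist u v ≤ T := by
  constructor
  · rintro ⟨p, hlen, -⟩
    exact (SimpleGraph.Walk.edist_le p).trans (by exact_mod_cast hlen)
  · intro h
    obtain ⟨p, hp⟩ := SimpleGraph.exists_walk_of_edist_ne_top
      (ne_top_of_le_ne_top (ENat.natCast_ne_top T) h)
    exact ⟨p, by exact_mod_cast hp ▸ h, fun _ _ => trivial⟩

end Within

section flood

variable {α W X ω : Type} [Finite X] [LinearOrder ω]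

/-- The part of the labelled elements `y` that a node keeps: for each of the labels in `rel`, the
`D` smallest elements with this label. -/
def relayed (rel : Set W) (D : ℕ) (f : X → ω) (y : Set (W × X)) : Set (W × X) :=
  {p | p.1 ∈ rel ∧ p.2 ∈ smallest D f {e | (p.1, e) ∈ y}}

/-- One round of flooding: for each of the labels `rel a` that a node with data `a` relays, it
learns what its neighbors know, and keeps the `D` smallest elements. Messages consist of at most
`K` labelled elements. -/
noncomputable def floodStep (rel : α → Set W) (D K : ℕ) (f : X → ω) :
    NetMap (α × Set (W × X)) (α × Set (W × X)) :=
  NetMap.gather K Prod.snd fun a r => (a.1, relayed (rel a.1) D f (a.2 ∪ r))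

/-- Flooding for `T` rounds, where the labelled elements `init a` start at the nodes with data
`a`. -/
noncomputable def flood (rel : α → Set W) (init : α → Set (W × X)) (D K : ℕ) (f : X → ω) (T : ℕ) :
    NetMap α (α × Set (W × X)) :=
  (NetMap.ofLocal fun a => (a, relayed (rel a) D f (init a))).andThen
    (NetMap.chain (fun _ => floodStep rel D K f) T)

theorem card_prod_le_two_pow {E E' : Type*} {b b' B : ℕ} (h : Nat.card E ≤ 2 ^ (b * B))
    (h' : Nat.card E' ≤ 2 ^ (b' * B)) : Nat.card (E × E') ≤ 2 ^ ((b + b') * B) := by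
  rw [Nat.card_prod, add_mul, pow_add]
  exact Nat.mul_le_mul h h'

theorem Realizable.flood [Finite W] {B b : ℕ} (hB : 1 ≤ B) (hW : Nat.card W ≤ 2 ^ B)
    (hX : Nat.card X ≤ 2 ^ (b * B)) (rel : α → Set W) (init : α → Set (W × X)) (D K : ℕ)
    (f : X → ω) (T : ℕ) :
    Realizable B (T * (K * (b + 2))) (flood rel init D K f T) := by
  have hWX := card_prod_le_two_pow (b := 1) (by rwa [one_mul]) hX
  have hstep : Realizable B (K * (b + 2)) (floodStep rel D K f) :=
    (gather hB hWX _ _).mono (le_of_eq (by ring))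
  exact ((ofLocal _ 0).andThen (chain (fun _ => hstep) T)).mono (le_of_eq (Nat.zero_add _))

/-- The state of the nodes if the elements with label `l` that have reached the node `v` are those
of `A l v`. -/
def floodState {V : Type} (rel : α → Set W) (D : ℕ) (f : X → ω) (x : V → α) (A : W → V → Set X)
    (v : V) : α × Set (W × X) :=
  (x v, {p | p.1 ∈ rel (x v) ∧ p.2 ∈ smallest D f (A p.1 v)})

variable {V : Type} {rel : α → Set W} {D K : ℕ} {x : V → α}

theorem floodState_congr {f : X → ω} {A A' : W → V → Set X} {v : V}
    (h : ∀ l ∈ rel (x v), A l v = A' l v) :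
    floodState rel D f x A v = floodState rel D f x A' v :=
  Prod.ext rfl (Set.ext fun p => and_congr_right fun hp => by rw [h p.1 hp])

theorem floodStep_floodState [Finite W] (G : SimpleGraph V) (f : X → ω)
    (hK : ∀ v, (rel (x v)).ncard * D ≤ K) (A : W → V → Set X) :
    floodStep rel D K f V G (floodState rel D f x A) = floodState rel D f x
      fun l v => {e | ∃ u, (u = v ∨ G.Adj v u ∧ l ∈ rel (x u)) ∧ e ∈ A l u} := by
  funext v
  have hcap (u : V) : NetMap.cap K (floodState rel D f x A u).2 = (floodState rel D f x A u).2 :=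
    NetMap.cap_of_le ((ncard_fibered_le (F := fun l => smallest D f (A l u))
      fun _ _ => ncard_smallest_le ..).trans (hK u))
  simp only [floodStep, NetMap.gather, hcap]
  refine Prod.ext rfl (Set.ext fun ⟨l, e⟩ => and_congr_right fun hl => ?_)
  rw [← smallest_iUnion_smallest]
  have hl' : l ∈ rel (x v) := hl
  have hunion : {e | (l, e) ∈ (floodState rel D f x A v).2 ∪
        {p | ∃ u, G.Adj v u ∧ p ∈ (floodState rel D f x A u).2}} =
      {e | ∃ u, (u = v ∨ G.Adj v u ∧ l ∈ rel (x u)) ∧ e ∈ smallest D f (A l u)} := by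
    ext e
    simp only [floodState, Set.mem_union, Set.mem_ofPred_eq, hl', true_and, or_and_right, exists_or,
      exists_eq_left, and_assoc]
  rw [hunion]

theorem flood_apply [Finite W] (G : SimpleGraph V) (init : α → Set (W × X)) (f : X → ω) (T : ℕ)
    (hK : ∀ v, (rel (x v)).ncard * D ≤ K) :
    flood rel init D K f T V G x = floodState rel D f x fun l v =>
      {e | ∃ u, Within G {w | l ∈ rel (x w)} T v u ∧ (l, e) ∈ init (x u)} := by
  induction T with
  | zero =>
    funext v
    refine floodState_congr (A := fun l v => {e | (l, e) ∈ init (x v)}) fun l hl => ?_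
    ext e
    simp [Within.zero_iff, hl]
  | succ T ih =>
    change floodStep rel D K f V G (flood rel init D K f T V G x) = _
    rw [ih, floodStep_floodState G f hK]
    funext v
    refine floodState_congr fun l hl => Set.ext fun e => ?_
    simp only [Set.mem_ofPred_eq, Within.succ_iff, hl, true_and]
    constructor
    · rintro ⟨u, rfl | ⟨hu, -⟩, w, hw, he⟩
      · exact ⟨w, .inl hw, he⟩
      · exact ⟨w, .inr ⟨u, hu, hw⟩, he⟩
    · rintro ⟨w, hw | ⟨u, hu, hw⟩, he⟩
      · exact ⟨v, .inl rfl, w, hw, he⟩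
      · exact ⟨u, .inr ⟨hu, hw.left_mem⟩, w, hw, he⟩

/-- Flooding to distance `T` in the whole network, without labels. -/
noncomputable def ballFlood (emit : α → Set X) (D : ℕ) (f : X → ω) (T : ℕ) : NetMap α (α × Set X) :=
  (flood (fun _ => (Set.univ : Set Unit)) (fun a => {p | p.2 ∈ emit a}) D D f T).andThen
    (NetMap.ofLocal fun a => (a.1, {e | ((), e) ∈ a.2}))

theorem Realizable.ballFlood {B b : ℕ} (hB : 1 ≤ B) (hX : Nat.card X ≤ 2 ^ (b * B))
    (emit : α → Set X) (D : ℕ) (f : X → ω) (T : ℕ) :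
    Realizable B (T * (D * (b + 2))) (ballFlood emit D f T) :=
  (Realizable.flood hB (by simp [Nat.one_le_two_pow]) hX _ _ D D f T).andThen (ofLocal _ 0)

theorem ballFlood_apply (G : SimpleGraph V) (emit : α → Set X) (f : X → ω) (T : ℕ) (v : V) :
    ballFlood emit D f T V G x v =
      (x v, smallest D f {e | ∃ u, G.edist v u ≤ T ∧ e ∈ emit (x u)}) := by
  simp only [ballFlood, NetMap.andThen, NetMap.ofLocal]
  rw [flood_apply G _ f T (by simp)]
  simp [floodState, Within.univ_iff_edist_le]

end flood

/-! ### Clusters with relays -/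

/-- The local data of a node: its own identifier, the label of its cluster, the labels of the
clusters for which it forwards messages, and data that is shared by the nodes of a cluster. -/
structure Node (W κ : Type) where
  me : W
  lab : W
  rel : Set W
  dat : κ

/-- Replace the data of the cluster. -/
def Node.setDat {W κ κ' : Type} (a : Node W κ) (k : κ') : Node W κ' := ⟨a.me, a.lab, a.rel, k⟩

/-- The local data of all nodes, where the cluster with label `A` holds the data `K A`. -/
def config {V W κ : Type} (me lab : V → W) (rel : V → Set W) (K : W → κ) (v : V) : Node W κ :=
  ⟨me v, lab v, rel v, K (lab v)⟩

section clusters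

variable {V W : Type} {G : SimpleGraph V} {k R R' ρ ρ' L L' : ℕ} {ldr : W → V} {lab : V → W}
  {rel : V → Set W}

/-- The clusters are connected in `G^k`, with radius at most `ρ` around their leaders. The nodes
that relay a label form a connected subgraph of `G`, with radius at most `R` around the leader. Each
node relays at most `L` labels. -/
structure ClusterInv (G : SimpleGraph V) (k R ρ L : ℕ) (ldr : W → V) (lab : V → W)
    (rel : V → Set W) : Prop where
  lab_mem : ∀ v, lab v ∈ rel v
  lab_ldr : ∀ v, ∀ l ∈ rel v, lab (ldr l) = l
  relay : ∀ v, ∀ l ∈ rel v, Within G {w | l ∈ rel w} R (ldr l) v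
  strong : ∀ v, Within (powerGraph G k) {w | lab w = lab v} ρ (ldr (lab v)) v
  card_le : ∀ v, (rel v).ncard ≤ L

/-- Two clusters contain nodes at distance at most `k`. -/
def Near (G : SimpleGraph V) (k : ℕ) (lab : V → W) (A A' : W) : Prop :=
  ∃ v w, lab v = A ∧ lab w = A' ∧ G.edist v w ≤ k

theorem Near.symm {A A' : W} : Near G k lab A A' → Near G k lab A' A := by
  rintro ⟨v, w, hv, hw, hvw⟩
  exact ⟨w, v, hw, hv, by rwa [SimpleGraph.edist_comm]⟩

theorem Near.refl (v : V) : Near G k lab (lab v) (lab v) := ⟨v, v, rfl, rfl, by simp⟩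

theorem ClusterInv.mono (h : ClusterInv G k R ρ L ldr lab rel) (hR : R ≤ R') (hρ : ρ ≤ ρ')
    (hL : L ≤ L') : ClusterInv G k R' ρ' L' ldr lab rel where
  lab_mem := h.lab_mem
  lab_ldr := h.lab_ldr
  relay v l hl := (h.relay v l hl).mono subset_rfl hR
  strong v := (h.strong v).mono subset_rfl hρ
  card_le v := (h.card_le v).trans hL

theorem ClusterInv.within_iff (h : ClusterInv G k R ρ L ldr lab rel) {l : W} {v u : V}
    (hv : l ∈ rel v) : Within G {w | l ∈ rel w} (2 * R) v u ↔ l ∈ rel u :=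
  ⟨Within.right_mem, fun hu =>
    ((h.relay v l hv).symm.trans (h.relay u l hu)).mono subset_rfl (two_mul R).ge⟩

end clusters

section clusterRound

variable {W X ω κ κ' : Type} [Finite X] [LinearOrder ω]

/-- Every cluster learns the `D` smallest elements of the sets emitted by the clusters near to
it. -/
noncomputable def clusterRound (k R L D : ℕ) (f : X → ω) (emit : W → κ → Set X)
    (upd : W → κ → Set X → κ') : NetMap (Node W κ) (Node W κ') :=
  (ballFlood (fun a : Node W κ => emit a.lab a.dat) D f k).andThen
    ((flood (fun a : Node W κ × Set X => a.1.rel) (fun a => {p | p.1 = a.1.lab ∧ p.2 ∈ a.2}) D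
        (L * D) f (2 * R)).andThen
      (NetMap.ofLocal fun a =>
        a.1.1.setDat (upd a.1.1.lab a.1.1.dat {e | (a.1.1.lab, e) ∈ a.2})))

variable [Finite W]

theorem Realizable.clusterRound {B b : ℕ} (hB : 1 ≤ B) (hW : Nat.card W ≤ 2 ^ B)
    (hX : Nat.card X ≤ 2 ^ (b * B)) (k R L D : ℕ) (f : X → ω) (emit : W → κ → Set X)
    (upd : W → κ → Set X → κ') :
    Realizable B (k * (D * (b + 2)) + 2 * R * (L * D * (b + 2)))
      (clusterRound k R L D f emit upd) :=
  (Realizable.ballFlood hB hX _ D f k).andThen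
    ((Realizable.flood hB hW hX _ _ D (L * D) f (2 * R)).andThen (ofLocal _ 0))

theorem clusterRound_config {V : Type} {G : SimpleGraph V} {k R ρ L : ℕ} {ldr : W → V}
    {me lab : V → W} {rel : V → Set W} (h : ClusterInv G k R ρ L ldr lab rel) (D : ℕ) (f : X → ω)
    (emit : W → κ → Set X) (upd : W → κ → Set X → κ') (K : W → κ) :
    clusterRound k R L D f emit upd V G (config me lab rel K) =
      config me lab rel fun A => upd A (K A)
        (smallest D f {e | ∃ A', Near G k lab A A' ∧ e ∈ emit A' (K A')}) := by
  set ball : V → Set X := fun u => {e | ∃ w, G.edist u w ≤ k ∧ e ∈ emit (lab w) (K (lab w))}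
  have hballFlood : ballFlood (fun a : Node W κ => emit a.lab a.dat) D f k V G
      (config me lab rel K) = fun u => (config me lab rel K u, smallest D f (ball u)) :=
    funext fun u => ballFlood_apply G _ f k u
  funext v
  simp only [clusterRound, NetMap.andThen, NetMap.ofLocal, hballFlood]
  rw [flood_apply (rel := fun a : Node W κ × Set X => a.1.rel) G _ f (2 * R)
    fun u => Nat.mul_le_mul_right D (h.card_le u)]
  simp only [floodState, config, Node.setDat, Node.mk.injEq, true_and, Set.mem_ofPred_eq, h.lab_mem]
  congr 1
  have hreach : {e | ∃ u, Within G {w | lab v ∈ rel w} (2 * R) v u ∧ lab v = lab u ∧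
      e ∈ smallest D f (ball u)} = {e | ∃ u, lab v = lab u ∧ e ∈ smallest D f (ball u)} := by
    ext e
    refine exists_congr fun u => and_iff_right_of_imp fun hu => ?_
    exact (h.within_iff (h.lab_mem v)).2 (hu.1 ▸ h.lab_mem u)
  have hnear : {e | ∃ u, lab v = lab u ∧ e ∈ ball u} =
      {e | ∃ A', Near G k lab (lab v) A' ∧ e ∈ emit A' (K A')} := by
    ext e
    constructor
    · rintro ⟨u, hu, w, hw, he⟩
      exact ⟨lab w, ⟨u, w, hu.symm, rfl, hw⟩, he⟩
    · rintro ⟨A', ⟨u, w, hu, rfl, hw⟩, he⟩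
      exact ⟨u, hu.symm, w, hw, he⟩
  calc smallest D f {e | ∃ u, Within G {w | lab v ∈ rel w} (2 * R) v u ∧ lab v = lab u ∧
        e ∈ smallest D f (ball u)}
      = smallest D f {e | ∃ u, lab v = lab u ∧ e ∈ smallest D f (ball u)} := by rw [hreach]
    _ = smallest D f {e | ∃ u, lab v = lab u ∧ e ∈ ball u} := smallest_iUnion_smallest _ _
    _ = smallest D f {e | ∃ A', Near G k lab (lab v) A' ∧ e ∈ emit A' (K A')} := by rw [hnear]

end clusterRound

/-! ### Growing clusters -/

/-- The status of a cluster: it takes part in the construction (`source`), it gets a color unless it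
is absorbed by another cluster (`pending`), or it has got a color (`done`). -/
inductive Status
  | source
  | pending (c : ℕ)
  | done (c : ℕ)

section voronoi

variable {V W : Type}

/-- The sets `reg` assign to every node that has a source at distance at most `T` the region of one
such source, and this source is reached within its region. The set of regions that start at the
node `v` is `s v`. -/
structure IsVoronoi (G : SimpleGraph V) (s : V → Set W) (T : ℕ) (reg : V → Set W) : Prop where
  ncard_le : ∀ v, (reg v).ncard ≤ 1
  exists_within : ∀ v, ∀ c ∈ reg v, ∃ w, c ∈ s w ∧ Within G {u | c ∈ reg u} T w v
  nonempty : ∀ v w, (s w).Nonempty → G.edist v w ≤ T → (reg v).Nonempty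

theorem IsVoronoi.zero {G : SimpleGraph V} {s : V → Set W} (hs : ∀ v, (s v).ncard ≤ 1) :
    IsVoronoi G s 0 s where
  ncard_le := hs
  exists_within v c hc := ⟨v, hc, Within.refl (U := {u | c ∈ s u}) hc 0⟩
  nonempty v w hw h := by
    obtain ⟨rfl, -⟩ := Within.zero_iff.1 (Within.univ_iff_edist_le.2 h)
    exact hw

variable [Finite W] [LinearOrder W]

open Classical in
/-- The region of a node with region `a`, if `r` is the union of the regions of its neighbors. -/
noncomputable def joinRegion (a r : Set W) : Set W := if a.Nonempty then a else smallest 1 id r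

theorem joinRegion_of_nonempty {a : Set W} (ha : a.Nonempty) (r : Set W) : joinRegion a r = a :=
  if_pos ha

theorem joinRegion_of_not_nonempty {a : Set W} (ha : ¬ a.Nonempty) (r : Set W) :
    joinRegion a r = smallest 1 id r :=
  if_neg ha

theorem IsVoronoi.succ {G : SimpleGraph V} {s reg : V → Set W} {T : ℕ} (h : IsVoronoi G s T reg) :
    IsVoronoi G s (T + 1) fun v => joinRegion (reg v) {c | ∃ u, G.Adj v u ∧ c ∈ reg u} := by
  set reg' : V → Set W := fun v => joinRegion (reg v) {c | ∃ u, G.Adj v u ∧ c ∈ reg u} with hreg'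
  have hkeep (c : W) : {v | c ∈ reg v} ⊆ {v | c ∈ reg' v} := fun v hc =>
    (joinRegion_of_nonempty ⟨c, hc⟩ {c | ∃ u, G.Adj v u ∧ c ∈ reg u}).ge hc
  refine ⟨fun v => ?_, fun v c hc => ?_, fun v w hw hvw => ?_⟩
  · by_cases hv : (reg v).Nonempty
    · exact (congrArg Set.ncard (joinRegion_of_nonempty hv _)).trans_le (h.ncard_le v)
    · exact (congrArg Set.ncard (joinRegion_of_not_nonempty hv _)).trans_le
        (ncard_smallest_le _ _ _)
  · by_cases hv : (reg v).Nonempty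
    · obtain ⟨w, hw, hwv⟩ := h.exists_within v c ((joinRegion_of_nonempty hv _).le hc)
      exact ⟨w, hw, hwv.mono (hkeep c) T.le_succ⟩
    · obtain ⟨u, hu, hcu⟩ := ((joinRegion_of_not_nonempty hv _).le hc).1
      obtain ⟨w, hw, hwu⟩ := h.exists_within u c hcu
      exact ⟨w, hw, (Within.cons hu hc (hwu.mono (hkeep c) le_rfl).symm).symm⟩
  · rcases (Within.succ_iff.1 (Within.univ_iff_edist_le.2 hvw)).2 with hvw | ⟨u, hu, huw⟩
    · obtain ⟨c, hc⟩ := h.nonempty v w hw (Within.univ_iff_edist_le.1 hvw)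
      exact ⟨c, hkeep c hc⟩
    · by_cases hv : (reg v).Nonempty
      · exact ⟨hv.some, hkeep _ hv.some_mem⟩
      · obtain ⟨c, hc⟩ := h.nonempty u w hw (Within.univ_iff_edist_le.1 huw)
        simp only [hreg', joinRegion_of_not_nonempty hv]
        exact nonempty_smallest_one.2 ⟨c, u, hu, hc⟩

/-- Every node without a region joins the region of a neighbor. -/
noncomputable def voronoiStep (α : Type) : NetMap (α × Set W) (α × Set W) :=
  NetMap.gather 1 Prod.snd fun a r => (a.1, joinRegion a.2 r)

/-- Regions of radius `T` around the nodes of the source clusters. -/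
noncomputable def voronoi (T : ℕ) : NetMap (Node W Status) (Node W Status × Set W) :=
  (NetMap.ofLocal fun a => (a, {c | a.dat = .source ∧ a.lab = c})).andThen
    (NetMap.chain (fun _ => voronoiStep (Node W Status)) T)

theorem Realizable.voronoi {B : ℕ} (hB : 1 ≤ B) (hW : Nat.card W ≤ 2 ^ B) (T : ℕ) :
    Realizable B (T * 2) (voronoi (W := W) T) := by
  have hstep : Realizable B 2 (voronoiStep (W := W) (Node W Status)) :=
    gather (b := 1) (K := 1) hB (by rwa [one_mul]) _ _
  exact ((ofLocal _ 0).andThen (chain (fun _ => hstep) T)).mono (Nat.zero_add _).le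

theorem voronoi_apply (G : SimpleGraph V) (x : V → Node W Status) (T : ℕ) :
    ∃ reg, voronoi T V G x = (fun v => (x v, reg v)) ∧
      IsVoronoi G (fun v => {c | (x v).dat = .source ∧ (x v).lab = c}) T reg := by
  induction T with
  | zero =>
    refine ⟨_, rfl, .zero fun v => ?_⟩
    exact (Set.ncard_le_ncard fun c hc => hc.2.symm).trans (Set.ncard_singleton (x v).lab).le
  | succ T ih =>
    obtain ⟨reg, hrun, hreg⟩ := ih
    refine ⟨_, ?_, hreg.succ⟩
    change voronoiStep _ V G (voronoi T V G x) = _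
    funext v
    simp only [hrun, voronoiStep, NetMap.gather, NetMap.cap_of_le (hreg.ncard_le _)]

end voronoi

open Classical in
/-- An element of `s`, or `a` if there is none. -/
noncomputable def pick {W : Type} (s : Set W) (a : W) : W :=
  if h : s.Nonempty then h.some else a

theorem pick_mem {W : Type} {s : Set W} (h : s.Nonempty) (a : W) : pick s a ∈ s := by
  rw [pick, dif_pos h]; exact h.some_mem

theorem pick_of_not_nonempty {W : Type} {s : Set W} (h : ¬ s.Nonempty) (a : W) : pick s a = a :=
  dif_neg h

open Classical in
/-- The new status of a cluster with status `k` that can join the source clusters in `s`. -/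
noncomputable def absorb {W : Type} (s : Set W) (k : Status) : Status :=
  if s.Nonempty then .source else k

section absorption

variable {V W : Type}

/-- The relabelling `nl` of the clusters merges every pending cluster near to a source cluster with
a source cluster, and may do so with other pending clusters. -/
structure IsAbsorption (G : SimpleGraph V) (k : ℕ) (lab : V → W) (K : W → Status) (nl : W → W) :
    Prop where
  pending_source : ∀ A, nl A ≠ A → (∃ c, K A = .pending c) ∧ K (nl A) = .source
  source_of_near : ∀ A A' c, K A = .pending c → Near G k lab A A' → K A' = .source →
    K (nl A) = .source
  exists_lab : ∀ v, ∃ w, nl (lab v) = lab w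

variable {G : SimpleGraph V} {k R ρ L : ℕ} {ldr : W → V} {lab : V → W} {rel : V → Set W}
  {K : W → Status} {reg : V → Set W}

namespace IsVoronoi

variable (hreg : IsVoronoi G (fun v => {c | K (lab v) = .source ∧ lab v = c}) k reg)

include hreg

theorem source_of_mem {u : V} {c : W} (hc : c ∈ reg u) : K c = .source := by
  obtain ⟨w, ⟨hw, rfl⟩, -⟩ := hreg.exists_within u c hc
  exact hw

theorem lab_ldr_of_mem (h : ClusterInv G k R ρ L ldr lab rel) {u : V} {c : W} (hc : c ∈ reg u) :
    lab (ldr c) = c := by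
  obtain ⟨w, ⟨-, rfl⟩, -⟩ := hreg.exists_within u c hc
  exact h.lab_ldr w _ (h.lab_mem w)

end IsVoronoi

variable [Finite W] [LinearOrder W]

/-- A region that meets the cluster `l`, if this cluster is pending. -/
def joinable (lab : V → W) (K : W → Status) (reg : V → Set W) (l : W) : Set W :=
  smallest 1 id {c | (∃ c', K l = .pending c') ∧ ∃ u, lab u = l ∧ c ∈ reg u}

/-- The label of the cluster `l` after it has joined the source cluster of a region it meets. -/
noncomputable def newLabel (lab : V → W) (K : W → Status) (reg : V → Set W) (l : W) : W :=
  pick (joinable lab K reg l) l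

theorem newLabel_cases (lab : V → W) (K : W → Status) (reg : V → Set W) (l : W) :
    newLabel lab K reg l = l ∨
      (∃ c, K l = .pending c) ∧ ∃ u, lab u = l ∧ newLabel lab K reg l ∈ reg u := by
  by_cases hne : (joinable lab K reg l).Nonempty
  · exact .inr (pick_mem hne l).1
  · exact .inl (pick_of_not_nonempty hne l)

namespace IsVoronoi

variable (hreg : IsVoronoi G (fun v => {c | K (lab v) = .source ∧ lab v = c}) k reg)

include hreg

theorem newLabel_of_mem {u : V} {c : W} (hc : c ∈ reg u) : newLabel lab K reg c = c := by
  refine (newLabel_cases lab K reg c).resolve_right fun ⟨⟨_, hc'⟩, _⟩ => ?_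
  simp only [hreg.source_of_mem hc, reduceCtorEq] at hc'

theorem newLabel_newLabel (l : W) :
    newLabel lab K reg (newLabel lab K reg l) = newLabel lab K reg l := by
  rcases newLabel_cases lab K reg l with hl | ⟨-, u, -, hu⟩
  · rw [hl, hl]
  · exact hreg.newLabel_of_mem hu

theorem isAbsorption : IsAbsorption G k lab K (newLabel lab K reg) where
  pending_source A hA := by
    obtain ⟨hpend, u, -, hu⟩ := (newLabel_cases lab K reg A).resolve_left hA
    exact ⟨hpend, hreg.source_of_mem hu⟩
  source_of_near := by
    rintro _ _ c hc ⟨v, w, rfl, rfl, hvw⟩ hw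
    obtain ⟨c', hc'⟩ := hreg.nonempty v w ⟨_, hw, rfl⟩ hvw
    have hjoin : (joinable lab K reg (lab v)).Nonempty :=
      nonempty_smallest_one.2 ⟨c', ⟨c, hc⟩, v, rfl, hc'⟩
    obtain ⟨-, u, -, hu⟩ := (pick_mem hjoin (lab v)).1
    exact hreg.source_of_mem hu
  exists_lab v := by
    rcases newLabel_cases lab K reg (lab v) with hv | ⟨-, u, -, hu⟩
    · exact ⟨v, hv⟩
    · obtain ⟨w, ⟨-, hw⟩, -⟩ := hreg.exists_within u _ hu
      exact ⟨w, hw.symm⟩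

theorem within_of_mem (h : ClusterInv G k R ρ L ldr lab rel) {u : V} {c : W} (hc : c ∈ reg u) :
    Within G {w | c ∈ newLabel lab K reg '' rel w ∪ reg w} (R + k) (ldr c) u := by
  obtain ⟨w, ⟨-, rfl⟩, hwu⟩ := hreg.exists_within u c hc
  refine ((h.relay w _ (h.lab_mem w)).mono (fun a ha => ?_) le_rfl).trans
    (hwu.mono (fun a => .inr) le_rfl)
  exact .inl ⟨_, ha, hreg.newLabel_of_mem hc⟩

theorem relay (h : ClusterInv G k R ρ L ldr lab rel) {v : V} {l : W} (hl : l ∈ rel v) :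
    Within G {w | newLabel lab K reg l ∈ newLabel lab K reg '' rel w ∪ reg w} (3 * R + k)
      (ldr (newLabel lab K reg l)) v := by
  have hsub : {w | l ∈ rel w} ⊆
      {w | newLabel lab K reg l ∈ newLabel lab K reg '' rel w ∪ reg w} := fun w hw =>
    .inl ⟨l, hw, rfl⟩
  have hlv := (h.relay v l hl).mono hsub le_rfl
  rcases newLabel_cases lab K reg l with heq | ⟨-, u, rfl, hu⟩
  · rw [heq] at hlv ⊢
    exact hlv.mono subset_rfl (by lia)
  · have hlu := (h.relay u _ (h.lab_mem u)).mono hsub le_rfl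
    exact (((hreg.within_of_mem h hu).trans hlu.symm).trans hlv).mono subset_rfl (by lia)

theorem strong (h : ClusterInv G k R ρ L ldr lab rel) (v : V) :
    Within (powerGraph G k) {w | newLabel lab K reg (lab w) = newLabel lab K reg (lab v)}
      (3 * ρ + 1) (ldr (newLabel lab K reg (lab v))) v := by
  have hstrong {u : V} {c : W} (hu : newLabel lab K reg (lab u) = c) :
      Within (powerGraph G k) {w | newLabel lab K reg (lab w) = c} ρ (ldr (lab u)) u :=
    (h.strong u).mono (fun w (hw : lab w = lab u) => (congrArg _ hw).trans hu) le_rfl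
  rcases newLabel_cases lab K reg (lab v) with heq | ⟨⟨c, hpend⟩, u, hu, hreg_u⟩
  · rw [heq]
    exact (hstrong heq).mono subset_rfl (by lia)
  · obtain ⟨w, ⟨hw, hwlab⟩, hwu⟩ := hreg.exists_within u _ hreg_u
    have hne : w ≠ u := by
      rintro rfl
      simp only [hu, hpend, reduceCtorEq] at hw
    have hadj : (powerGraph G k).Adj w u :=
      ⟨hne, Within.univ_iff_edist_le.1 (hwu.mono (Set.subset_univ _) le_rfl)⟩
    have hldr_w := hstrong (hwlab ▸ hreg.newLabel_newLabel (lab v))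
    have hldr_u := hstrong (u := u) (congrArg _ hu)
    rw [hwlab] at hldr_w
    rw [hu] at hldr_u
    have hw_ldr := Within.cons hadj hldr_w.right_mem hldr_u.symm
    exact ((hldr_w.trans hw_ldr).trans (hstrong rfl)).mono subset_rfl (by lia)

theorem clusterInv (h : ClusterInv G k R ρ L ldr lab rel) :
    ClusterInv G k (3 * R + k) (3 * ρ + 1) (L + 1) ldr (fun v => newLabel lab K reg (lab v))
      fun v => newLabel lab K reg '' rel v ∪ reg v where
  lab_mem v := .inl ⟨_, h.lab_mem v, rfl⟩
  lab_ldr := by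
    rintro v _ (⟨l, hl, rfl⟩ | hl)
    · rcases newLabel_cases lab K reg l with heq | ⟨-, u, -, hu⟩
      · rw [heq, h.lab_ldr v l hl, heq]
      · rw [hreg.lab_ldr_of_mem h hu, hreg.newLabel_newLabel]
    · rw [hreg.lab_ldr_of_mem h hl, hreg.newLabel_of_mem hl]
  relay := by
    rintro v _ (⟨l, hl, rfl⟩ | hl)
    · exact hreg.relay h hl
    · exact (hreg.within_of_mem h hl).mono subset_rfl (by lia)
  strong := hreg.strong h
  card_le v := (Set.ncard_union_le _ _).trans (Nat.add_le_add
    ((Set.ncard_image_le (Set.toFinite _)).trans (h.card_le v)) (hreg.ncard_le v))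

theorem absorb_joinable (l : W) :
    absorb (joinable lab K reg l) (K l) = K (newLabel lab K reg l) := by
  by_cases hne : (joinable lab K reg l).Nonempty
  · obtain ⟨-, u, -, hu⟩ := (pick_mem hne l).1
    exact (if_pos hne).trans (hreg.source_of_mem hu).symm
  · rw [absorb, if_neg hne, newLabel, pick_of_not_nonempty hne]

end IsVoronoi

end absorption

section grow

variable {W : Type} [Finite W] [LinearOrder W]

/-- Every pending cluster at distance at most `k` from a source cluster is absorbed by a source
cluster. -/
noncomputable def grow (k R L : ℕ) : NetMap (Node W Status) (Node W Status) :=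
  (voronoi k).andThen ((flood (fun a : Node W Status × Set W => a.1.rel)
      (fun a => {p | p.1 = a.1.lab ∧ (∃ c, a.1.dat = .pending c) ∧ p.2 ∈ a.2}) 1 L id
      (2 * R)).andThen
    (NetMap.ofLocal fun a =>
      ⟨a.1.1.me, pick {c | (a.1.1.lab, c) ∈ a.2} a.1.1.lab,
        (fun l => pick {c | (l, c) ∈ a.2} l) '' a.1.1.rel ∪ a.1.2,
        absorb {c | (a.1.1.lab, c) ∈ a.2} a.1.1.dat⟩))

theorem Realizable.grow {B : ℕ} (hB : 1 ≤ B) (hW : Nat.card W ≤ 2 ^ B) (k R L : ℕ) :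
    Realizable B (k * 2 + 2 * R * (L * 3)) (grow (W := W) k R L) :=
  (Realizable.voronoi hB hW k).andThen
    ((Realizable.flood (b := 1) hB hW (by rwa [one_mul]) _ _ 1 L id (2 * R)).andThen (ofLocal _ 0))

theorem grow_config {V : Type} {G : SimpleGraph V} {k R R' ρ L L' : ℕ} {ldr : W → V}
    {me lab : V → W} {rel : V → Set W} (h : ClusterInv G k R ρ L ldr lab rel) (hR : R ≤ R')
    (hL : L ≤ L') (K : W → Status) :
    ∃ (nl : W → W) (rel' : V → Set W),
      grow k R' L' V G (config me lab rel K) = config me (fun v => nl (lab v)) rel' K ∧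
      ClusterInv G k (3 * R + k) (3 * ρ + 1) (L + 1) ldr (fun v => nl (lab v)) rel' ∧
      IsAbsorption G k lab K nl := by
  obtain ⟨reg, hrun, hreg⟩ := voronoi_apply G (config me lab rel K) k
  simp only [config] at hreg
  refine ⟨newLabel lab K reg, _, ?_, hreg.clusterInv h, hreg.isAbsorption⟩
  funext v
  have hflood {l : W} (hl : l ∈ rel v) : {c | l ∈ rel v ∧ c ∈ smallest 1 id {e | ∃ u,
      Within G {w | l ∈ rel w} (2 * R') v u ∧ l = lab u ∧ (∃ c, K (lab u) = .pending c) ∧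
        e ∈ reg u}} = joinable lab K reg l := by
    have hmet : {e | ∃ u, Within G {w | l ∈ rel w} (2 * R') v u ∧ l = lab u ∧
        (∃ c, K (lab u) = .pending c) ∧ e ∈ reg u} =
        {c | (∃ c', K l = .pending c') ∧ ∃ u, lab u = l ∧ c ∈ reg u} := by
      ext e
      constructor
      · rintro ⟨u, -, rfl, hpend, hu⟩
        exact ⟨hpend, u, rfl, hu⟩
      · rintro ⟨hpend, u, rfl, hu⟩
        exact ⟨u, ((h.mono hR le_rfl le_rfl).within_iff hl).2 (h.lab_mem u), rfl, hpend, hu⟩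
    rw [hmet]
    simp only [hl, true_and]
    rfl
  simp only [grow, NetMap.andThen, NetMap.ofLocal, hrun]
  rw [flood_apply (rel := fun a : Node W Status × Set W => a.1.rel) G _ id (2 * R')
    fun u => (Nat.mul_one _).trans_le ((h.card_le u).trans hL)]
  simp only [floodState, config, Set.mem_ofPred_eq]
  rw [hflood (h.lab_mem v), hreg.absorb_joinable,
    Set.image_congr fun l hl => congrArg (pick · l) (hflood hl)]
  rfl

end grow

/-! ### Color reduction -/

section recolor

open Finset Polynomial

/-- The polynomial whose coefficients are the first `b` bits of `c`. -/
noncomputable def bitPoly (q b c : ℕ) : (ZMod q)[X] :=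
  ∑ i ∈ Finset.range b, C (if c.testBit i then 1 else 0) * X ^ i

theorem coeff_bitPoly (q b c i : ℕ) :
    (bitPoly q b c).coeff i = if i < b ∧ c.testBit i then 1 else 0 := by
  simp only [bitPoly, finsetSum_coeff, coeff_C_mul_X_pow, Finset.sum_ite_eq, Finset.mem_range,
    ite_and]

variable {q b c c' : ℕ} [Fact q.Prime]

theorem bitPoly_injOn : Set.InjOn (bitPoly q b) (Set.Iio (2 ^ b)) := by
  refine fun c hc c' hc' h => Nat.eq_of_testBit_eq fun i => ?_
  rcases lt_or_ge i b with hi | hi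
  · have hcoeff := congrArg (coeff · i) h
    simp only [coeff_bitPoly, hi, true_and] at hcoeff
    cases hb : c.testBit i <;> cases hb' : c'.testBit i <;> simp [hb, hb'] at hcoeff ⊢
  · have hpow : 2 ^ b ≤ 2 ^ i := Nat.pow_le_pow_right two_pos hi
    rw [Nat.testBit_lt_two_pow (lt_of_lt_of_le hc hpow),
      Nat.testBit_lt_two_pow (lt_of_lt_of_le hc' hpow)]

theorem card_eval_bitPoly_eq_le (hc : c < 2 ^ b) (hc' : c' < 2 ^ b) (hne : c ≠ c') :
    #{x | (bitPoly q b c).eval x = (bitPoly q b c').eval x} ≤ b := by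
  have hsub : bitPoly q b c - bitPoly q b c' ≠ 0 := fun h =>
    hne (bitPoly_injOn hc hc' (sub_eq_zero.1 h))
  have hdeg : (bitPoly q b c - bitPoly q b c').natDegree ≤ b :=
    natDegree_le_iff_coeff_eq_zero.2 fun i hi => by simp [coeff_bitPoly, hi.not_gt]
  calc #{x | (bitPoly q b c).eval x = (bitPoly q b c').eval x}
      ≤ #(bitPoly q b c - bitPoly q b c').roots.toFinset := by
        refine Finset.card_le_card fun x hx => ?_
        simpa [hsub, sub_eq_zero] using hx
    _ ≤ (bitPoly q b c - bitPoly q b c').natDegree :=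
        (Multiset.toFinset_card_le _).trans (card_roots' _)
    _ ≤ b := hdeg

theorem exists_eval_bitPoly_ne {Δ : ℕ} (hΔ : Δ * b < q) {s : Set ℕ} (hc : c < 2 ^ b)
    (hs : ∀ a ∈ s, a < 2 ^ b) (hcard : s.ncard ≤ Δ) :
    ∃ x : ZMod q, ∀ a ∈ s, c ≠ a → (bitPoly q b c).eval x ≠ (bitPoly q b a).eval x := by
  classical
  have hfin : s.Finite := (Set.finite_Iio (2 ^ b)).subset hs
  let bad : Finset (ZMod q) := {a ∈ hfin.toFinset | c ≠ a}.biUnion fun a =>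
    {x | (bitPoly q b c).eval x = (bitPoly q b a).eval x}
  have hbad : #bad < #(Finset.univ : Finset (ZMod q)) :=
    calc #bad ≤ #{a ∈ hfin.toFinset | c ≠ a} * b := by
          refine Finset.card_biUnion_le_card_mul _ _ b fun a ha => ?_
          rw [Finset.mem_filter, Set.Finite.mem_toFinset] at ha
          exact card_eval_bitPoly_eq_le hc (hs a ha.1) ha.2
      _ ≤ Δ * b := by
          refine Nat.mul_le_mul_right _ ((Finset.card_filter_le _ _).trans ?_)
          rwa [← Set.ncard_eq_toFinset_card s hfin]
      _ < #(Finset.univ : Finset (ZMod q)) := by rwa [Finset.card_univ, ZMod.card]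
  obtain ⟨x, -, hx⟩ := Finset.exists_mem_notMem_of_card_lt_card hbad
  refine ⟨x, fun a ha hne h => hx (Finset.mem_biUnion.2 ⟨a, ?_, ?_⟩)⟩ <;> simp [ha, hne, h]

/-- The new color is a point of the graph of the polynomial of the old color `c` which is on none of
the graphs of the polynomials of the colors in `s`. -/
theorem exists_recolor {Δ : ℕ} (hΔ : Δ * b < q) :
    ∃ φ : ℕ → Set ℕ → ℕ, (∀ c s, φ c s < q ^ 2) ∧ ∀ c c' s s', c < 2 ^ b →
      (∀ a ∈ s, a < 2 ^ b) → s.ncard ≤ Δ → c' ∈ s → c ≠ c' → φ c s ≠ φ c' s' := by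
  choose! x hx using fun (c : ℕ) (s : Set ℕ) hc hs =>
    exists_eval_bitPoly_ne (c := c) (s := s) hΔ hc hs
  let code : ZMod q × ZMod q ≃ Fin (q ^ 2) :=
    Fintype.equivFinOfCardEq (by rw [Fintype.card_prod, ZMod.card, sq])
  refine ⟨fun c s => code (x c s, (bitPoly q b c).eval (x c s)), fun c s => Fin.is_lt _, ?_⟩
  intro c c' s s' hc hs hcard hc' hne h
  obtain ⟨hpoint, hvalue⟩ := Prod.ext_iff.1 (code.injective (Fin.ext h))
  simp only at hpoint hvalue
  exact hx c s hc hs hcard c' hc' hne (by rw [hvalue, hpoint])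

end recolor

/-- The number of bits of a color after one step of color reduction that starts with `b` bits, in a
graph of degree at most `2 ^ e`. -/
def nextBits (e b : ℕ) : ℕ := 2 * (e + 1) + 2 * Nat.clog 2 b

theorem exists_recolor_bits (e b : ℕ) (hb : 1 ≤ b) :
    ∃ φ : ℕ → Set ℕ → ℕ, (∀ c s, φ c s < 2 ^ nextBits e b) ∧ ∀ c c' s s', c < 2 ^ b →
      (∀ a ∈ s, a < 2 ^ b) → s.ncard ≤ 2 ^ e → c' ∈ s → c ≠ c' → φ c s ≠ φ c' s' := by
  obtain ⟨q, hq, hlt, hle⟩ := Nat.exists_prime_lt_and_le_two_mul (2 ^ e * b) (by positivity)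
  have := Fact.mk hq
  obtain ⟨φ, hφ, hproper⟩ := exists_recolor hlt
  refine ⟨φ, fun c s => (hφ c s).trans_le ?_, hproper⟩
  have hclog : b ≤ 2 ^ Nat.clog 2 b := Nat.le_pow_clog one_lt_two b
  calc q ^ 2 ≤ (2 * (2 ^ e * 2 ^ Nat.clog 2 b)) ^ 2 := by
        gcongr
        exact hle.trans (by gcongr)
    _ = 2 ^ nextBits e b := by rw [nextBits]; ring

/-- A bound for the number of bits of the final colors. -/
def finalBits (e : ℕ) : ℕ := 22 * e + 102

theorem four_mul_add_three_le_two_pow {m : ℕ} (hm : 5 ≤ m) : 4 * m + 3 ≤ 2 ^ m := by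
  induction m, hm using Nat.le_induction with
  | base => norm_num
  | succ m hm ih => rw [pow_succ]; lia

theorem four_mul_clog_le {x : ℕ} (hx : 20 ≤ x) : 4 * Nat.clog 2 x ≤ x := by
  have hpow := four_mul_add_three_le_two_pow (m := x / 4) (by lia)
  have hclog : Nat.clog 2 x ≤ x / 4 := Nat.clog_le_of_le_pow (by lia)
  lia

theorem clog_two_le_self (x : ℕ) : Nat.clog 2 x ≤ x :=
  Nat.clog_le_of_le_pow Nat.lt_two_pow_self.le

theorem nextBits_nextBits_le (e b : ℕ) :
    nextBits e (nextBits e b) ≤ max (Nat.clog 2 b) (finalBits e) := by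
  set x := Nat.clog 2 b with hx
  simp only [nextBits, finalBits, ← hx]
  by_cases h : 4 * (e + 1) + 20 ≤ x
  · have hclog : Nat.clog 2 (2 * (e + 1) + 2 * x) ≤ 2 + Nat.clog 2 x := by
      have hpow := Nat.le_pow_clog one_lt_two x
      exact Nat.clog_le_of_le_pow (by rw [pow_add]; lia)
    have hfour := four_mul_clog_le (x := x) (by lia)
    exact le_max_of_le_left (by lia)
  · have hself := clog_two_le_self (2 * (e + 1) + 2 * x)
    exact le_max_of_le_right (by lia)

theorem nextBits_le (e b : ℕ) : nextBits e b ≤ max b (finalBits e) := by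
  rw [nextBits, finalBits]
  by_cases h : 4 * (e + 1) + 20 ≤ b
  · have hfour := four_mul_clog_le (x := b) (by lia)
    exact le_max_of_le_left (by lia)
  · have hself := clog_two_le_self b
    exact le_max_of_le_right (by lia)

/-- The number of bits of the colors after `t` steps of color reduction. -/
def bitSeq (e S : ℕ) : ℕ → ℕ
  | 0 => S
  | t + 1 => nextBits e (bitSeq e S t)

theorem bitSeq_le (e S t : ℕ) : bitSeq e S t ≤ max S (finalBits e) := by
  induction t with
  | zero => exact le_max_left _ _
  | succ t ih => exact (nextBits_le _ _).trans (max_le ih (le_max_right _ _))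

theorem one_le_bitSeq {e S : ℕ} (hS : 1 ≤ S) (t : ℕ) : 1 ≤ bitSeq e S t := by
  cases t with
  | zero => exact hS
  | succ t => rw [bitSeq, nextBits]; lia

/-- Two steps replace the number of bits by its logarithm, up to the additive constant. -/
theorem bitSeq_add_two_mul_logStar_le (e S n : ℕ) :
    ∀ t, bitSeq e S t ≤ max n (finalBits e) → bitSeq e S (t + 2 * logStar n) ≤ finalBits e := by
  induction n using Nat.strong_induction_on with
  | _ n ih =>
    intro t ht
    rw [logStar]
    split_ifs with hn
    · exact ht.trans (max_le (by rw [finalBits]; lia) le_rfl)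
    · have hlt : Nat.clog 2 n < n := by
        have hpow := @Nat.lt_two_pow_self (n - 1)
        have hclog : Nat.clog 2 n ≤ n - 1 := Nat.clog_le_of_le_pow (by lia)
        lia
      rw [show t + 2 * (logStar (Nat.clog 2 n) + 1) = t + 2 + 2 * logStar (Nat.clog 2 n) by ring]
      refine ih _ hlt _ ((nextBits_nextBits_le e _).trans (max_le ?_ (le_max_right _ _)))
      refine (Nat.clog_mono_right 2 ht).trans ?_
      rcases le_total n (finalBits e) with h | h
      · exact le_max_of_le_right ((max_eq_right h).symm ▸ clog_two_le_self _)
      · exact le_max_of_le_left (congrArg (Nat.clog 2) (max_eq_left h)).le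

theorem bitSeq_two_mul_logStar_le (e S : ℕ) : bitSeq e S (2 * logStar S) ≤ finalBits e := by
  simpa only [Nat.zero_add] using bitSeq_add_two_mul_logStar_le e S S 0 (le_max_left _ _)

/-! ### The conflict graph -/

/-- What a cluster knows about its neighborhood in the cluster graph. The clusters whose status is
`source` are the active ones; `th` is the largest label of an out-neighbor, or the largest label at
all if the cluster has low degree. -/
structure Profile (W : Type) where
  status : Status
  th : W
  high : Prop
  heavy : Prop
  free : Prop

/-- The working data of a cluster: its profile, the pairs of label and payload that it has received
from its in-neighbors, and its own payload. -/
structure Work (W Q : Type) where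
  prof : Profile W
  inn : Set (W × Q)
  pay : Q

section threshold

variable {W : Type} [LinearOrder W] [OrderTop W]

open Classical in
/-- The largest element of `z`, or `⊤` if `z` has fewer than `d` elements. -/
noncomputable def threshold (d : ℕ) (z : Set W) : W :=
  if h : d ≤ z.ncard ∧ ∃ m, IsGreatest z m then h.2.choose else ⊤

theorem threshold_eq_top {d : ℕ} {z : Set W} (h : ¬ d ≤ z.ncard) : threshold d z = ⊤ :=
  dif_neg fun h' => h h'.1

variable [Finite W]

theorem isGreatest_threshold {d : ℕ} (hd : 1 ≤ d) {z : Set W} (h : d ≤ z.ncard) :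
    IsGreatest z (threshold d z) := by
  have hne : z.Nonempty := (Set.ncard_pos (Set.toFinite _)).1 (hd.trans h)
  obtain ⟨m, hm, hmax⟩ := Set.exists_max_image z id (Set.toFinite _) hne
  have hex : d ≤ z.ncard ∧ ∃ m, IsGreatest z m := ⟨h, m, hm, hmax⟩
  rw [threshold, dif_pos hex]
  exact hex.2.choose_spec

theorem sep_le_threshold_smallest_eq {d : ℕ} (hd : 1 ≤ d) {N : Set W}
    (h : d ≤ (smallest d id N).ncard) :
    {u ∈ N | u ≤ threshold d (smallest d id N)} = smallest d id N := by
  have hgreatest := isGreatest_threshold hd h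
  refine Set.Subset.antisymm ?_ fun u hu => ⟨hu.1, hgreatest.2 hu⟩
  rintro u ⟨huN, hle⟩
  rcases hle.eq_or_lt with heq | hlt
  · exact heq ▸ hgreatest.1
  · exact mem_smallest_of_rank_lt huN hgreatest.1 (Prod.Lex.lt_iff.2 (Or.inl hlt))

theorem ncard_sep_le_threshold_smallest_le {d : ℕ} (hd : 1 ≤ d) (N : Set W) :
    {u ∈ N | u ≤ threshold d (smallest d id N)}.ncard ≤ d := by
  by_cases h : d ≤ (smallest d id N).ncard
  · rw [sep_le_threshold_smallest_eq hd h]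
    exact ncard_smallest_le _ _ _
  · have hN : N.ncard < d := not_le.1 fun hN => h (le_ncard_smallest hN)
    exact (Set.ncard_le_ncard (Set.sep_subset _ _)).trans hN.le

end threshold

section received

variable {W Q : Type} [LinearOrder W]

/-- The pairs that `u` extracts from a set of triples, whose first component is a threshold. -/
def incoming (u : W) (z : Set (W × W × Q)) : Set (W × Q) := {p | ∃ θ, u ≤ θ ∧ (θ, p) ∈ z}

/-- The triples of threshold, label and payload that the members of `Y` announce. -/
def announced (Y : Set W) (th : W → W) (pay : W → Q) : Set (W × W × Q) :=
  {e | ∃ A ∈ Y, e = (th A, A, pay A)}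

/-- The order by decreasing threshold. -/
def thKey (e : W × W × Q) : Wᵒᵈ := OrderDual.toDual e.1

theorem thKey_le {u : W} : ∀ a b : W × W × Q, thKey a ≤ thKey b → u ≤ b.1 → u ≤ a.1 :=
  fun _ _ hab hu => hu.trans (OrderDual.toDual_le_toDual.1 hab)

variable [Finite W] [Finite Q]

/-- The pairs that `u` receives from `Y` if only the `D` triples of largest threshold are
forwarded. -/
noncomputable def received (D : ℕ) (Y : Set W) (th : W → W) (pay : W → Q) (u : W) : Set (W × Q) :=
  incoming u (smallest D thKey (announced Y th pay))

variable {D : ℕ} {u : W} {Y : Set W} {th : W → W} {pay : W → Q}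

theorem exists_of_mem_received {p : W × Q} (hp : p ∈ received D Y th pay u) :
    ∃ A ∈ Y, u ≤ th A ∧ p = (A, pay A) := by
  obtain ⟨θ, hθ, ⟨A, hA, he⟩, -⟩ := hp
  rw [Prod.mk.injEq] at he
  exact ⟨A, hA, he.1 ▸ hθ, he.2⟩

theorem le_ncard_of_le_ncard_received (h : D ≤ (received D Y th pay u).ncard) :
    D ≤ {A ∈ Y | u ≤ th A}.ncard := by
  have hsub : received D Y th pay u ⊆ (fun A => (A, pay A)) '' {A ∈ Y | u ≤ th A} := by
    intro p hp
    obtain ⟨A, hA, hu, rfl⟩ := exists_of_mem_received hp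
    exact ⟨A, ⟨hA, hu⟩, rfl⟩
  exact h.trans ((Set.ncard_le_ncard hsub (Set.toFinite _)).trans
    (Set.ncard_image_le (Set.toFinite _)))

theorem ncard_received_le : (received D Y th pay u).ncard ≤ D := by
  have hsub : received D Y th pay u ⊆ Prod.snd '' smallest D thKey (announced Y th pay) :=
    fun p ⟨θ, _, hp⟩ => ⟨(θ, p), hp, rfl⟩
  exact (Set.ncard_le_ncard hsub).trans
    ((Set.ncard_image_le (Set.toFinite _)).trans (ncard_smallest_le _ _ _))

theorem ncard_lt_of_ncard_received_lt (h : (received D Y th pay u).ncard < D) :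
    {A ∈ Y | u ≤ th A}.ncard < D := by
  have hfew : {e ∈ smallest D thKey (announced Y th pay) | u ≤ e.1}.ncard < D := by
    refine (Set.ncard_le_ncard_of_injOn Prod.snd (t := received D Y th pay u)
      (fun e he => ⟨e.1, he.2, he.1⟩) ?_).trans_lt h
    rintro e ⟨⟨⟨A, -, rfl⟩, -⟩, -⟩ e' ⟨⟨⟨A', -, rfl⟩, -⟩, -⟩ heq
    rw [(Prod.mk.injEq _ _ _ _ ▸ heq : A = A' ∧ _).1]
  refine (Set.ncard_le_ncard_of_injOn (t := received D Y th pay u) (fun A => (A, pay A))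
      (fun A hA => ?_) ?_).trans_lt h
  · exact ⟨th A, hA.2,
      mem_smallest_of_ncard_lt (p := fun e => u ≤ e.1) thKey_le hfew ⟨A, hA.1, rfl⟩ hA.2⟩
  · exact fun A _ A' _ heq => congrArg Prod.fst heq

theorem mem_received (h : {A ∈ Y | u ≤ th A}.ncard ≤ D) {A : W} (hA : A ∈ Y) (hu : u ≤ th A) :
    (A, pay A) ∈ received D Y th pay u := by
  refine ⟨th A, hu, mem_smallest_of_ncard_le (p := fun e => u ≤ e.1) thKey_le ?_ ⟨A, hA, rfl⟩ hu⟩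
  have hsub : {e ∈ announced Y th pay | u ≤ e.1} ⊆
      (fun A => (th A, A, pay A)) '' {A ∈ Y | u ≤ th A} := by
    rintro e ⟨⟨A, hA, rfl⟩, hu⟩
    exact ⟨A, ⟨hA, hu⟩, rfl⟩
  exact (Set.ncard_le_ncard hsub).trans ((Set.ncard_image_le (Set.toFinite _)).trans h)

end received

section conflict

variable {V W Q : Type}

/-- The cluster `u` is an out-neighbor of `A`: both are active, they are near to each other, and the
label of `u` does not exceed the threshold of `A`. -/
def Out [LE W] (G : SimpleGraph V) (k : ℕ) (lab : V → W) (prof : W → Profile W) (A u : W) : Prop :=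
  Near G k lab A u ∧ (prof A).status = .source ∧ (prof u).status = .source ∧ u ≤ (prof A).th

/-- The cluster `A'` is free and has a common out-neighbor with `A`. -/
def Conflict [LE W] (G : SimpleGraph V) (k : ℕ) (lab : V → W) (prof : W → Profile W)
    (A A' : W) : Prop :=
  (prof A').free ∧ ∃ u, Out G k lab prof A u ∧ Out G k lab prof A' u

/-- The profiles are correct. A cluster has at most `d` out-neighbors, and all active clusters near
to it are out-neighbors if it is not `high`. A cluster is `heavy` if it has at least `d ^ 2`
in-neighbors, and `free` if no heavy cluster is near. -/
structure IsProfile [LE W] (G : SimpleGraph V) (k : ℕ) (lab : V → W) (d : ℕ)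
    (prof : W → Profile W) : Prop where
  ncard_out_le : ∀ A, {u | Out G k lab prof A u}.ncard ≤ d
  le_ncard_out : ∀ A, (prof A).status = .source → (prof A).high →
    d ≤ {u | Out G k lab prof A u}.ncard
  out_of_not_high : ∀ A u, ¬ (prof A).high → Near G k lab A u → (prof A).status = .source →
    (prof u).status = .source → Out G k lab prof A u
  heavy_in : ∀ u, (prof u).heavy → (prof u).status = .source ∧
    d ^ 2 ≤ {A | Out G k lab prof A u}.ncard
  light_in : ∀ u, (prof u).status = .source → ¬ (prof u).heavy →
    {A | Out G k lab prof A u}.ncard < d ^ 2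
  free_iff : ∀ A, (prof A).free ↔ ¬ ∃ u, Near G k lab A u ∧ (prof u).heavy

section rounds

variable [Finite W] [LinearOrder W] [Finite Q]

/-- Every cluster learns the free clusters of which it is an out-neighbor. -/
noncomputable def inStep (k R L d : ℕ) : NetMap (Node W (Work W Q)) (Node W (Work W Q)) :=
  clusterRound k R L (d ^ 2) thKey
    (fun A s => {e | s.prof.status = .source ∧ s.prof.free ∧ e = (s.prof.th, A, s.pay)})
    fun A s z => ⟨s.prof, incoming A z, s.pay⟩

/-- Every cluster learns the clusters with which it is in conflict, and updates its payload by
`h`. -/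
noncomputable def outStep (k R L d : ℕ) (h : W → Profile W → Q → Set (W × Q) → Q) :
    NetMap (Node W (Work W Q)) (Node W (Work W Q)) :=
  clusterRound k R L (d ^ 3) (fun e : W × W × Q => e.1)
    (fun A s => {e | s.prof.status = .source ∧ e.1 = A ∧ e.2 ∈ s.inn})
    fun A s z => ⟨s.prof, s.inn, h A s.prof s.pay {p | ∃ u, u ≤ s.prof.th ∧ (u, p) ∈ z}⟩

/-- A round of communication in the conflict graph. -/
noncomputable def confRound (k R L d : ℕ) (h : W → Profile W → Q → Set (W × Q) → Q) :
    NetMap (Node W (Work W Q)) (Node W (Work W Q)) :=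
  (inStep k R L d).andThen (outStep k R L d h)

end rounds

section conflicts

variable [Finite W] [LinearOrder W] [Finite Q]

/-- The pairs that `u` learns about its free in-neighbors. -/
noncomputable def freeIn (G : SimpleGraph V) (k : ℕ) (lab : V → W) (d : ℕ) (prof : W → Profile W)
    (pay : W → Q) (u : W) : Set (W × Q) :=
  received (d ^ 2) {A | Near G k lab u A ∧ (prof A).status = .source ∧ (prof A).free}
    (fun A => (prof A).th) pay u

/-- The pairs that the active clusters `u` near to `A` have learned, together with `u`. -/
noncomputable def relayedIn (G : SimpleGraph V) (k : ℕ) (lab : V → W) (d : ℕ) (prof : W → Profile W)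
    (pay : W → Q) (A : W) : Set (W × W × Q) :=
  {e | Near G k lab A e.1 ∧ (prof e.1).status = .source ∧ e.2 ∈ freeIn G k lab d prof pay e.1}

/-- The pairs that `A` learns about the clusters with which it is in conflict. -/
noncomputable def conflicts (G : SimpleGraph V) (k : ℕ) (lab : V → W) (d : ℕ) (prof : W → Profile W)
    (pay : W → Q) (A : W) : Set (W × Q) :=
  {p | ∃ u, u ≤ (prof A).th ∧
    (u, p) ∈ smallest (d ^ 3) (fun e => e.1) (relayedIn G k lab d prof pay A)}

variable {G : SimpleGraph V} {k R ρ L d : ℕ} {ldr : W → V} {me lab : V → W}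
  {rel : V → Set W} {prof : W → Profile W} {pay : W → Q}

theorem inStep_config (inv : ClusterInv G k R ρ L ldr lab rel) (inn : W → Set (W × Q)) :
    inStep k R L d V G (config me lab rel fun A => ⟨prof A, inn A, pay A⟩) =
      config me lab rel fun A => ⟨prof A, freeIn G k lab d prof pay A, pay A⟩ := by
  have hannounced : ∀ A, {e : W × W × Q | ∃ A', Near G k lab A A' ∧
      e ∈ {e | (prof A').status = .source ∧ (prof A').free ∧ e = ((prof A').th, A', pay A')}} =
      announced {A' | Near G k lab A A' ∧ (prof A').status = .source ∧ (prof A').free}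
        (fun A => (prof A).th) pay := fun A =>
    Set.ext fun e => exists_congr fun A' => by simp only [Set.mem_ofPred_eq, and_assoc]
  rw [inStep, clusterRound_config inv]
  simp only [hannounced, freeIn, received]

theorem confRound_config (inv : ClusterInv G k R ρ L ldr lab rel)
    (h : W → Profile W → Q → Set (W × Q) → Q) (inn : W → Set (W × Q)) :
    confRound k R L d h V G (config me lab rel fun A => ⟨prof A, inn A, pay A⟩) =
      config me lab rel fun A => ⟨prof A, freeIn G k lab d prof pay A,
        h A (prof A) (pay A) (conflicts G k lab d prof pay A)⟩ := by
  have hrelayed : ∀ A, {e : W × W × Q | ∃ A', Near G k lab A A' ∧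
      e ∈ {e | (prof A').status = .source ∧ e.1 = A' ∧ e.2 ∈ freeIn G k lab d prof pay A'}} =
      relayedIn G k lab d prof pay A := by
    intro A
    ext e
    constructor
    · rintro ⟨_, hnear, hsource, rfl, he⟩
      exact ⟨hnear, hsource, he⟩
    · exact fun ⟨hnear, hsource, he⟩ => ⟨_, hnear, hsource, rfl, he⟩
  rw [confRound, NetMap.andThen, inStep_config inv, outStep, clusterRound_config inv]
  exact congrArg _ (funext fun A => by rw [conflicts, ← hrelayed])

theorem ncard_conflicts_le (A : W) : (conflicts G k lab d prof pay A).ncard ≤ d ^ 3 := by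
  have hsub : conflicts G k lab d prof pay A ⊆
      Prod.snd '' smallest (d ^ 3) (fun e => e.1) (relayedIn G k lab d prof pay A) :=
    fun p ⟨u, _, hp⟩ => ⟨(u, p), hp, rfl⟩
  exact (Set.ncard_le_ncard hsub).trans
    ((Set.ncard_image_le (Set.toFinite _)).trans (ncard_smallest_le _ _ _))

theorem ncard_relayedIn_sep_le (hprof : IsProfile G k lab d prof) {A : W}
    (hA : (prof A).status = .source) :
    {e ∈ relayedIn G k lab d prof pay A | e.1 ≤ (prof A).th}.ncard ≤ d ^ 3 := by
  have hsub : {e ∈ relayedIn G k lab d prof pay A | e.1 ≤ (prof A).th} ⊆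
      {e | e.1 ∈ {u | Out G k lab prof A u} ∧ e.2 ∈ freeIn G k lab d prof pay e.1} :=
    fun e ⟨⟨hnear, hsource, he⟩, hle⟩ => ⟨⟨hnear, hA, hsource, hle⟩, he⟩
  calc {e ∈ relayedIn G k lab d prof pay A | e.1 ≤ (prof A).th}.ncard
      ≤ {u | Out G k lab prof A u}.ncard * d ^ 2 :=
        (Set.ncard_le_ncard hsub).trans (ncard_fibered_le fun _ _ => ncard_received_le)
    _ ≤ d * d ^ 2 := Nat.mul_le_mul_right _ (hprof.ncard_out_le A)
    _ = d ^ 3 := by ring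

theorem mem_conflicts_iff (hprof : IsProfile G k lab d prof) {A : W}
    (hA : (prof A).status = .source) {p : W × Q} :
    p ∈ conflicts G k lab d prof pay A ↔
      ∃ u, Out G k lab prof A u ∧ p ∈ freeIn G k lab d prof pay u := by
  constructor
  · rintro ⟨u, hle, ⟨hnear, hsource, hp⟩, -⟩
    exact ⟨u, ⟨hnear, hA, hsource, hle⟩, hp⟩
  · rintro ⟨u, ⟨hnear, -, hsource, hle⟩, hp⟩
    refine ⟨u, hle, mem_smallest_of_ncard_le (p := fun e : W × W × Q => e.1 ≤ (prof A).th)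
      (fun _ _ hab hb => le_trans hab hb) (ncard_relayedIn_sep_le hprof hA) ?_ hle⟩
    exact ⟨hnear, hsource, hp⟩

theorem mem_conflicts_iff_conflict (hprof : IsProfile G k lab d prof) {A : W}
    (hA : (prof A).status = .source) (hfree : (prof A).free) {p : W × Q} :
    p ∈ conflicts G k lab d prof pay A ↔
      ∃ A', p = (A', pay A') ∧ Conflict G k lab prof A A' := by
  rw [mem_conflicts_iff hprof hA]
  constructor
  · rintro ⟨u, hu, hp⟩
    obtain ⟨A', ⟨hnear, hsource, hfree'⟩, hle, rfl⟩ := exists_of_mem_received hp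
    exact ⟨A', rfl, hfree', u, hu, hnear.symm, hsource, hu.2.2.1, hle⟩
  · rintro ⟨A', rfl, hfree', u, hu, hu'⟩
    refine ⟨u, hu, mem_received ?_ ⟨hu'.1.symm, hu'.2.1, hfree'⟩ hu'.2.2.2⟩
    have hlight : ¬ (prof u).heavy := fun hheavy => (hprof.free_iff A).1 hfree ⟨u, hu.1, hheavy⟩
    refine le_trans (Set.ncard_le_ncard ?_) (hprof.light_in u hu.2.2.1 hlight).le
    exact fun A'' ⟨⟨hnear, hsource, _⟩, hle⟩ => ⟨hnear.symm, hsource, hu.2.2.1, hle⟩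

end conflicts

section prepare

variable [Finite W] {G : SimpleGraph V} {k R ρ L d : ℕ} {ldr : W → V} {me lab : V → W}
  {rel : V → Set W} {K : W → Status} {pay : W → Q}

/-- A cluster is heavy if it is an out-neighbor of many clusters. -/
noncomputable def heavyStep (d : ℕ) : NetMap (Node W (Work W Q)) (Node W (Work W Q)) :=
  NetMap.ofLocal fun a => a.setDat ⟨⟨a.dat.prof.status, a.dat.prof.th, a.dat.prof.high,
    a.dat.prof.status = .source ∧ d ^ 2 ≤ a.dat.inn.ncard, a.dat.prof.free⟩, a.dat.inn, a.dat.pay⟩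

/-- A cluster is free if no heavy cluster is near. -/
noncomputable def freeStep (k R L : ℕ) : NetMap (Node W (Work W Q)) (Node W (Work W Q)) :=
  clusterRound k R L 1 (id : Unit → Unit) (fun _ s => {_e | s.prof.heavy}) fun _ s z =>
    ⟨⟨s.prof.status, s.prof.th, s.prof.high, s.prof.heavy, ¬ z.Nonempty⟩, s.inn, s.pay⟩

theorem freeStep_config (inv : ClusterInv G k R ρ L ldr lab rel) (prof : W → Profile W)
    (inn : W → Set (W × Q)) :
    freeStep k R L V G (config me lab rel fun A => ⟨prof A, inn A, pay A⟩) =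
      config me lab rel fun A => ⟨⟨(prof A).status, (prof A).th, (prof A).high, (prof A).heavy,
        ¬ ∃ u, Near G k lab A u ∧ (prof u).heavy⟩, inn A, pay A⟩ := by
  have hnonempty : ∀ A, (smallest 1 id {e : Unit | ∃ A', Near G k lab A A' ∧
      e ∈ {_e : Unit | (prof A').heavy}}).Nonempty ↔
      ∃ u, Near G k lab A u ∧ (prof u).heavy := by
    intro A
    rw [nonempty_smallest_one]
    exact ⟨fun ⟨_, he⟩ => he, fun hu => ⟨(), hu⟩⟩
  rw [freeStep, clusterRound_config inv]
  simp only [hnonempty]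

variable [LinearOrder W] [OrderTop W]

/-- Every active cluster announces its label to the clusters near to it, which determines the
thresholds. -/
noncomputable def degreeStep (k R L d : ℕ) (pay : W → Q) :
    NetMap (Node W Status) (Node W (Work W Q)) :=
  clusterRound k R L d id (fun A s => {u | u = A ∧ s = .source}) fun A s z =>
    ⟨⟨s, threshold d z, d ≤ z.ncard, False, True⟩, ∅, pay A⟩

/-- The active clusters near to `A`. -/
def sources (G : SimpleGraph V) (k : ℕ) (lab : V → W) (K : W → Status) (A : W) : Set W :=
  {u | Near G k lab A u ∧ K u = .source}

/-- The threshold that `A` computes from the active clusters near to it. -/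
noncomputable def cutoff (G : SimpleGraph V) (k : ℕ) (lab : V → W) (d : ℕ) (K : W → Status)
    (A : W) : W :=
  threshold d (smallest d id (sources G k lab K A))

theorem degreeStep_config (inv : ClusterInv G k R ρ L ldr lab rel) :
    degreeStep k R L d pay V G (config me lab rel K) =
      config me lab rel fun A => ⟨⟨K A, cutoff G k lab d K A,
        d ≤ (smallest d id (sources G k lab K A)).ncard, False, True⟩, ∅, pay A⟩ := by
  have hsources : ∀ A, {e | ∃ A', Near G k lab A A' ∧ e ∈ {u | u = A' ∧ K A' = .source}} =
      sources G k lab K A := by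
    intro A
    ext e
    constructor
    · rintro ⟨_, hnear, rfl, hsource⟩
      exact ⟨hnear, hsource⟩
    · exact fun ⟨hnear, hsource⟩ => ⟨e, hnear, rfl, hsource⟩
  rw [degreeStep, clusterRound_config inv]
  simp only [hsources, cutoff]

variable [Finite Q]

/-- The pairs that `u` learns about its in-neighbors. -/
noncomputable def sourceIn (G : SimpleGraph V) (k : ℕ) (lab : V → W) (d : ℕ) (K : W → Status)
    (pay : W → Q) (u : W) : Set (W × Q) :=
  received (d ^ 2) (sources G k lab K u) (cutoff G k lab d K) pay u

/-- The profiles that the clusters compute if their status is given by `K`. -/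
noncomputable def profile (G : SimpleGraph V) (k : ℕ) (lab : V → W) (d : ℕ) (K : W → Status)
    (pay : W → Q) (A : W) : Profile W where
  status := K A
  th := cutoff G k lab d K A
  high := d ≤ (smallest d id (sources G k lab K A)).ncard
  heavy := K A = .source ∧ d ^ 2 ≤ (sourceIn G k lab d K pay A).ncard
  free := ¬ ∃ u, Near G k lab A u ∧ K u = .source ∧ d ^ 2 ≤ (sourceIn G k lab d K pay u).ncard

theorem setOf_out_profile_eq {u : W} (hu : K u = .source) :
    {A | Out G k lab (profile G k lab d K pay) A u} =
      {A ∈ sources G k lab K u | u ≤ cutoff G k lab d K A} := by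
  ext A
  constructor
  · rintro ⟨hnear, hsource, -, hle⟩
    exact ⟨⟨hnear.symm, hsource⟩, hle⟩
  · rintro ⟨⟨hnear, hsource⟩, hle⟩
    exact ⟨hnear.symm, hsource, hu, hle⟩

theorem isProfile_profile (hd : 1 ≤ d) : IsProfile G k lab d (profile G k lab d K pay) where
  ncard_out_le A := by
    refine le_trans (Set.ncard_le_ncard ?_)
      (ncard_sep_le_threshold_smallest_le hd (sources G k lab K A))
    exact fun u ⟨hnear, _, hsource, hle⟩ => ⟨⟨hnear, hsource⟩, hle⟩
  le_ncard_out A hA hhigh := by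
    refine le_trans hhigh (Set.ncard_le_ncard ?_)
    rw [← sep_le_threshold_smallest_eq hd hhigh]
    exact fun u ⟨⟨hnear, hsource⟩, hle⟩ => ⟨hnear, hA, hsource, hle⟩
  out_of_not_high A u hhigh hnear hA hu :=
    ⟨hnear, hA, hu, le_top.trans_eq (threshold_eq_top hhigh).symm⟩
  heavy_in u hu := by
    rw [setOf_out_profile_eq hu.1]
    exact ⟨hu.1, le_ncard_of_le_ncard_received hu.2⟩
  light_in u hu hheavy := by
    have hu' : K u = .source := hu
    rw [setOf_out_profile_eq hu']
    exact ncard_lt_of_ncard_received_lt (not_le.1 fun hle => hheavy ⟨hu, hle⟩)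
  free_iff _ := Iff.rfl

/-- The computation of the profiles of all clusters. -/
noncomputable def prepare (k R L d : ℕ) (pay : W → Q) :
    NetMap (Node W Status) (Node W (Work W Q)) :=
  (degreeStep k R L d pay).andThen ((inStep k R L d).andThen
    ((heavyStep d).andThen (freeStep k R L)))

theorem prepare_config (inv : ClusterInv G k R ρ L ldr lab rel) :
    prepare k R L d pay V G (config me lab rel K) =
      config me lab rel fun A =>
        ⟨profile G k lab d K pay A, sourceIn G k lab d K pay A, pay A⟩ := by
  have hheavyStep : ∀ K' : W → Work W Q, heavyStep d V G (config me lab rel K') =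
      config me lab rel fun A => ⟨⟨(K' A).prof.status, (K' A).prof.th, (K' A).prof.high,
        (K' A).prof.status = .source ∧ d ^ 2 ≤ (K' A).inn.ncard, (K' A).prof.free⟩,
        (K' A).inn, (K' A).pay⟩ := fun _ => rfl
  simp only [prepare, NetMap.andThen, degreeStep_config inv, inStep_config inv, hheavyStep,
    freeStep_config inv]
  simp only [freeIn, and_true]
  rfl

end prepare

end conflict

/-! ### Coloring and independent sets in the conflict graph -/

/-- A color of at most `m` bits, and the membership in the independent set. -/
abbrev Payload (m : ℕ) := Fin (2 ^ m) × Prop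

open Classical in
/-- A step of color reduction for colors of `b` bits and conflict degree at most `2 ^ e`. -/
noncomputable def recolor (e b : ℕ) : ℕ → Set ℕ → ℕ :=
  if h : 1 ≤ b then (exists_recolor_bits e b h).choose else fun _ _ => 0

theorem recolor_lt (e : ℕ) {b : ℕ} (hb : 1 ≤ b) (c : ℕ) (s : Set ℕ) :
    recolor e b c s < 2 ^ nextBits e b := by
  rw [recolor, dif_pos hb]
  exact (exists_recolor_bits e b hb).choose_spec.1 c s

theorem recolor_ne {e b : ℕ} (hb : 1 ≤ b) {c c' : ℕ} {s : Set ℕ} (s' : Set ℕ) (hc : c < 2 ^ b)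
    (hs : ∀ a ∈ s, a < 2 ^ b) (hcard : s.ncard ≤ 2 ^ e) (hc' : c' ∈ s) (hne : c ≠ c') :
    recolor e b c s ≠ recolor e b c' s' := by
  rw [recolor, dif_pos hb]
  exact (exists_recolor_bits e b hb).choose_spec.2 c c' s s' hc hs hcard hc' hne

section coloring

variable {V W : Type}

/-- The initial colors are the labels. -/
noncomputable def initialPayload [Finite W] (m : ℕ) (A : W) : Payload m :=
  (Fin.ofNat (2 ^ m) (Finite.equivFin W A), False)

/-- The colors of the clusters other than `A` in a set of conflicts. -/
def otherColors {m : ℕ} (A : W) (cf : Set (W × Payload m)) : Set ℕ :=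
  {c | ∃ p ∈ cf, p.1 ≠ A ∧ c = p.2.1}

/-- The payload of a cluster after a step of color reduction. -/
noncomputable def recolorUpd (e b m : ℕ) (A : W) (_ : Profile W) (p : Payload m)
    (cf : Set (W × Payload m)) : Payload m :=
  (Fin.ofNat (2 ^ m) (recolor e b p.1 (otherColors A cf)), p.2)

/-- The payload of a cluster after the clusters of color `i` have joined the independent set if
possible. -/
def joinUpd (i : ℕ) {m : ℕ} (_ : W) (b : Profile W) (p : Payload m) (cf : Set (W × Payload m)) :
    Payload m :=
  (p.1, p.2 ∨ (b.status = .source ∧ b.high ∧ b.free ∧ (p.1 : ℕ) = i ∧ ¬ ∃ p' ∈ cf, p'.2.2))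

section orders

variable [LinearOrder W] {G : SimpleGraph V} {k : ℕ} {lab : V → W} {prof : W → Profile W}

theorem Conflict.symm {A A' : W} (h : Conflict G k lab prof A A') (hA : (prof A).free) :
    Conflict G k lab prof A' A :=
  ⟨hA, h.2.imp fun _ => And.symm⟩

/-- The colors of the free clusters form a proper coloring of the conflict graph with colors of at
most `b` bits. -/
structure IsProperColoring (G : SimpleGraph V) (k : ℕ) (lab : V → W) (prof : W → Profile W) (b : ℕ)
    {m : ℕ} (pay : W → Payload m) : Prop where
  lt : ∀ A, ((pay A).1 : ℕ) < 2 ^ b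
  ne : ∀ A A', (prof A).free → Conflict G k lab prof A A' → A ≠ A' → (pay A).1 ≠ (pay A').1

/-- The clusters that have joined form an independent set of the conflict graph that is maximal
among the free clusters of high degree and color less than `i`. -/
structure IsGreedySet (G : SimpleGraph V) (k : ℕ) (lab : V → W) (prof : W → Profile W) {m : ℕ}
    (i : ℕ) (pay : W → Payload m) : Prop where
  mem : ∀ A, (pay A).2 → (prof A).status = .source ∧ (prof A).high ∧ (prof A).free ∧
    ((pay A).1 : ℕ) < i
  indep : ∀ A A', (pay A).2 → (pay A').2 → Conflict G k lab prof A A' → A = A'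
  maximal : ∀ A, (prof A).status = .source → (prof A).high → (prof A).free →
    ((pay A).1 : ℕ) < i → (pay A).2 ∨ ∃ A', (pay A').2 ∧ Conflict G k lab prof A A'

end orders

theorem coe_recolorUpd {e b m : ℕ} (hb : 1 ≤ b) (hm : nextBits e b ≤ m) (A : W) (P : Profile W)
    (p : Payload m) (cf : Set (W × Payload m)) :
    ((recolorUpd e b m A P p cf).1 : ℕ) = recolor e b p.1 (otherColors A cf) :=
  Nat.mod_eq_of_lt ((recolor_lt e hb _ _).trans_le (Nat.pow_le_pow_right two_pos hm))

variable [Finite W]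

theorem coe_initialPayload {B m : ℕ} (hW : Nat.card W ≤ 2 ^ B) (hm : B ≤ m) (A : W) :
    ((initialPayload m A).1 : ℕ) = Finite.equivFin W A :=
  Nat.mod_eq_of_lt <| (Fin.is_lt _).trans_le (hW.trans (Nat.pow_le_pow_right two_pos hm))

theorem ncard_otherColors_le {m D : ℕ} {A : W} {cf : Set (W × Payload m)} (h : cf.ncard ≤ D) :
    (otherColors A cf).ncard ≤ D := by
  have hsub : otherColors A cf ⊆ (fun p : W × Payload m => (p.2.1 : ℕ)) '' cf := by
    rintro c ⟨p, hp, -, rfl⟩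
    exact ⟨p, hp, rfl⟩
  exact (Set.ncard_le_ncard hsub ((Set.toFinite _).image _)).trans
    ((Set.ncard_image_le (Set.toFinite _)).trans h)

variable [LinearOrder W] {G : SimpleGraph V} {k R ρ L d e b m B : ℕ} {ldr : W → V} {me lab : V → W}
  {rel : V → Set W} {prof : W → Profile W}

section iteratePay

variable {Q : Type} [Finite Q]

/-- The payloads after `t` rounds of communication in the conflict graph, where the `i`th round
updates them by `h i`. -/
noncomputable def iteratePay (G : SimpleGraph V) (k : ℕ) (lab : V → W) (d : ℕ)
    (prof : W → Profile W) (h : ℕ → W → Profile W → Q → Set (W × Q) → Q) (pay : W → Q) :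
    ℕ → W → Q
  | 0 => pay
  | t + 1 => fun A => h t A (prof A) (iteratePay G k lab d prof h pay t A)
      (conflicts G k lab d prof (iteratePay G k lab d prof h pay t) A)

theorem chain_confRound_config (inv : ClusterInv G k R ρ L ldr lab rel)
    (h : ℕ → W → Profile W → Q → Set (W × Q) → Q) (inn : W → Set (W × Q)) (pay : W → Q) (t : ℕ) :
    ∃ inn' : W → Set (W × Q),
      NetMap.chain (fun i => confRound k R L d (h i)) t V G
        (config me lab rel fun A => ⟨prof A, inn A, pay A⟩) =
          config me lab rel fun A => ⟨prof A, inn' A, iteratePay G k lab d prof h pay t A⟩ := by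
  induction t with
  | zero => exact ⟨inn, rfl⟩
  | succ t ih =>
    obtain ⟨inn', hchain⟩ := ih
    exact ⟨_, by rw [NetMap.chain, NetMap.andThen, hchain, confRound_config inv, iteratePay]⟩

end iteratePay

theorem isProperColoring_initialPayload (hW : Nat.card W ≤ 2 ^ B) (hm : B ≤ m) :
    IsProperColoring G k lab prof B (initialPayload (W := W) m) where
  lt A := by
    rw [coe_initialPayload hW hm]
    exact (Fin.is_lt _).trans_le hW
  ne A A' _ _ hne h := by
    have hval := congrArg Fin.val h
    rw [coe_initialPayload hW hm, coe_initialPayload hW hm] at hval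
    exact hne ((Finite.equivFin W).injective (Fin.ext hval))

theorem IsProperColoring.recolor {pay : W → Payload m} (h : IsProperColoring G k lab prof b pay)
    (hprof : IsProfile G k lab d prof) (hde : d ^ 3 = 2 ^ e) (hb : 1 ≤ b)
    (hm : nextBits e b ≤ m) :
    IsProperColoring G k lab prof (nextBits e b) fun A =>
      recolorUpd e b m A (prof A) (pay A) (conflicts G k lab d prof pay A) where
  lt A := by
    rw [coe_recolorUpd hb hm]
    exact recolor_lt e hb _ _
  ne A A' hfree hconflict hne heq := by
    have hval := congrArg Fin.val heq
    rw [coe_recolorUpd hb hm, coe_recolorUpd hb hm] at hval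
    obtain ⟨-, u, hu, -⟩ := id hconflict
    have hmem := fun p => mem_conflicts_iff_conflict (pay := pay) hprof hu.2.1 hfree (p := p)
    have hother : ((pay A').1 : ℕ) ∈ otherColors A (conflicts G k lab d prof pay A) :=
      ⟨(A', pay A'), (hmem _).2 ⟨A', rfl, hconflict⟩, hne.symm, rfl⟩
    refine recolor_ne hb _ (h.lt A) ?_ (hde ▸ ncard_otherColors_le (ncard_conflicts_le A))
      hother (fun hval => h.ne A A' hfree hconflict hne (Fin.ext hval)) hval
    rintro c ⟨p, hp, -, rfl⟩
    obtain ⟨A'', rfl, -⟩ := (hmem p).1 hp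
    exact h.lt A''

theorem isProperColoring_iteratePay (hprof : IsProfile G k lab d prof) (hde : d ^ 3 = 2 ^ e)
    (hB : 1 ≤ B) (hW : Nat.card W ≤ 2 ^ B) (hm : ∀ t, bitSeq e B t ≤ m) (t : ℕ) :
    IsProperColoring G k lab prof (bitSeq e B t) (iteratePay G k lab d prof
      (fun t => recolorUpd e (bitSeq e B t) m) (initialPayload m) t) := by
  induction t with
  | zero => exact isProperColoring_initialPayload hW (hm 0)
  | succ t ih => exact ih.recolor hprof hde (one_le_bitSeq hB t) (hm (t + 1))

theorem not_joined_iteratePay (f : ℕ → ℕ) (t : ℕ) (A : W) :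
    ¬ (iteratePay G k lab d prof (fun t => recolorUpd e (f t) m) (initialPayload m) t A).2 := by
  induction t with
  | zero => exact id
  | succ _ ih => exact ih

theorem exists_joined_mem_conflicts_iff (hprof : IsProfile G k lab d prof) {pay : W → Payload m}
    {A : W} (hA : (prof A).status = .source) (hfree : (prof A).free) :
    (∃ p ∈ conflicts G k lab d prof pay A, p.2.2) ↔
      ∃ A', (pay A').2 ∧ Conflict G k lab prof A A' := by
  simp only [mem_conflicts_iff_conflict hprof hA hfree]
  constructor
  · rintro ⟨_, ⟨A', rfl, hconflict⟩, hjoined⟩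
    exact ⟨A', hjoined, hconflict⟩
  · rintro ⟨A', hjoined, hconflict⟩
    exact ⟨_, ⟨A', rfl, hconflict⟩, hjoined⟩

theorem IsGreedySet.join {i : ℕ} {pay : W → Payload m} (h : IsGreedySet G k lab prof i pay)
    (hprof : IsProfile G k lab d prof) (hcol : IsProperColoring G k lab prof b pay) :
    IsGreedySet G k lab prof (i + 1) fun A =>
      joinUpd i A (prof A) (pay A) (conflicts G k lab d prof pay A) where
  mem A hA := by
    rcases hA with hA | ⟨hsource, hhigh, hfree, hi, -⟩
    · obtain ⟨hsource, hhigh, hfree, hi⟩ := h.mem A hA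
      exact ⟨hsource, hhigh, hfree, hi.trans i.lt_succ_self⟩
    · exact ⟨hsource, hhigh, hfree, Nat.lt_succ_of_le hi.le⟩
  indep A A' hA hA' hconflict := by
    rcases hA with hA | ⟨hsource, -, hfree, hi, hnone⟩ <;>
      rcases hA' with hA' | ⟨hsource', -, hfree', hi', hnone'⟩
    · exact h.indep A A' hA hA' hconflict
    · have hsymm := hconflict.symm (h.mem A hA).2.2.1
      exact absurd ((exists_joined_mem_conflicts_iff hprof hsource' hfree').2 ⟨A, hA, hsymm⟩) hnone'
    · exact absurd ((exists_joined_mem_conflicts_iff hprof hsource hfree).2 ⟨A', hA', hconflict⟩)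
        hnone
    · by_contra hne
      exact hcol.ne A A' hfree hconflict hne (Fin.ext (hi.trans hi'.symm))
  maximal A hsource hhigh hfree hi := by
    change ((pay A).1 : ℕ) < i + 1 at hi
    by_cases hnone : ∃ A', (pay A').2 ∧ Conflict G k lab prof A A'
    · obtain ⟨A', hA', hconflict⟩ := hnone
      exact Or.inr ⟨A', Or.inl hA', hconflict⟩
    · left
      rcases Nat.lt_succ_iff_lt_or_eq.1 hi with hi | hi
      · exact Or.inl ((h.maximal A hsource hhigh hfree hi).resolve_right hnone)
      · exact Or.inr ⟨hsource, hhigh, hfree, hi, fun hex =>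
          hnone ((exists_joined_mem_conflicts_iff hprof hsource hfree).1 hex)⟩

theorem fst_iteratePay_joinUpd (pay : W → Payload m) (i : ℕ) (A : W) :
    (iteratePay G k lab d prof (fun i => joinUpd i) pay i A).1 = (pay A).1 := by
  induction i with
  | zero => rfl
  | succ _ ih => exact ih

theorem IsProperColoring.join {pay : W → Payload m} (h : IsProperColoring G k lab prof b pay)
    (i : ℕ) :
    IsProperColoring G k lab prof b
      (iteratePay G k lab d prof (fun i => joinUpd i) pay i) where
  lt A := fst_iteratePay_joinUpd pay i A ▸ h.lt A
  ne A A' := fst_iteratePay_joinUpd pay i A ▸ fst_iteratePay_joinUpd pay i A' ▸ h.ne A A'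

theorem isGreedySet_iteratePay (hprof : IsProfile G k lab d prof) {pay : W → Payload m}
    (hpay : ∀ A, ¬ (pay A).2) (hcol : IsProperColoring G k lab prof b pay) (i : ℕ) :
    IsGreedySet G k lab prof i (iteratePay G k lab d prof (fun i => joinUpd i) pay i) := by
  induction i with
  | zero => exact ⟨fun A hA => absurd hA (hpay A), fun A _ hA => absurd hA (hpay A),
      fun A _ _ _ hi => absurd hi (Nat.not_lt_zero _)⟩
  | succ i ih => exact ih.join hprof (hcol.join i)

end coloring

/-! ### One level of the construction -/

section absorption

variable {V W : Type} {G : SimpleGraph V} {k : ℕ} {lab : V → W} {K : W → Status}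
  {nl nl₁ nl₂ : W → W} {A u : W}

namespace IsAbsorption

theorem eq_of_not_pending (h : IsAbsorption G k lab K nl) (hA : ∀ c, K A ≠ .pending c) :
    nl A = A := by
  by_contra hne
  obtain ⟨⟨c, hc⟩, -⟩ := h.pending_source A hne
  exact hA c hc

theorem eq_of_ne_source (h : IsAbsorption G k lab K nl) (hA : K (nl A) ≠ .source) : nl A = A := by
  by_contra hne
  exact hA (h.pending_source A hne).2

theorem source_of_source (h : IsAbsorption G k lab K nl) (hA : K A = .source) :
    K (nl A) = .source := by
  rw [h.eq_of_not_pending fun c hc => by simp [hA] at hc, hA]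

theorem eq_of_comp_ne_source (h₁ : IsAbsorption G k lab K nl₁)
    (h₂ : IsAbsorption G k (fun v => nl₁ (lab v)) K nl₂) (hA : K (nl₂ (nl₁ A)) ≠ .source) :
    nl₁ A = A ∧ nl₂ A = A := by
  have hA₂ : nl₂ (nl₁ A) = nl₁ A := h₂.eq_of_ne_source hA
  have hA₁ : nl₁ A = A := h₁.eq_of_ne_source (hA₂ ▸ hA)
  exact ⟨hA₁, by rwa [hA₁] at hA₂⟩

theorem ne_source_of_near (h₁ : IsAbsorption G k lab K nl₁)
    (h₂ : IsAbsorption G k (fun v => nl₁ (lab v)) K nl₂) {c : ℕ} (hpend : K A = .pending c)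
    (hA : K (nl₂ (nl₁ A)) ≠ .source) (hnear : Near G k lab A u) : K (nl₁ u) ≠ .source := by
  obtain ⟨hA₁, -⟩ := h₁.eq_of_comp_ne_source h₂ hA
  obtain ⟨v, w, rfl, rfl, hvw⟩ := hnear
  exact fun hu => hA (hA₁.symm ▸ h₂.source_of_near _ _ c hpend ⟨v, w, hA₁, rfl, hvw⟩ hu)

end IsAbsorption

end absorption

section activeLabels

variable {V W : Type} {G : SimpleGraph V} {k d m i : ℕ} {lab : V → W} {prof : W → Profile W}

/-- The labels of the active clusters, those of status `source`. -/
def activeLabels (lab : V → W) (K : W → Status) : Set W := {A | (∃ v, lab v = A) ∧ K A = .source}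

theorem Out.mem_activeLabels [LE W] {A u : W} (h : Out G k lab prof A u) :
    A ∈ activeLabels lab (fun A => (prof A).status) ∧
      u ∈ activeLabels lab (fun A => (prof A).status) := by
  obtain ⟨⟨v, w, hv, hw, -⟩, hA, hu, -⟩ := h
  exact ⟨⟨⟨v, hv⟩, hA⟩, ⟨w, hw⟩, hu⟩

variable [LinearOrder W] [Finite W]

-- Double counting of the out-edges that enter heavy clusters.
theorem ncard_heavy_mul_le (hprof : IsProfile G k lab d prof) (hd : 1 ≤ d) :
    {A | (prof A).heavy}.ncard * d ≤ (activeLabels lab fun A => (prof A).status).ncard := by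
  have hin := le_ncard_fibered (Λ := {A | (prof A).heavy})
    (F := fun u => {A | Out G k lab prof A u}) fun u hu => (hprof.heavy_in u hu).2
  have hout := ncard_fibered_le (Λ := activeLabels lab fun A => (prof A).status)
    (F := fun A => {u | Out G k lab prof A u}) fun A _ => hprof.ncard_out_le A
  have hswap := Set.ncard_le_ncard_of_injOn Prod.swap
    (s := {p : W × W | p.1 ∈ {A | (prof A).heavy} ∧ p.2 ∈ {A | Out G k lab prof A p.1}})
    (t := {p : W × W | p.1 ∈ activeLabels lab (fun A => (prof A).status) ∧
      p.2 ∈ {u | Out G k lab prof p.1 u}})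
    (fun p hp => ⟨(Out.mem_activeLabels hp.2).1, hp.2⟩) Prod.swap_injective.injOn
  refine Nat.le_of_mul_le_mul_right ?_ hd
  calc {A | (prof A).heavy}.ncard * d * d = {A | (prof A).heavy}.ncard * d ^ 2 := by ring
    _ ≤ (activeLabels lab fun A => (prof A).status).ncard * d := hin.trans (hswap.trans hout)

theorem IsGreedySet.ncard_joined_mul_le {pay : W → Payload m} (h : IsGreedySet G k lab prof i pay)
    (hprof : IsProfile G k lab d prof) :
    {A | (pay A).2}.ncard * d ≤ (activeLabels lab fun A => (prof A).status).ncard := by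
  refine (le_ncard_fibered (Λ := {A | (pay A).2}) (F := fun A => {u | Out G k lab prof A u})
    fun A hA => hprof.le_ncard_out A (h.mem A hA).1 (h.mem A hA).2.1).trans ?_
  refine Set.ncard_le_ncard_of_injOn Prod.snd
    (fun p hp => (Out.mem_activeLabels hp.2).2) ?_ (Set.toFinite _)
  rintro ⟨A, u⟩ ⟨hA, hu⟩ ⟨A', _⟩ ⟨hA', hu'⟩ rfl
  rw [h.indep A A' hA hA' ⟨(h.mem A' hA').2.2.1, u, hu, hu'⟩]

end activeLabels

section select

variable {W : Type} {m i q : ℕ} {P : Profile W} {p : Payload m} {A : W}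

open Classical in
/-- The status of a cluster after the selection of the new centers: a heavy cluster or one in the
independent set remains active, any other active cluster waits with its color, shifted to the `i`th
range of `q` colors. -/
noncomputable def select (i q : ℕ) (P : Profile W) (p : Payload m) : Status :=
  if P.status = .source then
    if P.heavy ∨ p.2 then .source else .pending (i * q + p.1)
  else P.status

theorem select_eq_source (hP : P.status = .source) (h : P.heavy ∨ p.2) :
    select i q P p = .source := by
  rw [select, if_pos hP, if_pos h]

theorem select_eq_pending (hP : P.status = .source) (h : ¬ (P.heavy ∨ p.2)) :
    select i q P p = .pending (i * q + p.1) := by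
  rw [select, if_pos hP, if_neg h]

theorem select_eq_done {c : ℕ} (hP : P.status = .done c) : select i q P p = .done c := by
  rw [select, if_neg (by simp [hP]), hP]

/-- The status of a cluster at the end of a level, where a cluster that is still waiting obtains its
color. -/
def finish : Status → Status
  | .source => .source
  | .pending c => .done c
  | .done c => .done c

theorem finish_eq_source_iff {S : Status} : finish S = .source ↔ S = .source := by
  cases S <;> simp [finish]

theorem ne_source_of_finish_eq_done {S : Status} {c : ℕ} (h : finish S = .done c) :
    S ≠ .source := by
  rintro rfl
  cases h

theorem finish_eq_source_or_done (S : Status) : finish S = .source ∨ ∃ c, finish S = .done c := by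
  cases S <;> simp [finish]

end select

/-- A level maps the labels `lab`, with statuses `K`, to `nl (lab v)`, with statuses `K'`: it merges
active clusters, gives colors from the `i`th range of `q` colors to some of them, and divides the
number of the remaining ones by `2 ^ s`. -/
structure IsLevelStep {V W : Type} (G : SimpleGraph V) (k q s i : ℕ) (lab : V → W) (K : W → Status)
    (nl : W → W) (K' : W → Status) : Prop where
  source_or_done : ∀ A, K' A = .source ∨ ∃ c, K' A = .done c
  done_stays : ∀ A c, K A = .done c → nl A = A ∧ K' A = .done c
  color_range : ∀ A c, K A = .source → K' (nl A) = .done c → i * q ≤ c ∧ c < (i + 1) * q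
  lab_eq : ∀ v w c, K (lab v) = .source → K (lab w) = .source → K' (nl (lab v)) = .done c →
    K' (nl (lab w)) = .done c → G.edist v w ≤ k → lab v = lab w
  ncard_active : (activeLabels (fun v => nl (lab v)) K').ncard * 2 ^ s ≤ (activeLabels lab K).ncard
  exists_lab : ∀ v, ∃ w, nl (lab v) = lab w

section isLevelStep

variable {V W : Type} {G : SimpleGraph V} {k d b m i q : ℕ} {lab : V → W}
  {prof : W → Profile W} {pay : W → Payload m} {nl₁ nl₂ : W → W} {A : W} {c : ℕ}
  (h₁ : IsAbsorption G k lab (fun A => select i q (prof A) (pay A)) nl₁)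
  (h₂ : IsAbsorption G k (fun v => nl₁ (lab v)) (fun A => select i q (prof A) (pay A)) nl₂)

include h₁ h₂

theorem select_eq_pending_of_finish_eq_done (hA : (prof A).status = .source)
    (hc : finish (select i q (prof (nl₂ (nl₁ A))) (pay (nl₂ (nl₁ A)))) = .done c) :
    c = i * q + (pay A).1 ∧ select i q (prof A) (pay A) = .pending (i * q + (pay A).1) := by
  have hne := ne_source_of_finish_eq_done hc
  obtain ⟨hA₁, hA₂⟩ := h₁.eq_of_comp_ne_source h₂ hne
  rw [hA₁, hA₂] at hne hc
  have hpend := select_eq_pending (i := i) (q := q) hA fun h => hne (select_eq_source hA h)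
  rw [hpend] at hc
  exact ⟨(Status.done.inj hc).symm, hpend⟩

variable [LinearOrder W]

theorem free_of_finish_eq_done (hprof : IsProfile G k lab d prof)
    (hA : (prof A).status = .source)
    (hc : finish (select i q (prof (nl₂ (nl₁ A))) (pay (nl₂ (nl₁ A)))) = .done c) :
    (prof A).free := by
  obtain ⟨-, hpend⟩ := select_eq_pending_of_finish_eq_done h₁ h₂ hA hc
  rw [hprof.free_iff]
  rintro ⟨u, hnear, hu⟩
  have hsource := h₁.source_of_source (A := u)
    (select_eq_source (hprof.heavy_in u hu).1 (Or.inl hu))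
  exact h₁.ne_source_of_near h₂ hpend (ne_source_of_finish_eq_done hc) hnear hsource

/-- If the free cluster `A` had high degree, it would be in the independent set or have a common
out-neighbor `u` with a member `A'` of it. Unless `u` is itself a center, it would then be absorbed
in the first step, and `A` in the second one. -/
theorem not_high_of_finish_eq_done (hprof : IsProfile G k lab d prof)
    (hgreedy : IsGreedySet G k lab prof q pay) (hlt : ((pay A).1 : ℕ) < q)
    (hA : (prof A).status = .source)
    (hc : finish (select i q (prof (nl₂ (nl₁ A))) (pay (nl₂ (nl₁ A)))) = .done c) :
    ¬ (prof A).high := by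
  intro hhigh
  have hne := ne_source_of_finish_eq_done hc
  obtain ⟨-, hpend⟩ := select_eq_pending_of_finish_eq_done h₁ h₂ hA hc
  have hfree := free_of_finish_eq_done h₁ h₂ hprof hA hc
  rcases hgreedy.maximal A hA hhigh hfree hlt with hjoin | ⟨A', hA', -, u, hu, hu'⟩
  · rw [select_eq_source hA (Or.inr hjoin)] at hpend
    cases hpend
  · refine h₁.ne_source_of_near h₂ hpend hne hu.1 ?_
    by_cases hcenter : (prof u).heavy ∨ (pay u).2
    · exact h₁.source_of_source (A := u) (select_eq_source hu.2.2.1 hcenter)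
    · exact h₁.source_of_near u A' _ (select_eq_pending hu.2.2.1 hcenter) hu'.1.symm
        (select_eq_source hu'.2.1 (Or.inr hA'))

theorem lab_eq_of_finish_eq_done (hprof : IsProfile G k lab d prof)
    (hgreedy : IsGreedySet G k lab prof q pay) (hcol : IsProperColoring G k lab prof b pay)
    (hq : 2 ^ b ≤ q) {v w : V} (hv : (prof (lab v)).status = .source)
    (hw : (prof (lab w)).status = .source)
    (hvc : finish (select i q (prof (nl₂ (nl₁ (lab v)))) (pay (nl₂ (nl₁ (lab v))))) = .done c)
    (hwc : finish (select i q (prof (nl₂ (nl₁ (lab w)))) (pay (nl₂ (nl₁ (lab w))))) = .done c)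
    (hvw : G.edist v w ≤ k) : lab v = lab w := by
  have hcv := (select_eq_pending_of_finish_eq_done h₁ h₂ hv hvc).1
  have hcw := (select_eq_pending_of_finish_eq_done h₁ h₂ hw hwc).1
  have hlow := fun v => not_high_of_finish_eq_done (A := lab v) (c := c) h₁ h₂ hprof hgreedy
    ((hcol.lt (lab v)).trans_le hq)
  have hconflict : Conflict G k lab prof (lab v) (lab w) :=
    ⟨free_of_finish_eq_done h₁ h₂ hprof hw hwc, lab w,
      hprof.out_of_not_high _ _ (hlow v hv hvc) ⟨v, w, rfl, rfl, hvw⟩ hv hw,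
      hprof.out_of_not_high _ _ (hlow w hw hwc) (Near.refl w) hw hw⟩
  by_contra hne
  exact hcol.ne _ _ (free_of_finish_eq_done h₁ h₂ hprof hv hvc) hconflict hne
    (Fin.ext (by lia))

omit h₁ h₂ in
theorem ncard_activeLabels_finish_mul_le [Finite W] {s : ℕ} (hd : d = 2 ^ (s + 1))
    (hprof : IsProfile G k lab d prof) (hgreedy : IsGreedySet G k lab prof q pay)
    (hK : ∀ A, (prof A).status = .source ∨ ∃ c, (prof A).status = .done c) (lab' : V → W) :
    (activeLabels lab' fun A => finish (select i q (prof A) (pay A))).ncard * 2 ^ s ≤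
      (activeLabels lab fun A => (prof A).status).ncard := by
  have hsub : (activeLabels lab' fun A => finish (select i q (prof A) (pay A))) ⊆
      {A | (prof A).heavy} ∪ {A | (pay A).2} := by
    rintro A ⟨-, hA⟩
    rw [finish_eq_source_iff] at hA
    rcases hK A with hsource | ⟨c, hdone⟩
    · by_contra hcenter
      simp [select_eq_pending hsource hcenter] at hA
    · simp [select_eq_done hdone] at hA
  have hunion := (Set.ncard_le_ncard hsub (Set.toFinite _)).trans (Set.ncard_union_le _ _)
  have hheavy := ncard_heavy_mul_le hprof (hd ▸ Nat.one_le_two_pow)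
  have hjoined := hgreedy.ncard_joined_mul_le hprof
  have hcenters := Nat.mul_le_mul_right (2 ^ s) hunion
  rw [hd, pow_succ, ← mul_assoc] at hheavy hjoined
  rw [add_mul] at hcenters
  lia

theorem isLevelStep_finish [Finite W] {s : ℕ} (hd : d = 2 ^ (s + 1))
    (hprof : IsProfile G k lab d prof) (hgreedy : IsGreedySet G k lab prof q pay)
    (hcol : IsProperColoring G k lab prof b pay) (hq : 2 ^ b ≤ q)
    (hK : ∀ A, (prof A).status = .source ∨ ∃ c, (prof A).status = .done c) :
    IsLevelStep G k q s i lab (fun A => (prof A).status) (fun A => nl₂ (nl₁ A))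
      fun A => finish (select i q (prof A) (pay A)) where
  source_or_done A := finish_eq_source_or_done _
  done_stays A c hA := by
    have hdone : select i q (prof A) (pay A) = .done c := select_eq_done hA
    have hA₁ : nl₁ A = A := h₁.eq_of_not_pending fun c hc => by simp [hdone] at hc
    have hA₂ : nl₂ A = A := h₂.eq_of_not_pending fun c hc => by simp [hdone] at hc
    exact ⟨by rw [hA₁, hA₂], by rw [hdone, finish]⟩
  color_range A c hA hc := by
    have hlt := (hcol.lt A).trans_le hq
    obtain ⟨rfl, -⟩ := select_eq_pending_of_finish_eq_done h₁ h₂ hA hc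
    rw [Nat.succ_mul]
    lia
  lab_eq _ _ _ hv hw hvc hwc hvw :=
    lab_eq_of_finish_eq_done h₁ h₂ hprof hgreedy hcol hq hv hw hvc hwc hvw
  ncard_active := ncard_activeLabels_finish_mul_le hd hprof hgreedy hK _
  exists_lab v := by
    obtain ⟨w, hw⟩ := h₂.exists_lab v
    obtain ⟨w', hw'⟩ := h₁.exists_lab w
    exact ⟨w', hw.trans hw'⟩

end isLevelStep

section level

variable {V W : Type} [LinearOrder W] [Finite W] [OrderTop W] {G : SimpleGraph V}
  {k R ρ L d e m B : ℕ} {ldr : W → V} {me lab : V → W} {rel : V → Set W}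

/-- One level of the construction of the network decomposition: the clusters compute their profiles,
a proper coloring of the conflict graph with `q` colors, in `T` steps of color reduction, and from
it a maximal independent set, whose clusters become centers along with the heavy ones. Two
absorption steps around the centers follow, and the clusters that are left obtain their colors. -/
noncomputable def level (k R L d e m B T q : ℕ) (i : ℕ) : NetMap (Node W Status) (Node W Status) :=
  (prepare k R L d (initialPayload m)).andThen
    ((NetMap.chain (fun t => confRound k R L d (recolorUpd e (bitSeq e B t) m)) T).andThen
      ((NetMap.chain (fun i => confRound k R L d (joinUpd i)) q).andThen
        ((NetMap.ofLocal fun a => a.setDat (select i q a.dat.prof a.dat.pay)).andThen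
          ((grow k R L).andThen ((grow k R L).andThen
            (NetMap.ofLocal fun a => a.setDat (finish a.dat)))))))

theorem level_config {R' L' s T q : ℕ} (inv : ClusterInv G k R ρ L ldr lab rel)
    (hR : 3 * R + k ≤ R') (hL : L + 1 ≤ L') (hd : d = 2 ^ (s + 1)) (hde : d ^ 3 = 2 ^ e)
    (hB : 1 ≤ B) (hW : Nat.card W ≤ 2 ^ B) (hm : ∀ t, bitSeq e B t ≤ m)
    (hq : 2 ^ bitSeq e B T ≤ q) (K : W → Status) (i : ℕ)
    (hK : ∀ A, K A = .source ∨ ∃ c, K A = .done c) :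
    ∃ (nl : W → W) (rel' : V → Set W) (K' : W → Status),
      level k R' L' d e m B T q i V G (config me lab rel K) =
        config me (fun v => nl (lab v)) rel' K' ∧
      ClusterInv G k (9 * R + 4 * k) (9 * ρ + 4) (L + 2) ldr (fun v => nl (lab v)) rel' ∧
      IsLevelStep G k q s i lab K nl K' := by
  have inv' : ClusterInv G k R' ρ L' ldr lab rel := inv.mono (by lia) le_rfl (by lia)
  set prof := profile G k lab d K (initialPayload m)
  have hprof : IsProfile G k lab d prof := isProfile_profile (hd ▸ Nat.one_le_two_pow)
  obtain ⟨inn₁, hcoloring⟩ := chain_confRound_config (me := me) (prof := prof) inv'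
    (fun t => recolorUpd e (bitSeq e B t) m) (sourceIn G k lab d K (initialPayload m))
    (initialPayload m) T
  set colors := iteratePay G k lab d prof (fun t => recolorUpd e (bitSeq e B t) m)
    (initialPayload m) T
  have hcolors : IsProperColoring G k lab prof (bitSeq e B T) colors :=
    isProperColoring_iteratePay hprof hde hB hW hm T
  obtain ⟨inn₂, hjoining⟩ := chain_confRound_config (me := me) (prof := prof) (d := d) inv'
    (fun i => joinUpd i) inn₁ colors q
  set pay := iteratePay G k lab d prof (fun i => joinUpd i) colors q
  have hgreedy : IsGreedySet G k lab prof q pay :=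
    isGreedySet_iteratePay hprof (not_joined_iteratePay _ T) hcolors q
  obtain ⟨nl₁, rel₁, hgrow₁, inv₁, h₁⟩ := grow_config (me := me) inv (R' := R') (L' := L')
    (by lia) (by lia) fun A => select i q (prof A) (pay A)
  obtain ⟨nl₂, rel₂, hgrow₂, inv₂, h₂⟩ := grow_config (me := me) inv₁ (R' := R') (L' := L')
    hR hL fun A => select i q (prof A) (pay A)
  refine ⟨fun A => nl₂ (nl₁ A), rel₂, fun A => finish (select i q (prof A) (pay A)), ?_,
    inv₂.mono (by lia) (by lia) le_rfl,
    isLevelStep_finish h₁ h₂ hd hprof hgreedy (hcolors.join q) hq hK⟩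
  have hselect : NetMap.ofLocal (fun a : Node W (Work W (Payload m)) =>
      a.setDat (select i q a.dat.prof a.dat.pay)) V G
      (config me lab rel fun A => ⟨prof A, inn₂ A, pay A⟩) =
        config me lab rel fun A => select i q (prof A) (pay A) := rfl
  simp only [level, NetMap.andThen]
  rw [prepare_config inv', hcoloring, hjoining, hselect, hgrow₁, hgrow₂]
  rfl

end level

/-! ### The number of rounds -/

section rounds

variable {W : Type} {B k R L d β : ℕ}

theorem card_payload_le (hB : 1 ≤ B) (β : ℕ) :
    Nat.card (Payload (β * B)) ≤ 2 ^ ((β + 1) * B) := by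
  rw [Nat.card_prod, Nat.card_eq_fintype_card, Nat.card_eq_fintype_card, Fintype.card_fin,
    Fintype.card_prop, add_mul, pow_add, one_mul]
  exact Nat.mul_le_mul_left _ (Nat.le_self_pow (Nat.one_le_iff_ne_zero.1 hB) 2)

theorem card_triple_le (hB : 1 ≤ B) (hW : Nat.card W ≤ 2 ^ B) (β : ℕ) :
    Nat.card (W × W × Payload (β * B)) ≤ 2 ^ ((β + 3) * B) := by
  rw [← one_mul B] at hW
  have htriple := card_prod_le_two_pow hW (card_prod_le_two_pow hW (card_payload_le hB β))
  rwa [show 1 + (1 + (β + 1)) = β + 3 by ring] at htriple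

/-- A bound for the number of rounds of an exchange between the clusters, if these have relay radius
at most `R`, every node relays for at most `L` of them, and each obtains at most `d ^ 3` items,
which take `β + 3` messages each. -/
def roundCost (R L d β : ℕ) : ℕ := 3 * (R * (L * (d ^ 3 * (β + 5))))

theorem clusterRound_rounds_le {D b : ℕ} (hk : k ≤ R) (hL : 1 ≤ L) (hD : D ≤ d ^ 3)
    (hb : b ≤ β + 3) :
    k * (D * (b + 2)) + 2 * R * (L * D * (b + 2)) ≤ roundCost R L d β := by
  have hitems : D * (b + 2) ≤ d ^ 3 * (β + 5) := Nat.mul_le_mul hD (by lia)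
  calc k * (D * (b + 2)) + 2 * R * (L * D * (b + 2))
      = k * (1 * (D * (b + 2))) + 2 * (R * (L * (D * (b + 2)))) := by ring
    _ ≤ R * (L * (d ^ 3 * (β + 5))) + 2 * (R * (L * (d ^ 3 * (β + 5)))) := by gcongr
    _ = roundCost R L d β := by rw [roundCost]; ring

variable [Finite W] [LinearOrder W]

theorem Realizable.inStep (hB : 1 ≤ B) (hW : Nat.card W ≤ 2 ^ B) (hk : k ≤ R) (hL : 1 ≤ L)
    (hd : 1 ≤ d) :
    Realizable B (roundCost R L d β) (inStep (W := W) (Q := Payload (β * B)) k R L d) :=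
  (Realizable.clusterRound hB hW (card_triple_le hB hW β) k R L (d ^ 2) _ _ _).mono
    (clusterRound_rounds_le hk hL (Nat.pow_le_pow_right hd (by norm_num)) le_rfl)

theorem Realizable.confRound (hB : 1 ≤ B) (hW : Nat.card W ≤ 2 ^ B) (hk : k ≤ R)
    (hL : 1 ≤ L) (hd : 1 ≤ d) (h : W → Profile W → Payload (β * B) →
      Set (W × Payload (β * B)) → Payload (β * B)) :
    Realizable B (2 * roundCost R L d β) (confRound k R L d h) := by
  rw [two_mul]
  exact (Realizable.inStep hB hW hk hL hd).andThen
    ((Realizable.clusterRound hB hW (card_triple_le hB hW β) k R L (d ^ 3) _ _ _).mono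
      (clusterRound_rounds_le hk hL le_rfl le_rfl))

theorem Realizable.grow_roundCost (hB : 1 ≤ B) (hW : Nat.card W ≤ 2 ^ B) (hk : k ≤ R)
    (hL : 1 ≤ L) (hd : 1 ≤ d) :
    Realizable B (roundCost R L d β) (NetworkDecomposition.grow (W := W) k R L) := by
  refine (Realizable.grow hB hW k R L).mono ?_
  have hk' : k ≤ R * L := hk.trans (Nat.le_mul_of_pos_right _ hL)
  have hitems : 1 * 5 ≤ d ^ 3 * (β + 5) :=
    Nat.mul_le_mul (Nat.one_le_pow _ _ hd) (Nat.le_add_left _ _)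
  calc k * 2 + 2 * R * (L * 3) ≤ R * L * 2 + R * L * 6 := by lia
    _ ≤ 3 * (R * L * (1 * 5)) := by lia
    _ ≤ 3 * (R * L * (d ^ 3 * (β + 5))) := by gcongr
    _ = roundCost R L d β := by rw [roundCost]; ring

variable [OrderTop W]

theorem Realizable.prepare (hB : 1 ≤ B) (hW : Nat.card W ≤ 2 ^ B) (hk : k ≤ R) (hL : 1 ≤ L)
    (hd : 1 ≤ d) (pay : W → Payload (β * B)) :
    Realizable B (3 * roundCost R L d β) (prepare k R L d pay) := by
  have hdegree : Realizable B (roundCost R L d β) (degreeStep k R L d pay) :=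
    (Realizable.clusterRound (b := 1) hB hW (by rwa [one_mul]) k R L d _ _ _).mono
      (clusterRound_rounds_le hk hL (Nat.le_self_pow three_ne_zero d) (by lia))
  have hfree : Realizable B (roundCost R L d β)
      (freeStep (W := W) (Q := Payload (β * B)) k R L) :=
    (Realizable.clusterRound (b := 0) hB hW (by simp) k R L 1 _ _ _).mono
      (clusterRound_rounds_le hk hL (Nat.one_le_pow _ _ hd) (by lia))
  exact (hdegree.andThen ((Realizable.inStep hB hW hk hL hd).andThen
    ((Realizable.ofLocal _ 0).andThen hfree))).mono (by lia)

theorem Realizable.level (hB : 1 ≤ B) (hW : Nat.card W ≤ 2 ^ B) (hk : k ≤ R) (hL : 1 ≤ L)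
    (hd : 1 ≤ d) (e T q i : ℕ) :
    Realizable B ((5 + 2 * T + 2 * q) * roundCost R L d β)
      (level (W := W) k R L d e (β * B) B T q i) := by
  have hgrow := Realizable.grow_roundCost (β := β) hB hW hk hL hd
  have hcoloring := Realizable.chain (fun t => Realizable.confRound hB hW hk hL hd
    (recolorUpd e (bitSeq e B t) (β * B))) T
  have hjoining := Realizable.chain (fun i => Realizable.confRound hB hW hk hL hd
    (joinUpd (m := β * B) i)) q
  refine ((Realizable.prepare hB hW hk hL hd (initialPayload (β * B))).andThen
    (hcoloring.andThen (hjoining.andThen ((Realizable.ofLocal _ 0).andThen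
      (hgrow.andThen (hgrow.andThen (Realizable.ofLocal _ 0))))))).mono (le_of_eq ?_)
  ring

end rounds

/-! ### All levels -/

section levels

variable {V W : Type} {G : SimpleGraph V} {k R ρ c d e j m B T q s : ℕ} {ldr : W → V}
  {me lab : V → W} {rel : V → Set W} {K K' : W → Status} {nl : W → W}

/-- The clusters are active or colored with colors less than `c`, and distinct clusters of the same
color are not near to each other. -/
structure IsPartialDecomposition (G : SimpleGraph V) (k c : ℕ) (lab : V → W) (K : W → Status) :
    Prop where
  source_or_done : ∀ A, K A = .source ∨ ∃ i, K A = .done i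
  color_lt : ∀ v i, K (lab v) = .done i → i < c
  lab_eq : ∀ v w i, K (lab v) = .done i → K (lab w) = .done i → G.edist v w ≤ k → lab v = lab w

theorem IsLevelStep.source_or_stays {A : W} {i : ℕ} (h : IsLevelStep G k q s j lab K nl K')
    (hK : ∀ A, K A = .source ∨ ∃ i, K A = .done i) (hi : K' (nl A) = .done i) :
    K A = .source ∨ K A = .done i := by
  refine (hK A).imp_right fun ⟨i', hi'⟩ => ?_
  obtain ⟨hnl, hK'⟩ := h.done_stays A i' hi'
  rw [hnl, hK'] at hi
  exact hi ▸ hi'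

theorem IsPartialDecomposition.level (h : IsPartialDecomposition G k (j * q) lab K)
    (hstep : IsLevelStep G k q s j lab K nl K') :
    IsPartialDecomposition G k ((j + 1) * q) (fun v => nl (lab v)) K' where
  source_or_done := hstep.source_or_done
  color_lt v i hi := by
    rcases hstep.source_or_stays h.source_or_done hi with hsource | hdone
    · exact (hstep.color_range _ i hsource hi).2
    · exact (h.color_lt v i hdone).trans_le (Nat.mul_le_mul_right _ j.le_succ)
  lab_eq v w i hv hw hvw := by
    rcases hstep.source_or_stays h.source_or_done hv with hv' | hv' <;>
      rcases hstep.source_or_stays h.source_or_done hw with hw' | hw'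
    · exact congrArg nl (hstep.lab_eq v w i hv' hw' hv hw hvw)
    · exact absurd (h.color_lt w i hw') (hstep.color_range _ i hv' hv).1.not_gt
    · exact absurd (h.color_lt v i hv') (hstep.color_range _ i hw' hw).1.not_gt
    · exact congrArg nl (h.lab_eq v w i hv' hw' hvw)

theorem levels_config [Finite W] [LinearOrder W] [OrderTop W]
    (inv : ClusterInv G k R ρ 1 ldr lab rel) (hk : k ≤ R) (hρ : 1 ≤ ρ)
    (hd : d = 2 ^ (s + 1)) (hde : d ^ 3 = 2 ^ e) (hB : 1 ≤ B) (hW : Nat.card W ≤ 2 ^ B)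
    (hm : ∀ t, bitSeq e B t ≤ m) (hq : 2 ^ bitSeq e B T ≤ q) (hj : j ≤ s) :
    ∃ (nl : W → W) (rel' : V → Set W) (K : W → Status),
      NetMap.chain (level k (R * 16 ^ s) (1 + 2 * s) d e m B T q) j V G
        (config me lab rel fun _ => .source) = config me (fun v => nl (lab v)) rel' K ∧
      ClusterInv G k (R * 16 ^ j) (ρ * 16 ^ j) (1 + 2 * j) ldr (fun v => nl (lab v)) rel' ∧
      IsPartialDecomposition G k (j * q) (fun v => nl (lab v)) K ∧
      (activeLabels (fun v => nl (lab v)) K).ncard * 2 ^ (s * j) ≤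
        (activeLabels lab fun _ => .source).ncard ∧
      ∀ v, ∃ w, nl (lab v) = lab w := by
  induction j with
  | zero =>
    exact ⟨id, rel, fun _ => .source, rfl, inv.mono (by simp) (by simp) (by simp),
      ⟨fun _ => Or.inl rfl, nofun, nofun⟩, by simp, fun v => ⟨v, rfl⟩⟩
  | succ j ih =>
    obtain ⟨nl, rel', K, hrun, inv', hdec, hactive, hlab⟩ := ih (Nat.le_of_succ_le hj)
    have hpow : 1 ≤ 16 ^ j := Nat.one_le_pow _ _ (by norm_num)
    have hkR : k ≤ R * 16 ^ j := hk.trans (Nat.le_mul_of_pos_right _ hpow)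
    have hρj : 1 ≤ ρ * 16 ^ j := Nat.mul_pos hρ hpow
    have hRs : R * 16 ^ (j + 1) ≤ R * 16 ^ s :=
      Nat.mul_le_mul_left _ (Nat.pow_le_pow_right (by norm_num) hj)
    rw [pow_succ, ← mul_assoc] at hRs
    obtain ⟨nl', rel'', K', hlevel, inv'', hstep⟩ := level_config (me := me) (T := T)
      (R' := R * 16 ^ s) (L' := 1 + 2 * s) inv' (by lia) (by lia) hd hde hB hW hm hq K j
      hdec.source_or_done
    refine ⟨fun A => nl' (nl A), rel'', K', ?_, inv''.mono ?_ ?_ le_rfl, hdec.level hstep,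
      ?_, fun v => ?_⟩
    · rw [NetMap.chain, NetMap.andThen, hrun, hlevel]
    · rw [pow_succ, ← mul_assoc]
      lia
    · rw [pow_succ, ← mul_assoc]
      lia
    · rw [Nat.mul_succ, pow_add, mul_comm (2 ^ (s * j)), ← mul_assoc]
      exact (Nat.mul_le_mul_right _ hstep.ncard_active).trans hactive
    · obtain ⟨w, hw⟩ := hstep.exists_lab v
      obtain ⟨w', hw'⟩ := hlab w
      exact ⟨w', hw.trans hw'⟩

end levels

/-! ### The output -/

section output

variable {V W : Type} {G : SimpleGraph V} {k R ρ L c : ℕ} {ldr : W → V} {lab : V → W}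
  {rel : V → Set W} {col : W → ℕ}

/-- The labels have colors less than `c`, and distinct clusters of the same color are not near to
each other. -/
structure IsClusterColoring (G : SimpleGraph V) (k c : ℕ) (lab : V → W) (col : W → ℕ) : Prop where
  color_lt : ∀ v, col (lab v) < c
  lab_eq : ∀ u v, col (lab u) = col (lab v) → G.edist u v ≤ k → lab u = lab v

theorem ClusterInv.within_blockGraph (inv : ClusterInv G k R ρ L ldr lab rel) {u v : V}
    (h : lab u = lab v) :
    Within (blockGraph (powerGraph G k) fun v => col (lab v)) {w | lab w = lab v} (2 * ρ) u v := by
  have hu := inv.strong u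
  rw [h] at hu
  rw [two_mul]
  exact (hu.symm.trans (inv.strong v)).mono_graph
    fun a b ha hb hab => ⟨hab, congrArg col (Eq.trans ha (Eq.symm hb))⟩

theorem ClusterInv.dist_blockGraph_le (inv : ClusterInv G k R ρ L ldr lab rel) {u v : V}
    (h : lab u = lab v) :
    (blockGraph (powerGraph G k) fun v => col (lab v)).dist u v ≤ 2 * ρ := by
  obtain ⟨p, hp, -⟩ := inv.within_blockGraph (col := col) h
  exact (SimpleGraph.dist_le p).trans hp

theorem ClusterInv.sameCluster_iff (inv : ClusterInv G k R ρ L ldr lab rel)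
    (hcol : IsClusterColoring G k c lab col) {u v : V} :
    SameCluster (powerGraph G k) (fun v => col (lab v)) u v ↔ lab u = lab v := by
  refine ⟨?_, fun h => ?_⟩
  · rintro ⟨p⟩
    induction p with
    | nil => rfl
    | cons hab _ ih => exact (hcol.lab_eq _ _ hab.2 hab.1.2).trans ih
  · obtain ⟨p, -⟩ := inv.within_blockGraph (col := col) h
    exact ⟨p⟩

theorem ClusterInv.outputsDecomposition {S D : ℕ} (inv : ClusterInv G k R ρ L ldr lab rel)
    (hcol : IsClusterColoring G k c lab col) (hD : 2 * ρ ≤ D) {name : W → BitVec S}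
    (hname : Function.Injective name) {ident : V → BitVec S}
    (hident : ∀ v, ident (ldr (lab v)) = name (lab v)) :
    OutputsDecomposition (powerGraph G k) c D ident fun v => (col (lab v), name (lab v)) where
  decomposition :=
    { color_lt := hcol.color_lt
      diam_le := fun _ _ h =>
        (inv.dist_blockGraph_le ((inv.sameCluster_iff hcol).1 h)).trans hD }
  label_eq_iff _ _ := hname.eq_iff.trans (inv.sameCluster_iff hcol).symm
  label_mem v := ⟨ldr (lab v), (inv.sameCluster_iff hcol).2
    (inv.lab_ldr v _ (inv.lab_mem v)).symm, (hident v).symm⟩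

theorem ClusterInv.prod_clusterOf [Fintype V] {M : Type*} [CommMonoid M]
    (inv : ClusterInv G k R ρ L ldr lab rel) (hcol : IsClusterColoring G k c lab col) (x : V → M)
    (v : V) :
    ∏ u ∈ clusterOf (powerGraph G k) (fun v => col (lab v)) v, x u =
      open Classical in ∏ u ∈ Finset.univ.filter (fun u => lab v = lab u), x u := by
  classical
  refine Finset.prod_congr ?_ fun _ _ => rfl
  ext u
  simp only [clusterOf, Finset.mem_filter, Finset.mem_univ, true_and]
  exact inv.sameCluster_iff hcol

end output

/-! ### Convergecast and broadcast in the clusters -/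

section depth

variable {V : Type*} {G : SimpleGraph V} {U : Set V} {r v : V} {n n' : ℕ}

/-- The node `v` has distance exactly `n` from the root `r` in the subgraph induced by `U`. -/
def AtDepth (G : SimpleGraph V) (U : Set V) (r : V) (n : ℕ) (v : V) : Prop :=
  Within G U n v r ∧ ∀ n' < n, ¬ Within G U n' v r

theorem AtDepth.zero_iff : AtDepth G U r 0 v ↔ v = r ∧ v ∈ U := by
  simp [AtDepth, Within.zero_iff]

theorem AtDepth.succ_iff' : AtDepth G U r (n + 1) v ↔
    Within G U (n + 1) v r ∧ ¬ Within G U n v r :=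
  and_congr_right fun _ => ⟨fun h => h n n.lt_succ_self,
    fun h _ hn hv => h (hv.mono subset_rfl (Nat.lt_succ_iff.1 hn))⟩

theorem AtDepth.of_adj {w : V} (hw : Within G U n w r) (hvw : G.Adj v w) (hU : v ∈ U)
    (hv : ¬ Within G U n v r) : AtDepth G U r n w :=
  ⟨hw, fun _ hn hw' => hv ((Within.cons hvw hU hw').mono subset_rfl hn)⟩

theorem AtDepth.succ_iff : AtDepth G U r (n + 1) v ↔
    v ∈ U ∧ ¬ Within G U n v r ∧ ∃ w, G.Adj v w ∧ AtDepth G U r n w := by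
  rw [AtDepth.succ_iff', Within.succ_iff]
  constructor
  · rintro ⟨⟨hU, h | ⟨w, hvw, hw⟩⟩, hv⟩
    · exact absurd h hv
    · exact ⟨hU, hv, w, hvw, .of_adj hw hvw hU hv⟩
  · rintro ⟨hU, hv, w, hvw, hw⟩
    exact ⟨⟨hU, Or.inr ⟨w, hvw, hw.1⟩⟩, hv⟩

theorem AtDepth.unique (h : AtDepth G U r n v) (h' : AtDepth G U r n' v) : n = n' :=
  le_antisymm (not_lt.1 fun hn => h.2 _ hn h'.1) (not_lt.1 fun hn => h'.2 _ hn h.1)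

theorem AtDepth.exists_of_within (h : Within G U n v r) : ∃ n' ≤ n, AtDepth G U r n' v := by
  classical
  have hex : ∃ n, Within G U n v r := ⟨n, h⟩
  exact ⟨Nat.find hex, Nat.find_min' hex h, Nat.find_spec hex, fun _ => Nat.find_min hex⟩

end depth

/-- The data of a node in the aggregation: for every label that it relays, its depth in the tree of
the label together with the identifier of its parent, and the product of the values that it has
collected. -/
structure TreeNode (W M : Type) where
  me : W
  lab : W
  rel : Set W
  dep : W → Option (ℕ × W)
  acc : W → M

/-- The data of all nodes in the aggregation. -/
def treeConfig {V W M : Type} (me lab : V → W) (rel : V → Set W) (dep : V → W → Option (ℕ × W))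
    (acc : V → W → M) (v : V) : TreeNode W M :=
  ⟨me v, lab v, rel v, dep v, acc v⟩

section trees

variable {V W M : Type}

open Classical in
/-- Initially the trees consist of their roots only. The root of the tree of a label is the node
that has this label as its identifier. -/
noncomputable def rootDepth (me : W) (rel : Set W) (l : W) : Option (ℕ × W) :=
  if l = me ∧ l ∈ rel then some (0, me) else none

open Classical in
/-- A node outside the tree of `l` accepts an offer `(l, u)` of a node at depth `j`, and `u` becomes
its parent. -/
noncomputable def adopt (rel : Set W) (dep : W → Option (ℕ × W)) (j : ℕ) (offers : Set (W × W))
    (l : W) : Option (ℕ × W) :=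
  if dep l = none ∧ l ∈ rel ∧ ∃ u, (l, u) ∈ offers then
    some (j + 1, pick {u | (l, u) ∈ offers} l)
  else dep l

/-- The nodes at depth `j` recruit children. -/
noncomputable def bfsStep (L j : ℕ) : NetMap (TreeNode W M) (TreeNode W M) :=
  NetMap.gather L
    (fun a => {p : W × W | p.1 ∈ a.rel ∧ p.2 = a.me ∧ ∃ q, a.dep p.1 = some (j, q)})
    fun a r => ⟨a.me, a.lab, a.rel, adopt a.rel a.dep j r, a.acc⟩

variable {G : SimpleGraph V} {k R ρ L j : ℕ} {ldr : W → V} {me lab : V → W} {rel : V → Set W}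
  {dep : V → W → Option (ℕ × W)}

/-- The offers that the neighbors of `v` at depth `j` make. -/
def offers (G : SimpleGraph V) (me : V → W) (rel : V → Set W) (dep : V → W → Option (ℕ × W))
    (j : ℕ) (v : V) : Set (W × W) :=
  {p | ∃ u, G.Adj v u ∧ p.1 ∈ rel u ∧ p.2 = me u ∧ ∃ q, dep u p.1 = some (j, q)}

/-- The entries of `dep` describe the first `j` levels of breadth first search trees, one for each
label, in the subgraph of the nodes that relay the label. -/
structure IsBfs (G : SimpleGraph V) (ldr : W → V) (me : V → W) (rel : V → Set W) (j : ℕ)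
    (dep : V → W → Option (ℕ × W)) : Prop where
  exists_iff : ∀ v l n, (∃ q, dep v l = some (n, q)) ↔
    n ≤ j ∧ AtDepth G {w | l ∈ rel w} (ldr l) n v
  parent : ∀ v l n q, dep v l = some (n + 1, q) →
    ∃ u, me u = q ∧ G.Adj u v ∧ AtDepth G {w | l ∈ rel w} (ldr l) n u

namespace IsBfs

theorem zero (hme : Function.Injective me) (hldr : ∀ v, ∀ l ∈ rel v, me (ldr l) = l) :
    IsBfs G ldr me rel 0 fun v => rootDepth (me v) (rel v) where
  exists_iff v l n := by
    have hroot : l = me v ∧ l ∈ rel v ↔ v = ldr l ∧ l ∈ rel v := by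
      refine and_congr_left fun hl => ⟨fun h => hme (h.symm.trans (hldr v l hl).symm), fun h => ?_⟩
      rw [h, hldr v l hl]
    rw [Nat.le_zero, rootDepth]
    constructor
    · rintro ⟨q, h⟩
      split_ifs at h with hl
      obtain rfl : 0 = n := congrArg Prod.fst (Option.some.inj h)
      exact ⟨rfl, AtDepth.zero_iff.2 (hroot.1 hl)⟩
    · rintro ⟨rfl, h⟩
      exact ⟨me v, if_pos (hroot.2 (AtDepth.zero_iff.1 h))⟩
  parent v l n q h := by
    rw [rootDepth] at h
    split_ifs at h
    simp at h

variable (h : IsBfs G ldr me rel j dep)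
include h

theorem atDepth {v : V} {l : W} {n : ℕ} {q : W} (hv : dep v l = some (n, q)) :
    AtDepth G {w | l ∈ rel w} (ldr l) n v :=
  ((h.exists_iff v l n).1 ⟨q, hv⟩).2

theorem eq_none_iff (v : V) (l : W) :
    dep v l = none ↔ ¬ Within G {w | l ∈ rel w} j v (ldr l) := by
  rw [← not_iff_not, not_not, ← ne_eq, Option.ne_none_iff_exists']
  constructor
  · rintro ⟨⟨n, q⟩, hv⟩
    have hn := (h.exists_iff v l n).1 ⟨q, hv⟩
    exact hn.2.1.mono subset_rfl hn.1
  · intro hv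
    obtain ⟨n, hn, hvn⟩ := AtDepth.exists_of_within hv
    obtain ⟨q, hq⟩ := (h.exists_iff v l n).2 ⟨hn, hvn⟩
    exact ⟨_, hq⟩

theorem mem_offers_iff (v : V) (l q : W) : (l, q) ∈ offers G me rel dep j v ↔
    ∃ u, me u = q ∧ G.Adj v u ∧ AtDepth G {w | l ∈ rel w} (ldr l) j u := by
  refine exists_congr fun u => ⟨fun ⟨hu, _, hq, hj⟩ => ?_, fun ⟨hq, hu, hj⟩ => ?_⟩
  · exact ⟨hq.symm, hu, ((h.exists_iff u l j).1 hj).2⟩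
  · exact ⟨hu, hj.1.left_mem, hq.symm, (h.exists_iff u l j).2 ⟨le_rfl, hj⟩⟩

theorem accepts_iff (v : V) (l : W) :
    (dep v l = none ∧ l ∈ rel v ∧ ∃ u, (l, u) ∈ offers G me rel dep j v) ↔
      AtDepth G {w | l ∈ rel w} (ldr l) (j + 1) v := by
  rw [AtDepth.succ_iff, h.eq_none_iff, and_left_comm]
  refine and_congr_right fun _ => and_congr_right fun _ => ?_
  simp only [h.mem_offers_iff]
  exact ⟨fun ⟨_, u, _, hu⟩ => ⟨u, hu⟩, fun ⟨u, hu⟩ => ⟨_, u, rfl, hu⟩⟩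

theorem adopt_offers :
    IsBfs G ldr me rel (j + 1) fun v => adopt (rel v) (dep v) j (offers G me rel dep j v) where
  exists_iff v l n := by
    by_cases hv : AtDepth G {w | l ∈ rel w} (ldr l) (j + 1) v
    · rw [adopt, if_pos ((h.accepts_iff v l).2 hv)]
      simp only [Option.some.injEq, Prod.mk.injEq, exists_and_left, exists_eq', and_true]
      exact ⟨fun hn => hn ▸ ⟨le_rfl, hv⟩, fun hn => hv.unique hn.2⟩
    · rw [adopt, if_neg fun hv' => hv ((h.accepts_iff v l).1 hv'), h.exists_iff]
      refine and_congr_left fun hn => ⟨fun hj => hj.trans j.le_succ, fun hj => ?_⟩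
      exact Nat.lt_succ_iff.1 (hj.lt_of_ne fun hnj => hv (hnj ▸ hn))
  parent v l n q hq := by
    rw [adopt] at hq
    split_ifs at hq with hv
    · simp only [Option.some.injEq, Prod.mk.injEq, Nat.add_right_cancel_iff] at hq
      obtain ⟨rfl, rfl⟩ := hq
      have hoffer := pick_mem (s := {u | (l, u) ∈ offers G me rel dep j v}) hv.2.2 l
      obtain ⟨u, hu, hvu, hj⟩ := (h.mem_offers_iff v l _).1 hoffer
      exact ⟨u, hu, hvu.symm, hj⟩
    · exact h.parent v l n q hq

end IsBfs

theorem bfsStep_treeConfig [Finite W] (inv : ClusterInv G k R ρ L ldr lab rel) (acc : V → W → M) :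
    bfsStep L j V G (treeConfig me lab rel dep acc) =
      treeConfig me lab rel (fun v => adopt (rel v) (dep v) j (offers G me rel dep j v)) acc := by
  have hcap (u : V) : NetMap.cap L
        {p : W × W | p.1 ∈ rel u ∧ p.2 = me u ∧ ∃ q, dep u p.1 = some (j, q)} =
      {p | p.1 ∈ rel u ∧ p.2 = me u ∧ ∃ q, dep u p.1 = some (j, q)} := by
    refine NetMap.cap_of_le ((Set.ncard_le_ncard_of_injOn Prod.fst (fun p hp => hp.1) ?_
      (Set.toFinite _)).trans (inv.card_le u))
    exact fun p hp p' hp' hpp => Prod.ext hpp (hp.2.1.trans hp'.2.1.symm)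
  funext v
  simp only [bfsStep, NetMap.gather, treeConfig, hcap]
  rfl

theorem exists_bfs [Finite W] (inv : ClusterInv G k R ρ L ldr lab rel)
    (hme : Function.Injective me) (hldr : ∀ v, ∀ l ∈ rel v, me (ldr l) = l) (acc : V → W → M)
    (j : ℕ) :
    ∃ dep, NetMap.chain (bfsStep L) j V G
        (treeConfig me lab rel (fun v => rootDepth (me v) (rel v)) acc) =
      treeConfig me lab rel dep acc ∧ IsBfs G ldr me rel j dep := by
  induction j with
  | zero => exact ⟨_, rfl, .zero hme hldr⟩
  | succ j ih =>
    obtain ⟨dep, hdep, h⟩ := ih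
    refine ⟨_, ?_, h.adopt_offers⟩
    rw [NetMap.chain, NetMap.andThen, hdep, bfsStep_treeConfig inv]

end trees

section converge

variable {V W M : Type}

variable [Fintype V] {G : SimpleGraph V} {k R ρ L : ℕ} {ldr : W → V} {me lab : V → W}
  {rel : V → Set W} {dep : V → W → Option (ℕ × W)}

open Classical in
/-- The children of `u` at depth `n` in the tree of `l`. -/
noncomputable def children (G : SimpleGraph V) (me : V → W) (dep : V → W → Option (ℕ × W)) (l : W)
    (n : ℕ) (u : V) : Finset V :=
  Finset.univ.filter fun c => G.Adj u c ∧ dep c l = some (n, me u)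

theorem mem_children {l : W} {n : ℕ} {u c : V} :
    c ∈ children G me dep l n u ↔ G.Adj u c ∧ dep c l = some (n, me u) := by
  simp [children]

open Classical in
/-- The nodes of depth at most `n` in the tree of `l`. -/
noncomputable def shallow (G : SimpleGraph V) (ldr : W → V) (rel : V → Set W) (l : W) (n : ℕ) :
    Finset V :=
  Finset.univ.filter fun v => Within G {w | l ∈ rel w} n v (ldr l)

theorem mem_shallow {l : W} {n : ℕ} {v : V} :
    v ∈ shallow G ldr rel l n ↔ Within G {w | l ∈ rel w} n v (ldr l) := by
  simp [shallow]

theorem ClusterInv.mem_shallow_iff (inv : ClusterInv G k R ρ L ldr lab rel) {l : W} {v : V} :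
    v ∈ shallow G ldr rel l R ↔ l ∈ rel v :=
  mem_shallow.trans ⟨Within.left_mem, fun h => (inv.relay v l h).symm⟩

theorem shallow_zero {l : W} (h : l ∈ rel (ldr l)) : shallow G ldr rel l 0 = {ldr l} := by
  ext u
  rw [mem_shallow, Within.zero_iff, Finset.mem_singleton]
  exact and_iff_left_of_imp fun hu => hu ▸ h

theorem IsBfs.shallow_succ [DecidableEq V] (h : IsBfs G ldr me rel R dep) {n : ℕ} (hn : n + 1 ≤ R)
    (l : W) : shallow G ldr rel l (n + 1) =
      shallow G ldr rel l n ∪ (shallow G ldr rel l n).biUnion (children G me dep l (n + 1)) := by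
  ext c
  simp only [Finset.mem_union, Finset.mem_biUnion, mem_shallow, mem_children]
  constructor
  · intro hc
    refine or_iff_not_imp_left.2 fun hc' => ?_
    obtain ⟨q, hq⟩ := (h.exists_iff c l (n + 1)).2 ⟨hn, AtDepth.succ_iff'.2 ⟨hc, hc'⟩⟩
    obtain ⟨u, rfl, huc, hu⟩ := h.parent c l n q hq
    exact ⟨u, hu.1, huc, hq⟩
  · rintro (hc | ⟨u, -, -, hc⟩)
    · exact hc.mono subset_rfl n.le_succ
    · exact (h.atDepth hc).1

theorem IsBfs.disjoint_children (h : IsBfs G ldr me rel R dep) [DecidableEq V] (l : W) (n : ℕ) :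
    Disjoint (shallow G ldr rel l n)
      ((shallow G ldr rel l n).biUnion (children G me dep l (n + 1))) := by
  simp only [Finset.disjoint_left, Finset.mem_biUnion, mem_shallow, mem_children]
  rintro c hc ⟨u, -, -, hc'⟩
  exact (h.atDepth hc').2 n n.lt_succ_self hc

theorem IsBfs.received_eq_image_children (h : IsBfs G ldr me rel R dep) (acc : V → W → M) (n : ℕ)
    (v : V) (l : W) :
    {e : W × W × W × M | (∃ u, G.Adj v u ∧ e.1 ∈ rel u ∧ e.2.1 = me u ∧
        dep u e.1 = some (n, e.2.2.1) ∧ e.2.2.2 = acc u e.1) ∧ e.1 = l ∧ e.2.2.1 = me v} =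
      (fun c => (l, me c, me v, acc c l)) '' (children G me dep l n v : Set V) := by
  ext ⟨l', w, q, m⟩
  constructor
  · rintro ⟨⟨u, hvu, -,
      rfl : w = _, hu : dep u l' = _, (rfl : m = acc u l')⟩, rfl : l' = _, rfl : q = _⟩
    exact ⟨u, mem_children.2 ⟨hvu, hu⟩, rfl⟩
  · rintro ⟨u, hu, he⟩
    simp only [Prod.mk.injEq] at he
    obtain ⟨rfl, rfl, rfl, rfl⟩ := he
    obtain ⟨hvu, hu⟩ := mem_children.1 hu
    exact ⟨⟨u, hvu, (h.atDepth hu).1.left_mem, rfl, hu, rfl⟩, rfl, rfl⟩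

variable [CommMonoid M]

/-- The nodes at depth `R - i` send their values to their parents. -/
noncomputable def convergeStep (R L i : ℕ) : NetMap (TreeNode W M) (TreeNode W M) :=
  NetMap.gather L
    (fun a => {e : W × W × W × M | e.1 ∈ a.rel ∧ e.2.1 = a.me ∧
      a.dep e.1 = some (R - i, e.2.2.1) ∧ e.2.2.2 = a.acc e.1})
    fun a r => ⟨a.me, a.lab, a.rel, a.dep, fun l =>
      a.acc l * ∏ᶠ e ∈ {e | e ∈ r ∧ e.1 = l ∧ e.2.2.1 = a.me}, e.2.2.2⟩

/-- Multiply the value of every node with the values of its children at depth `n`. -/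
noncomputable def collect (G : SimpleGraph V) (me : V → W) (dep : V → W → Option (ℕ × W)) (n : ℕ)
    (acc : V → W → M) (v : V) (l : W) : M :=
  acc v l * ∏ c ∈ children G me dep l n v, acc c l

theorem IsBfs.prod_collect (h : IsBfs G ldr me rel R dep) (hme : Function.Injective me) {n : ℕ}
    (hn : n + 1 ≤ R) (acc : V → W → M) (l : W) :
    ∏ u ∈ shallow G ldr rel l n, collect G me dep (n + 1) acc u l =
      ∏ u ∈ shallow G ldr rel l (n + 1), acc u l := by
  classical
  simp only [collect]
  rw [Finset.prod_mul_distrib, h.shallow_succ hn, Finset.prod_union (h.disjoint_children l n),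
    Finset.prod_biUnion]
  intro u _ u' _ hne
  simp only [Function.onFun, Finset.disjoint_left, mem_children]
  intro c ⟨_, hc⟩ ⟨_, hc'⟩
  exact hne (hme (congrArg Prod.snd (Option.some.inj (hc.symm.trans hc'))))

theorem convergeStep_treeConfig [Finite W] (inv : ClusterInv G k R ρ L ldr lab rel)
    (hme : Function.Injective me) (h : IsBfs G ldr me rel R dep) (acc : V → W → M) (i : ℕ) :
    convergeStep R L i V G (treeConfig me lab rel dep acc) =
      treeConfig me lab rel dep (collect G me dep (R - i) acc) := by
  have hcap (u : V) : NetMap.cap L {e : W × W × W × M | e.1 ∈ rel u ∧ e.2.1 = me u ∧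
        dep u e.1 = some (R - i, e.2.2.1) ∧ e.2.2.2 = acc u e.1} =
      {e | e.1 ∈ rel u ∧ e.2.1 = me u ∧ dep u e.1 = some (R - i, e.2.2.1) ∧
        e.2.2.2 = acc u e.1} := by
    refine NetMap.cap_of_le ((Set.ncard_le_ncard_of_injOn Prod.fst (fun e he => he.1) ?_
      (Set.toFinite _)).trans (inv.card_le u))
    rintro ⟨l, w, q, m⟩ ⟨-, rfl : w = _, hq : dep u l = _, (rfl : m = acc u l)⟩
      ⟨l', w', q', m'⟩ ⟨-, rfl : w' = _, hq' : dep u l' = _, (rfl : m' = acc u l')⟩ (rfl : l = l')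
    obtain rfl : q = q' := congrArg Prod.snd (Option.some.inj (hq.symm.trans hq'))
    rfl
  funext v
  simp only [convergeStep, NetMap.gather, treeConfig, hcap, TreeNode.mk.injEq, true_and]
  funext l
  rw [collect]
  congr 1
  have himage := h.received_eq_image_children acc (R - i) v l
  refine (congrArg (fun s : Set (W × W × W × M) => ∏ᶠ e ∈ s, e.2.2.2) himage).trans ?_
  rw [finprod_mem_image, finprod_mem_coe_finset]
  exact fun c _ c' _ hc => hme (congrArg (fun e => e.2.1) hc)

theorem exists_converge [Finite W] (inv : ClusterInv G k R ρ L ldr lab rel)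
    (hme : Function.Injective me) (h : IsBfs G ldr me rel R dep) (acc₀ : V → W → M) {i : ℕ}
    (hi : i ≤ R) :
    ∃ acc, NetMap.chain (convergeStep R L) i V G (treeConfig me lab rel dep acc₀) =
        treeConfig me lab rel dep acc ∧
      ∀ l, ∏ v ∈ shallow G ldr rel l (R - i), acc v l =
        ∏ v ∈ shallow G ldr rel l R, acc₀ v l := by
  induction i with
  | zero => exact ⟨acc₀, rfl, fun l => rfl⟩
  | succ i ih =>
    obtain ⟨acc, hacc, hprod⟩ := ih (Nat.le_of_succ_le hi)
    refine ⟨collect G me dep (R - i) acc, ?_, fun l => ?_⟩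
    · rw [NetMap.chain, NetMap.andThen, hacc, convergeStep_treeConfig inv hme h]
    · rw [← hprod l, show R - i = R - (i + 1) + 1 by lia]
      exact h.prod_collect hme (by lia) acc l

end converge

section aggregate

variable {V W κ M : Type} [CommMonoid M] [Finite M]

open Classical in
/-- A node contributes its value to its own cluster only. -/
noncomputable def treeInit (a : Node W κ × M) : TreeNode W M :=
  ⟨a.1.me, a.1.lab, a.1.rel, rootDepth a.1.me a.1.rel, Pi.mulSingle a.1.lab a.2⟩

/-- The leaders flood the product that they have collected. -/
noncomputable def broadcast (R L : ℕ) : NetMap (TreeNode W M) M :=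
  (flood (fun a => a.rel) (fun a => {p | p.1 = a.me ∧ p.1 ∈ a.rel ∧ p.2 = a.acc p.1}) 1 L
    (fun _ : M => ()) R).andThen (NetMap.ofLocal fun a => pick {m | (a.1.lab, m) ∈ a.2} 1)

/-- Every node learns the product of the values in its cluster. -/
noncomputable def aggregate (R L : ℕ) : NetMap (Node W κ × M) M :=
  (NetMap.ofLocal treeInit).andThen ((NetMap.chain (bfsStep L) R).andThen
    ((NetMap.chain (convergeStep R L) R).andThen (broadcast R L)))

variable [Finite W]

theorem Realizable.aggregate {B a : ℕ} (hB : 1 ≤ B) (hW : Nat.card W ≤ 2 ^ B)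
    (hM : Nat.card M ≤ 2 ^ (a * B)) (R L : ℕ) :
    Realizable B (R * L * (9 + 2 * a)) (aggregate (W := W) (M := M) (κ := κ) R L) := by
  have hW' : Nat.card W ≤ 2 ^ (1 * B) := by rwa [one_mul]
  have hbfs (j : ℕ) : Realizable B (L * 3) (bfsStep (W := W) (M := M) L j) :=
    Realizable.gather hB (card_prod_le_two_pow hW' hW') _ _
  have hconverge (i : ℕ) : Realizable B (L * (a + 4)) (convergeStep (W := W) (M := M) R L i) :=
    (Realizable.gather hB (card_prod_le_two_pow hW'
      (card_prod_le_two_pow hW' (card_prod_le_two_pow hW' hM))) _ _).mono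
      (Nat.mul_le_mul_left _ (by lia))
  have hbroadcast := Realizable.flood hB hW hM (fun a : TreeNode W M => a.rel)
    (fun a => {p | p.1 = a.me ∧ p.1 ∈ a.rel ∧ p.2 = a.acc p.1}) 1 L (fun _ => ()) R
  refine ((Realizable.ofLocal treeInit 0).andThen ((Realizable.chain hbfs R).andThen
    ((Realizable.chain hconverge R).andThen (hbroadcast.andThen (.ofLocal _ 0))))).mono
    (le_of_eq ?_)
  ring

variable {G : SimpleGraph V} {k R ρ L : ℕ} {ldr : W → V} {me lab : V → W} {rel : V → Set W}

theorem broadcast_treeConfig (inv : ClusterInv G k R ρ L ldr lab rel)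
    (hme : Function.Injective me) (hldr : ∀ v, ∀ l ∈ rel v, me (ldr l) = l)
    (dep : V → W → Option (ℕ × W)) (acc : V → W → M) (v : V) :
    broadcast R L V G (treeConfig me lab rel dep acc) v = acc (ldr (lab v)) (lab v) := by
  have hsource : {e | ∃ u, Within G {w | lab v ∈ rel w} R v u ∧
      lab v = me u ∧ lab v ∈ rel u ∧ e = acc u (lab v)} = {acc (ldr (lab v)) (lab v)} := by
    ext e
    constructor
    · rintro ⟨u, -, hu, hrel, rfl⟩
      obtain rfl : u = ldr (lab v) := hme (hu.symm.trans (hldr u _ hrel).symm)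
      rfl
    · rintro rfl
      have hv := inv.relay v _ (inv.lab_mem v)
      exact ⟨_, hv.symm, (hldr v _ (inv.lab_mem v)).symm, hv.left_mem, rfl⟩
  simp only [broadcast, NetMap.andThen, NetMap.ofLocal]
  rw [flood_apply (rel := fun a : TreeNode W M => a.rel) G _ _ R
    fun u => (Nat.mul_one _).trans_le (inv.card_le u)]
  simp only [floodState, treeConfig, Set.mem_ofPred_eq, inv.lab_mem, true_and]
  rw [hsource, smallest_eq_self (by simp)]
  exact pick_mem (Set.singleton_nonempty _) 1

theorem aggregate_apply [Fintype V] (inv : ClusterInv G k R ρ L ldr lab rel)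
    (hme : Function.Injective me) (hldr : ∀ v, ∀ l ∈ rel v, me (ldr l) = l) (K : W → κ) (x : V → M)
    (v : V) :
    aggregate R L V G (fun v => (config me lab rel K v, x v)) v =
      open Classical in ∏ u ∈ Finset.univ.filter (fun u => lab v = lab u), x u := by
  classical
  set acc₀ : V → W → M := fun u => Pi.mulSingle (lab u) (x u)
  obtain ⟨dep, hdep, hbfs⟩ := exists_bfs inv hme hldr acc₀ R
  obtain ⟨acc, hacc, hprod⟩ := exists_converge inv hme hbfs acc₀ le_rfl
  have haggregate : aggregate R L V G (fun v => (config me lab rel K v, x v)) =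
      broadcast R L V G (treeConfig me lab rel dep acc) := by
    rw [← hacc, ← hdep]
    simp only [aggregate, NetMap.andThen]
    congr!
  rw [haggregate, broadcast_treeConfig inv hme hldr]
  calc acc (ldr (lab v)) (lab v) = ∏ u ∈ shallow G ldr rel (lab v) 0, acc u (lab v) := by
        rw [shallow_zero (inv.relay v _ (inv.lab_mem v)).left_mem, Finset.prod_singleton]
    _ = ∏ u ∈ shallow G ldr rel (lab v) R, acc₀ u (lab v) := by rw [← hprod, Nat.sub_self]
    _ = ∏ u, acc₀ u (lab v) := by
        refine Finset.prod_subset (Finset.subset_univ _) fun u _ hu => Pi.mulSingle_eq_of_ne ?_ _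
        exact fun h => hu (inv.mem_shallow_iff.2 (h ▸ inv.lab_mem u))
    _ = ∏ u ∈ Finset.univ.filter (fun u => lab v = lab u), x u := by
        rw [Finset.prod_filter]
        exact Finset.prod_congr rfl fun u _ => Pi.mulSingle_apply _ _ _

end aggregate

/-! ### The parameters of the algorithm -/

/-- An integer version of `√(log₂ N)`. It is the number of levels of the algorithm, and each level
divides the number of active clusters by `2 ^ scale N`. -/
def scale (N : ℕ) : ℕ := Nat.sqrt (Nat.clog 2 N) + 1

/-- The bound for the number of colors, the diameters, and the number of rounds. -/
def decompositionBound (N : ℕ) : ℕ := 2 ^ (300 * scale N)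

theorem one_le_scale (N : ℕ) : 1 ≤ scale N := Nat.le_add_left _ _

theorem two_le_decompositionBound (N : ℕ) : 2 ≤ decompositionBound N :=
  Nat.le_self_pow (by have := one_le_scale N; lia) 2

theorem lt_two_pow_scale_mul_scale (N : ℕ) : N < 2 ^ (scale N * scale N) :=
  calc N ≤ 2 ^ Nat.clog 2 N := Nat.le_pow_clog one_lt_two N
    _ < 2 ^ (scale N * scale N) := Nat.pow_lt_pow_right one_lt_two (Nat.lt_succ_sqrt _)

theorem clog_two_le_logb_add_one {N : ℕ} (hN : 2 ≤ N) :
    (Nat.clog 2 N : ℝ) ≤ Real.logb 2 N + 1 := by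
  have hceil := Real.natCeil_logb_natCast 2 N
  rw [Nat.cast_ofNat] at hceil
  rw [← hceil]
  exact (Nat.ceil_lt_add_one (Real.logb_nonneg one_lt_two (by norm_cast; lia))).le

theorem scale_le_mul_sqrt_logb {N : ℕ} (hN : 2 ≤ N) : (scale N : ℝ) ≤ 3 * √(Real.logb 2 N) := by
  have hlog : 1 ≤ Real.logb 2 N := by
    rw [Real.le_logb_iff_rpow_le one_lt_two (by positivity), Real.rpow_one]
    exact_mod_cast hN
  have hsqrt : √(Nat.clog 2 N : ℝ) ≤ 2 * √(Real.logb 2 N) := by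
    rw [Real.sqrt_le_left (by positivity), mul_pow, Real.sq_sqrt (by linarith)]
    linarith [clog_two_le_logb_add_one hN]
  calc (scale N : ℝ) = (Nat.clog 2 N).sqrt + 1 := by rw [scale, Nat.cast_add, Nat.cast_one]
    _ ≤ 2 * √(Real.logb 2 N) + √(Real.logb 2 N) :=
        add_le_add (Real.nat_sqrt_le_real_sqrt.trans hsqrt) (Real.one_le_sqrt.2 hlog)
    _ = 3 * √(Real.logb 2 N) := by ring

theorem isTwoPowBigOSqrtLog_decompositionBound : IsTwoPowBigOSqrtLog decompositionBound := by
  refine ⟨900, Filter.eventually_atTop.2 ⟨2, fun N hN => ?_⟩⟩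
  rw [decompositionBound, Nat.cast_pow, Nat.cast_ofNat, ← Real.rpow_natCast]
  refine Real.rpow_le_rpow_of_exponent_le one_le_two ?_
  rw [Nat.cast_mul, Nat.cast_ofNat]
  linarith [scale_le_mul_sqrt_logb hN]

section numerics

variable {s : ℕ}

theorem le_two_pow_mul {a b : ℕ} (hs : 1 ≤ s) (h : a ≤ 2 ^ b) : a ≤ 2 ^ (b * s) :=
  h.trans (Nat.pow_le_pow_right two_pos (Nat.le_mul_of_pos_right _ hs))

theorem sixteen_pow_eq (s : ℕ) : 16 ^ s = 2 ^ (4 * s) := by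
  rw [pow_mul]
  norm_num

theorem one_add_two_mul_le_two_pow (s : ℕ) : 1 + 2 * s ≤ 2 ^ (2 * s) := by
  have hlt : s < 2 ^ s := Nat.lt_two_pow_self
  rw [two_mul, pow_add]
  nlinarith

theorem two_pow_finalBits_le (hs : 1 ≤ s) : 2 ^ finalBits (3 * (s + 1)) ≤ 2 ^ (234 * s) :=
  Nat.pow_le_pow_right two_pos (by rw [finalBits]; lia)

theorem mul_two_pow_finalBits_le (hs : 1 ≤ s) :
    s * 2 ^ finalBits (3 * (s + 1)) ≤ 2 ^ (300 * s) :=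
  calc s * 2 ^ finalBits (3 * (s + 1)) ≤ 2 ^ s * 2 ^ (234 * s) :=
        Nat.mul_le_mul Nat.lt_two_pow_self.le (two_pow_finalBits_le hs)
    _ = 2 ^ (s + 234 * s) := by rw [pow_add]
    _ ≤ 2 ^ (300 * s) := Nat.pow_le_pow_right two_pos (by lia)

theorem two_mul_radius_le (hs : 1 ≤ s) (r : ℕ) : 2 * (r * 16 ^ s) ≤ r * 2 ^ (300 * s) :=
  calc 2 * (r * 16 ^ s) = r * (2 ^ 1 * 2 ^ (4 * s)) := by rw [sixteen_pow_eq]; ring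
    _ = r * 2 ^ (1 + 4 * s) := by rw [pow_add]
    _ ≤ r * 2 ^ (300 * s) := Nat.mul_le_mul_left _ (Nat.pow_le_pow_right two_pos (by lia))

theorem exchanges_le (hs : 1 ≤ s) {l : ℕ} (hl : 1 ≤ l) :
    5 + 2 * (2 * l) + 2 * 2 ^ finalBits (3 * (s + 1)) ≤ l * 2 ^ (238 * s) := by
  have hcolors := two_pow_finalBits_le hs
  have hone : 1 ≤ 2 ^ (234 * s) := Nat.one_le_two_pow
  have hsixteen : 16 ≤ 2 ^ (4 * s) := le_two_pow_mul hs (by norm_num)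
  calc 5 + 2 * (2 * l) + 2 * 2 ^ finalBits (3 * (s + 1)) ≤ l * (16 * 2 ^ (234 * s)) := by nlinarith
    _ ≤ l * (2 ^ (4 * s) * 2 ^ (234 * s)) := by gcongr
    _ = l * 2 ^ (238 * s) := by ring_nf

theorem finalBits_add_five_le (hs : 1 ≤ s) : finalBits (3 * (s + 1)) + 5 ≤ 2 ^ (9 * s) :=
  calc finalBits (3 * (s + 1)) + 5 ≤ 256 * s := by rw [finalBits]; lia
    _ ≤ 2 ^ (8 * s) * 2 ^ s :=
        Nat.mul_le_mul (le_two_pow_mul hs (by norm_num)) Nat.lt_two_pow_self.le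
    _ = 2 ^ (9 * s) := by ring_nf

theorem roundCost_le (hs : 1 ≤ s) (K : ℕ) :
    roundCost (K * 16 ^ s) (1 + 2 * s) (2 ^ (s + 1)) (finalBits (3 * (s + 1))) ≤
      K * 2 ^ (23 * s) := by
  have hthree : 3 ≤ 2 ^ (2 * s) := le_two_pow_mul hs (by norm_num)
  have hcube : (2 ^ (s + 1)) ^ 3 ≤ 2 ^ (6 * s) := by
    rw [← pow_mul]
    exact Nat.pow_le_pow_right two_pos (by lia)
  rw [roundCost, sixteen_pow_eq]
  calc 3 * (K * 2 ^ (4 * s) * ((1 + 2 * s) * ((2 ^ (s + 1)) ^ 3 * (finalBits (3 * (s + 1)) + 5))))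
      ≤ 2 ^ (2 * s) * (K * 2 ^ (4 * s) * (2 ^ (2 * s) * (2 ^ (6 * s) * 2 ^ (9 * s)))) := by
        gcongr
        · exact one_add_two_mul_le_two_pow s
        · exact finalBits_add_five_le hs
    _ = K * 2 ^ (23 * s) := by ring_nf

theorem levels_rounds_le (hs : 1 ≤ s) {l : ℕ} (hl : 1 ≤ l) (K : ℕ) :
    s * ((5 + 2 * (2 * l) + 2 * 2 ^ finalBits (3 * (s + 1))) *
      roundCost (K * 16 ^ s) (1 + 2 * s) (2 ^ (s + 1)) (finalBits (3 * (s + 1)))) ≤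
      K * 2 ^ (300 * s) * l :=
  calc s * ((5 + 2 * (2 * l) + 2 * 2 ^ finalBits (3 * (s + 1))) *
      roundCost (K * 16 ^ s) (1 + 2 * s) (2 ^ (s + 1)) (finalBits (3 * (s + 1))))
      ≤ 2 ^ s * (l * 2 ^ (238 * s) * (K * 2 ^ (23 * s))) :=
        Nat.mul_le_mul Nat.lt_two_pow_self.le
          (Nat.mul_le_mul (exchanges_le hs hl) (roundCost_le hs K))
    _ = K * 2 ^ (262 * s) * l := by ring_nf
    _ ≤ K * 2 ^ (300 * s) * l := by gcongr <;> norm_num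

theorem aggregate_rounds_le (hs : 1 ≤ s) {a : ℕ} (ha : 1 ≤ a) (K : ℕ) :
    K * 16 ^ s * (1 + 2 * s) * (9 + 2 * a) ≤ a * K * 2 ^ (300 * s) := by
  have hsixteen : 16 ≤ 2 ^ (4 * s) := le_two_pow_mul hs (by norm_num)
  rw [sixteen_pow_eq]
  calc K * 2 ^ (4 * s) * (1 + 2 * s) * (9 + 2 * a)
      ≤ K * 2 ^ (4 * s) * 2 ^ (2 * s) * (2 ^ (4 * s) * a) := by
        gcongr
        · exact one_add_two_mul_le_two_pow s
        · nlinarith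
    _ = a * K * 2 ^ (10 * s) := by ring_nf
    _ ≤ a * K * 2 ^ (300 * s) := by gcongr <;> norm_num

end numerics

/-! ### The algorithm -/

/-- The computation of the network decomposition: `scale N` levels, which start from the given
clusters. The labels of the clusters are the identifiers of their centers. -/
noncomputable def decompose (N S k r : ℕ) : NetMap (BitVec S × Bool) (Node (Fin (2 ^ S)) Status) :=
  (NetMap.ofLocal fun x => ⟨x.1.toFin, x.1.toFin, {x.1.toFin}, .source⟩).andThen
    (NetMap.chain (level k (k * r * 16 ^ scale N) (1 + 2 * scale N) (2 ^ (scale N + 1))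
      (3 * (scale N + 1)) (finalBits (3 * (scale N + 1)) * S) S (2 * logStar S)
      (2 ^ finalBits (3 * (scale N + 1)))) (scale N))

theorem one_le_logStar {S : ℕ} (hS : 2 ≤ S) : 1 ≤ logStar S := by
  rw [logStar, if_neg (by lia)]
  exact Nat.le_add_left _ _

theorem Realizable.decompose (N k : ℕ) {S r : ℕ} (hS : 2 ≤ S) (hr : 1 ≤ r) :
    Realizable S (k * r * decompositionBound N * logStar S)
      (NetworkDecomposition.decompose N S k r) := by
  have hk : k ≤ k * r * 16 ^ scale N := by
    rw [mul_assoc]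
    exact Nat.le_mul_of_pos_right _ (Nat.mul_pos hr (by positivity))
  refine ((Realizable.ofLocal _ 0).andThen (Realizable.chain (fun i => Realizable.level
    (by lia) (by simp) hk (by lia) Nat.one_le_two_pow _ _ _ i) (scale N))).mono ?_
  rw [Nat.zero_add]
  exact levels_rounds_le (one_le_scale N) (one_le_logStar hS) (k * r)

/-- The color of a finished cluster, and the junk value `0` for other clusters. -/
def Status.color : Status → ℕ
  | .done c => c
  | _ => 0

section decompose

variable {V W : Type} {G : SimpleGraph V} {N S k r c : ℕ} {center : V → V} {name : V → W}
  {lab : V → W} {K : W → Status}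

theorem powerGraph_adj_of_adj (hk : 1 ≤ k) {u v : V} (h : G.Adj u v) : (powerGraph G k).Adj u v :=
  ⟨h.ne, (SimpleGraph.edist_eq_one_iff_adj.2 h).le.trans (Nat.one_le_cast.2 hk)⟩

theorem exists_clusterInv_of_isClustering [Nonempty V] (hk : 1 ≤ k) (hc : IsClustering G r center)
    (hname : Set.InjOn name (Set.range center)) :
    ∃ ldr : W → V, (∀ v, ldr (name (center v)) = center v) ∧
      ClusterInv G k r r 1 ldr (fun v => name (center v)) (fun v => {name (center v)}) := by
  have hldr : ∀ v, Function.invFunOn name (Set.range center) (name (center v)) = center v :=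
    fun v => hname.leftInvOn_invFunOn ⟨v, rfl⟩
  have hwithin : ∀ v, Within G {w | name (center w) = name (center v)} r (center v) v :=
    fun v => Within.mono (hc.radius_le v) (fun w hw => congrArg name hw) le_rfl
  refine ⟨Function.invFunOn name (Set.range center), hldr, fun v => rfl, ?_, ?_, fun v => ?_,
    fun v => (Set.ncard_singleton _).le⟩
  · rintro v l rfl
    rw [hldr, hc.center_center]
  · rintro v l rfl
    rw [hldr]
    exact (hwithin v).mono (fun w hw => Eq.symm hw) le_rfl
  · rw [hldr]
    exact (hwithin v).mono_graph fun _ _ _ _ => powerGraph_adj_of_adj hk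

theorem ncard_activeLabels_le [Finite V] :
    (activeLabels (fun v => name (center v)) fun _ => .source).ncard ≤
      (Set.range center).ncard := by
  have hsub : activeLabels (fun v => name (center v)) (fun _ => .source) ⊆
      name '' Set.range center := by
    rintro _ ⟨⟨v, rfl⟩, -⟩
    exact ⟨center v, ⟨v, rfl⟩, rfl⟩
  exact (Set.ncard_le_ncard hsub (Set.toFinite _)).trans (Set.ncard_image_le (Set.toFinite _))

theorem IsPartialDecomposition.isClusterColoring (h : IsPartialDecomposition G k c lab K)
    (hK : activeLabels lab K = ∅) : IsClusterColoring G k c lab fun A => (K A).color := by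
  have hdone : ∀ v, ∃ i, K (lab v) = .done i := fun v =>
    (h.source_or_done (lab v)).resolve_left fun hv => Set.eq_empty_iff_forall_notMem.1 hK (lab v)
      ⟨⟨v, rfl⟩, hv⟩
  refine ⟨fun v => ?_, fun u v huv hdist => ?_⟩
  · obtain ⟨i, hi⟩ := hdone v
    rw [hi]
    exact h.color_lt v i hi
  · obtain ⟨i, hi⟩ := hdone u
    obtain ⟨i', hi'⟩ := hdone v
    rw [hi, hi'] at huv
    obtain rfl : i = i' := huv
    exact h.lab_eq u v i hi hi' hdist

theorem decompose_apply [Finite V] [Nonempty V] {ident : V → BitVec S} (hS : 1 ≤ S) (hk : 1 ≤ k)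
    (hr : 1 ≤ r) (hc : IsClustering G r center) (hN : (Set.range center).ncard = N)
    (hident : Set.InjOn ident (Set.range center)) :
    ∃ (ldr : Fin (2 ^ S) → V) (lab : V → Fin (2 ^ S)) (rel : V → Set (Fin (2 ^ S)))
      (K : Fin (2 ^ S) → Status),
      decompose N S k r V G (clusterInput ident center) =
        config (fun v => (ident (center v)).toFin) lab rel K ∧
      ClusterInv G k (k * r * 16 ^ scale N) (r * 16 ^ scale N) (1 + 2 * scale N) ldr lab rel ∧
      IsClusterColoring G k (decompositionBound N) lab (fun A => (K A).color) ∧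
      (∀ v, lab (center v) = lab v) ∧
      ∀ v, ∀ l ∈ rel v, (ident (center (ldr l))).toFin = l := by
  set s := scale N
  have hbits : 1 ≤ finalBits (3 * (s + 1)) := by rw [finalBits]; lia
  obtain ⟨ldr, hldr, inv⟩ := exists_clusterInv_of_isClustering (name := fun v => (ident v).toFin)
    hk hc fun _ hu _ hv huv => hident hu hv (BitVec.toFin_inj.1 huv)
  obtain ⟨nl, rel, K, hrun, inv', hdec, hactive, hlab⟩ :=
    levels_config (me := fun v => (ident (center v)).toFin)
      (inv.mono (Nat.le_mul_of_pos_left r hk) le_rfl le_rfl) (Nat.le_mul_of_pos_right k hr) hr rfl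
      (by rw [← pow_mul, mul_comm]) hS (by simp)
      (fun t => (bitSeq_le (3 * (s + 1)) S t).trans
        (max_le (Nat.le_mul_of_pos_left _ hbits) (Nat.le_mul_of_pos_right _ hS)))
      (Nat.pow_le_pow_right two_pos (bitSeq_two_mul_logStar_le _ _)) (le_refl s)
  have hnone : activeLabels (fun v => nl (ident (center v)).toFin) K = ∅ := by
    refine (Set.ncard_eq_zero (Set.toFinite _)).1 (Nat.eq_zero_of_not_pos fun hpos => ?_)
    have hle := (Nat.le_mul_of_pos_left (2 ^ (s * s)) hpos).trans
      (hactive.trans (ncard_activeLabels_le (name := fun v => (ident v).toFin)))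
    exact absurd (hle.trans_eq hN) (not_le.2 (lt_two_pow_scale_mul_scale N))
  have hcol := hdec.isClusterColoring hnone
  have hbound : s * 2 ^ finalBits (3 * (s + 1)) ≤ decompositionBound N :=
    mul_two_pow_finalBits_le (one_le_scale N)
  refine ⟨ldr, fun v => nl (ident (center v)).toFin, rel, K, ?_, inv',
    ⟨fun v => (hcol.color_lt v).trans_le hbound, hcol.lab_eq⟩,
    fun v => congrArg (fun u => nl (ident u).toFin) (hc.center_center v), fun v l hl => ?_⟩
  · rw [decompose, NetMap.andThen]
    exact hrun
  · obtain ⟨w, hw⟩ := hlab (ldr l)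
    rw [inv'.lab_ldr v l hl] at hw
    rw [hw, hldr w, hc.center_center]

end decompose

/-! ### The guarantees of the algorithm -/

section guarantees

variable {B S N k r c D T T' a : ℕ}

/-- After `T` rounds, `A` has computed a `(c, D)` network decomposition of the `k`-th power of any
network that is initially partitioned into `N` clusters of radius at most `r`, without breaking
these clusters. -/
def DecomposesPower (A : CongestAlgorithm (BitVec S × Bool) (ℕ × BitVec S) B) (N k r c D T : ℕ) :
    Prop :=
  ∀ (V : Type) [Fintype V] (G : SimpleGraph V) (P : PortNumbering G) (center : V → V)
    (ident : V → BitVec S), IsClustering G r center → (Set.range center).ncard = N →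
    Set.InjOn ident (Set.range center) →
    OutputsDecomposition (powerGraph G k) c D (fun v => ident (center v))
      (A.result P (clusterInput ident center) T) ∧
    ∀ v, SameCluster (powerGraph G k) (fun w => (A.result P (clusterInput ident center) T w).1)
      (center v) v

/-- Once `A` has been run for `T` rounds on a network of `N` nodes, products of values of `a * S`
bits can be computed in all clusters simultaneously in `T'` more rounds. -/
def AggregatesAfter (A : CongestAlgorithm (BitVec S × Bool) (ℕ × BitVec S) B) (N k a T T' : ℕ) :
    Prop :=
  ∀ (M : Type) [CommMonoid M] [Finite M], Nat.card M ≤ 2 ^ (a * S) →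
    ∃ R : CongestAlgorithm (A.State × M) M B,
    ∀ (V : Type) [Fintype V] (G : SimpleGraph V) (P : PortNumbering G) (ident : V → BitVec S),
      Fintype.card V = N → Function.Injective ident → ∀ (x : V → M) (v : V),
      R.result P (fun u => (A.run P (fun w => (ident w, true)) T u, x u)) T' v =
      ∏ u ∈ clusterOf (powerGraph G k)
        (fun w => (A.result P (fun w => (ident w, true)) T w).1) v, x u

theorem outputsDecomposition_of_isEmpty {V : Type} [IsEmpty V] (H : SimpleGraph V) (c d : ℕ)
    (ident : V → BitVec S) (out : V → ℕ × BitVec S) : OutputsDecomposition H c d ident out :=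
  ⟨⟨isEmptyElim, isEmptyElim⟩, isEmptyElim, isEmptyElim⟩

theorem clusterInput_id {V : Type} (ident : V → BitVec S) :
    clusterInput ident id = fun v => (ident v, true) := by
  funext v
  simp [clusterInput]

theorem isClustering_id {V : Type} (G : SimpleGraph V) (r : ℕ) : IsClustering G r id :=
  ⟨fun _ => rfl, fun _ => ⟨.nil, by simp, by simp⟩⟩

theorem ncard_range_id {V : Type} [Fintype V] :
    (Set.range (id : V → V)).ncard = Fintype.card V := by
  rw [Set.range_id, Set.ncard_univ, Nat.card_eq_fintype_card]

theorem DecomposesPower.outputsDecomposition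
    {A : CongestAlgorithm (BitVec S × Bool) (ℕ × BitVec S) B} (h : DecomposesPower A N k r c D T)
    {V : Type} [Fintype V] {G : SimpleGraph V} (P : PortNumbering G) {ident : V → BitVec S}
    (hN : Fintype.card V = N) (hident : Function.Injective ident) :
    OutputsDecomposition (powerGraph G k) c D ident
      (A.result P (fun v => (ident v, true)) T) := by
  rw [← clusterInput_id]
  exact (h V G P id ident (isClustering_id G r) (ncard_range_id.trans hN) hident.injOn).1

/-- The algorithm without communication that uses the identifiers as colors. -/
def identAsColor (B S : ℕ) : CongestAlgorithm (BitVec S × Bool) (ℕ × BitVec S) B :=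
  .idle fun x => (x.1.toFin, x.1)

theorem isClusterColoring_val {V : Type} {n : ℕ} (hn : n ≤ c) (G : SimpleGraph V) (k : ℕ)
    (lab : V → Fin n) : IsClusterColoring G k c lab Fin.val :=
  ⟨fun v => (lab v).is_lt.trans_le hn, fun _ _ h _ => Fin.ext h⟩

theorem decomposesPower_identAsColor (hk : 1 ≤ k) (hc : 2 ^ S ≤ c) (hD : 2 * r ≤ D) :
    DecomposesPower (identAsColor B S) N k r c D T := by
  intro V _ G P center ident hcenter _ hident
  rw [identAsColor, CongestAlgorithm.result_idle]
  rcases isEmpty_or_nonempty V with hV | hV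
  · exact ⟨outputsDecomposition_of_isEmpty .., isEmptyElim⟩
  obtain ⟨ldr, hldr, inv⟩ := exists_clusterInv_of_isClustering (name := fun v => (ident v).toFin)
    hk hcenter fun _ hu _ hv huv => hident hu hv (BitVec.toFin_inj.1 huv)
  have hcol := isClusterColoring_val hc G k fun v => (ident (center v)).toFin
  refine ⟨inv.outputsDecomposition hcol hD (name := BitVec.ofFin)
    (fun _ _ => BitVec.ofFin.inj) fun v => ?_, fun v => (inv.sameCluster_iff hcol).2 ?_⟩
  · rw [hldr, hcenter.center_center]
  · rw [hcenter.center_center]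

theorem aggregatesAfter_identAsColor (hk : 1 ≤ k) :
    AggregatesAfter (identAsColor B S) N k a T T' := by
  intro M _ _ _
  refine ⟨.idle Prod.snd, fun V _ G P ident _ hident x v => ?_⟩
  have : Nonempty V := ⟨v⟩
  rw [CongestAlgorithm.result_idle, identAsColor, CongestAlgorithm.result_idle]
  have htoFin : Function.Injective fun v => (ident v).toFin :=
    fun _ _ huv => hident (BitVec.toFin_inj.1 huv)
  obtain ⟨_, -, inv⟩ := exists_clusterInv_of_isClustering hk (isClustering_id G 0) htoFin.injOn
  have hcol := isClusterColoring_val (le_refl (2 ^ S)) G k fun v => (ident v).toFin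
  refine Eq.trans (Finset.prod_eq_single v (fun u hu hne => ?_) fun hv => ?_).symm
    (inv.prod_clusterOf hcol x v).symm
  · simp only [Finset.mem_filter] at hu
    exact absurd (htoFin hu.2).symm hne
  · simp at hv

/-- The algorithm whose nodes output their color and the label of their cluster, where `A` computes
the local data. -/
abbrev outputDecomposition (A : CongestAlgorithm (BitVec S × Bool) (Node (Fin (2 ^ S)) Status) B) :
    CongestAlgorithm (BitVec S × Bool) (ℕ × BitVec S) B :=
  A.dimap id fun x => (x.dat.color, BitVec.ofFin x.lab)

variable {A : CongestAlgorithm (BitVec S × Bool) (Node (Fin (2 ^ S)) Status) B}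

theorem decomposesPower_outputDecomposition (hS : 1 ≤ S) (hk : 1 ≤ k) (hr : 1 ≤ r)
    (hA : ∀ (V : Type) (G : SimpleGraph V) (P : PortNumbering G) (x : V → BitVec S × Bool),
      A.result P x T = decompose N S k r V G x) :
    DecomposesPower (outputDecomposition A) N k r (decompositionBound N)
      (r * decompositionBound N) T := by
  intro V _ G P center ident hc hN hident
  rw [CongestAlgorithm.result_dimap, Function.id_comp, hA]
  rcases isEmpty_or_nonempty V with hV | hV
  · exact ⟨outputsDecomposition_of_isEmpty .., isEmptyElim⟩
  obtain ⟨ldr, lab, rel, K, hrun, inv, hcol, hcenter, hldr⟩ :=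
    decompose_apply hS hk hr hc hN hident
  rw [hrun]
  exact ⟨inv.outputsDecomposition hcol (two_mul_radius_le (one_le_scale N) r)
    (fun _ _ => BitVec.ofFin.inj) fun v => congrArg BitVec.ofFin (hldr v _ (inv.lab_mem v)),
    fun v => (inv.sameCluster_iff hcol).2 (hcenter v)⟩

theorem aggregatesAfter_outputDecomposition
    {A : CongestAlgorithm (BitVec S × Bool) (Node (Fin (2 ^ S)) Status) S} (hS : 1 ≤ S)
    (hk : 1 ≤ k) (hr : 1 ≤ r)
    (hA : ∀ (V : Type) (G : SimpleGraph V) (P : PortNumbering G) (x : V → BitVec S × Bool),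
      A.result P x T = decompose N S k r V G x) (a : ℕ) :
    AggregatesAfter (outputDecomposition A) N k a T
      (a * (k * r) * decompositionBound N) := by
  intro M _ _ hM
  rcases Nat.eq_zero_or_pos a with rfl | ha
  · rw [Nat.zero_mul, pow_zero, Finite.card_le_one_iff_subsingleton] at hM
    exact ⟨.idle Prod.snd, fun _ _ _ _ _ _ _ _ _ => Subsingleton.elim _ _⟩
  have hcost : k * r * 16 ^ scale N * (1 + 2 * scale N) * (9 + 2 * a) ≤
      a * (k * r) * decompositionBound N := aggregate_rounds_le (one_le_scale N) ha (k * r)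
  obtain ⟨R, hR⟩ := (Realizable.aggregate (κ := Status) (W := Fin (2 ^ S)) hS (by simp) hM _
    _).mono hcost
  refine ⟨R.dimap (fun p => (A.output p.1, p.2)) id, fun V _ G P ident hN hident x v => ?_⟩
  have : Nonempty V := ⟨v⟩
  obtain ⟨ldr, lab, rel, K, hrun, inv, hcol, -, hldr⟩ :=
    decompose_apply hS hk hr (isClustering_id G r) (ncard_range_id.trans hN) hident.injOn
  rw [clusterInput_id] at hrun
  have hresult : A.result P (fun w => (ident w, true)) T =
      config (fun v => (ident v).toFin) lab rel K := (hA V G P _).trans hrun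
  have hinput : (fun u => (A.output (A.run P (fun w => (ident w, true)) T u), x u)) =
      fun u => (config (fun v => (ident v).toFin) lab rel K u, x u) :=
    funext fun u => congrArg (·, x u) (congrFun hresult u)
  simp only [CongestAlgorithm.result_dimap, CongestAlgorithm.run_dimap, Function.id_comp, hresult]
  refine Eq.trans ?_ ((aggregate_apply inv (fun _ _ h => hident (BitVec.toFin_inj.1 h)) hldr K x
    v).trans (inv.prod_clusterOf hcol x v).symm)
  rw [← hR V G P, ← hinput]
  rfl

theorem exists_algorithm (N S : ℕ) (hk : 1 ≤ k) (hr : 1 ≤ r) :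
    ∃ A : CongestAlgorithm (BitVec S × Bool) (ℕ × BitVec S) (1 * S),
      DecomposesPower A N k r (decompositionBound N) (r * decompositionBound N)
        (k * r * decompositionBound N * logStar S) ∧
      ∀ a, AggregatesAfter A N k a (k * r * decompositionBound N * logStar S)
        (a * (k * r) * decompositionBound N) := by
  rw [one_mul]
  rcases Nat.lt_or_ge S 2 with hS | hS
  · have hcolors : 2 ^ S ≤ decompositionBound N :=
      (Nat.pow_le_pow_right two_pos (Nat.le_of_lt_succ hS)).trans (two_le_decompositionBound N)
    have hdiam : 2 * r ≤ r * decompositionBound N := by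
      rw [mul_comm]
      exact Nat.mul_le_mul_left r (two_le_decompositionBound N)
    exact ⟨identAsColor S S, decomposesPower_identAsColor hk hcolors hdiam,
      fun _ => aggregatesAfter_identAsColor hk⟩
  · obtain ⟨A, hA⟩ := Realizable.decompose N k hS hr
    exact ⟨outputDecomposition A,
      decomposesPower_outputDecomposition (Nat.one_le_of_lt hS) hk hr hA,
      aggregatesAfter_outputDecomposition (Nat.one_le_of_lt hS) hk hr hA⟩

end guarantees

end NetworkDecomposition

theorem mainTheorem1 :
    ∃ (g : ℕ → ℕ) (c : ℕ)
      -- the algorithm; `N`, `S`, `k` and the radius `r` of the initial clusters are common knowledge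
      (A : ∀ _N S _k _r : ℕ, CongestAlgorithm (BitVec S × Bool) (ℕ × BitVec S) (c * S)),
      IsTwoPowBigOSqrtLog g ∧
      -- network decomposition of `G^k` on a network of `N` nodes with `S`-bit identifiers
      (∀ N S k : ℕ, 1 ≤ k →
        ∀ (V : Type) [Fintype V] (G : SimpleGraph V) (P : PortNumbering G) (ident : V → BitVec S),
          Fintype.card V = N → Function.Injective ident →
          OutputsDecomposition (powerGraph G k) (g N) (g N) ident
            ((A N S k 0).result P (fun v => (ident v, true)) (k * g N * logStar S))) ∧
      -- a round of communication within the clusters: every node contributes a value of `a * S`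
      -- bits, and every node learns the product of all values in its cluster. This is a
      -- convergecast and a broadcast in all clusters at once, for an arbitrary way of
      -- aggregating values. The nodes start from their final states in the above execution.
      (∀ N S k a : ℕ, 1 ≤ k →
        ∀ (M : Type) [CommMonoid M] [Finite M], Nat.card M ≤ 2 ^ (a * S) →
        ∃ R : CongestAlgorithm ((A N S k 0).State × M) M (c * S),
        ∀ (V : Type) [Fintype V] (G : SimpleGraph V) (P : PortNumbering G) (ident : V → BitVec S),
          Fintype.card V = N → Function.Injective ident →
          ∀ (x : V → M) (v : V),
            R.result P
              (fun u => ((A N S k 0).run P (fun w => (ident w, true)) (k * g N * logStar S) u, x u))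
              (a * k * g N) v =
            ∏ u ∈ clusterOf (powerGraph G k)
                (fun w => ((A N S k 0).result P (fun w => (ident w, true))
                  (k * g N * logStar S) w).1) v, x u) ∧
      -- the variant that starts from `N` clusters of radius at most `r`
      (∀ N S k r : ℕ, 1 ≤ k → 1 ≤ r →
        ∀ (V : Type) [Fintype V] (G : SimpleGraph V) (P : PortNumbering G) (center : V → V)
          (ident : V → BitVec S),
          IsClustering G r center → (Set.range center).ncard = N →
          Set.InjOn ident (Set.range center) →
          OutputsDecomposition (powerGraph G k) (g N) (r * g N) (fun v => ident (center v))
            ((A N S k r).result P (clusterInput ident center) (k * r * g N * logStar S)) ∧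
          -- initial clusters are not broken
          ∀ v, SameCluster (powerGraph G k)
            (fun w => ((A N S k r).result P (clusterInput ident center)
              (k * r * g N * logStar S) w).1) (center v) v) := by
  choose A hA using fun N S k r : ℕ =>
    NetworkDecomposition.exists_algorithm N S (le_max_right k 1) (le_max_right r 1)
  refine ⟨NetworkDecomposition.decompositionBound, 1, A,
    NetworkDecomposition.isTwoPowBigOSqrtLog_decompositionBound, ?_, ?_, ?_⟩
  · intro N S k hk V _ G P ident hN hident
    have hdecomposes := (hA N S k 0).1
    simp only [max_eq_left hk, max_eq_right zero_le_one, mul_one, one_mul] at hdecomposes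
    exact hdecomposes.outputsDecomposition P hN hident
  · intro N S k a hk
    have haggregates := (hA N S k 0).2 a
    simp only [max_eq_left hk, max_eq_right zero_le_one, mul_one] at haggregates
    exact haggregates
  · intro N S k r hk hr
    have hdecomposes := (hA N S k r).1
    rwa [max_eq_left hk, max_eq_left hr] at hdecomposes
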